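/- Consider an episodic two-player zero-sum Markov game with finite state space $\mathcal S_1\times\mathcal S_2$, finite action sets $\mathcal A,\mathcal B$, horizon $H\ge 1$, fixed initial state $s_1=(s_1^1,s_1^2)$, unknown factored transitions $\mathcal P_h(s'\mid s,a,b)=\mathcal P^1_h(s^{1\prime}\mid s^1,a)\,\mathcal P^2_h(s^{2\prime}\mid s^2,b)$ and mean rewards $r_h(s,a,b)\in[0,1]$. Policies of Player 1 have the form $\mu_h(a\mid s^1)$, policies of Player 2 the form $\nu_h(b\mid s^2)$, and $V_1^{\mu,\nu}(s_1)$ is the expected total reward of an episode. The game is played for $K\ge1$ episodes: in episode $k$ the players act simultaneously and independently according to $\mu^k,\nu^k$; they observe the trajectory $(s_h^k,a_h^k,b_h^k,s_{h+1}^k)_{h\le H}$ and the rewards $r_h^k\in[0,1]$ along it, where $r_h^k$ has conditional mean $r_h(s_h^k,a_h^k,b_h^k)$ given the past and the current state and actions. Fix $\delta\in(0,1)$. For $k\ge1$ let $N_h^k(\cdot)$ be the number of visits at step $h$ in episodes $1,\dots,k$, and let $$\hat r_h^k(s,a,b)=\frac{\sum_{\tau\le k}\mathbf 1\{(s_h^\tau,a_h^\tau,b_h^\tau)=(s,a,b)\}\,r_h^\tau}{\max\{N_h^k(s,a,b),1\}},$$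 $$\hat{\mathcal P}^{1,k}_h(s^{1\prime}\mid s^1,a)=\frac{N_h^k(s^1,a,s^{1\prime})}{\max\{N_h^k(s^1,a),1\}},\qquad \hat{\mathcal P}^{2,k}_h(s^{2\prime}\mid s^2,b)=\frac{N_h^k(s^2,b,s^{2\prime})}{\max\{N_h^k(s^2,b),1\}},\qquad \hat{\mathcal P}^k_h=\hat{\mathcal P}^{1,k}_h\hat{\mathcal P}^{2,k}_h,$$ $$\beta_h^k(s,a,b)=\sqrt{\tfrac{4\log(|\mathcal S_1||\mathcal S_2||\mathcal A||\mathcal B|HK/\delta)}{\max\{N_h^k(s,a,b),1\}}}+\sqrt{\tfrac{2H^2|\mathcal S_1|\log(2|\mathcal S_1||\mathcal A|HK/\delta)}{\max\{N_h^k(s^1,a),1\}}}+\sqrt{\tfrac{2H^2|\mathcal S_2|\log(2|\mathcal S_2||\mathcal B|HK/\delta)}{\max\{N_h^k(s^2,b),1\}}}.$$ For $k=0$ let $\hat r^0=\beta^0=0$ and let $\hat{\mathcal P}^{1,0},\hat{\mathcal P}^{2,0},\mu^0,\nu^0$ be uniform. With $\overline V^k_{H+1}=\underline V^k_{H+1}=0$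 define, for $h=H,\dots,1$, $$\overline Q_h^k=\max\{\min\{\hat r_h^k+\hat{\mathcal P}_h^k\overline V_{h+1}^k+\beta_h^k,\,H-h+1\},0\},\qquad \overline V_h^k(s)=\mu_h^k(\cdot\mid s^1)^\top\,\overline Q_h^k(s,\cdot,\cdot)\,\nu_h^k(\cdot\mid s^2),$$ $$\underline Q_h^k=\max\{\min\{\hat r_h^k+\hat{\mathcal P}_h^k\underline V_{h+1}^k-\beta_h^k,\,H-h+1\},0\},\qquad \underline V_h^k(s)=\mu_h^k(\cdot\mid s^1)^\top\,\underline Q_h^k(s,\cdot,\cdot)\,\nu_h^k(\cdot\mid s^2).$$ Let $d_h^{1,k}(s^1)$ and $d_h^{2,k}(s^2)$ be the state reaching probabilities at step $h$, starting from $s_1^1$ and $s_1^2$, under $(\mu^k,\hat{\mathcal P}^{1,k})$ and $(\nu^k,\hat{\mathcal P}^{2,k})$, respectively. The two algorithms, run simultaneously, compute for $k=0,\dots,K-1$ and all $h$, $s^1$, $s^2$ (with maximum and minimum over probability distributions on $\mathcal A$, $\mathcal B$) $$\mu_h^{k+1}(\cdot\mid s^1)=\arg\max_{p}\Big\{\Big\langle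 p-\mu_h^k(\cdot\mid s^1),\sum_{s^2}\overline Q_h^k(s,\cdot,\cdot)\,\nu_h^k(\cdot\mid s^2)\,d_h^{2,k}(s^2)\Big\rangle-\eta^{-1}D_{\mathrm{KL}}\big(p,\mu_h^k(\cdot\mid s^1)\big)\Big\},$$ $$\nu_h^{k+1}(\cdot\mid s^2)=\arg\min_{p}\Big\{\Big\langle p-\nu_h^k(\cdot\mid s^2),\sum_{s^1}\underline Q_h^k(s,\cdot,\cdot)^\top\mu_h^k(\cdot\mid s^1)\,d_h^{1,k}(s^1)\Big\rangle+\gamma^{-1}D_{\mathrm{KL}}\big(p,\nu_h^k(\cdot\mid s^2)\big)\Big\},$$ where $\eta=\sqrt{\log|\mathcal A|/(KH^2)}$ and $\gamma=\sqrt{\log|\mathcal B|/(KH^2)}$. Put $T=KH$, $$C=\sqrt{(|\mathcal S_1|^2|\mathcal A|+|\mathcal S_2|^2|\mathcal B|)H^3}+\sqrt{|\mathcal S_1||\mathcal S_2||\mathcal A||\mathcal B|H},$$ $$\mathrm{Regret}_1(K)=\max_\mu\sum_{k=1}^K V_1^{\mu,\nu^k}(s_1)-\sum_{k=1}^K V_1^{\mu^k,\nu^k}(s_1),\qquad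 \mathrm{Regret}_2(K)=\sum_{k=1}^K V_1^{\mu^k,\nu^k}(s_1)-\min_\nu\sum_{k=1}^K V_1^{\mu^k,\nu}(s_1).$$ Then there are universal constants $c>0$ and $m\in\mathbb N$, independent of the game, $K$ and $\delta$, such that with probability at least $1-8\delta$ $$\mathrm{Gap}(K)=\mathrm{Regret}_1(K)+\mathrm{Regret}_2(K)\le c\,C\sqrt T\,\Big(\log\frac{|\mathcal S_1||\mathcal S_2||\mathcal A||\mathcal B|HK}{\delta}\Big)^m .$$ -/

import Mathlib

open MeasureTheory

noncomputable section

namespace FactoredMG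

/-- A Markov policy of one player that depends only on that player's own state component:
`π h s a` is the probability of action `a` in state `s` at step `h`.
Steps are numbered `0, …, H - 1` throughout. -/
abbrev Policy (S A : Type*) := ℕ → S → A → ℝ

/-- `π` is a genuine policy for an episode of length `H`. -/
def IsPolicy {S A : Type*} [Fintype A] (H : ℕ) (π : Policy S A) : Prop :=
  ∀ h < H, ∀ s, π h s ∈ stdSimplex ℝ A

/-- An episodic two-player zero-sum Markov game with state space `S₁ × S₂`, horizon `H`,
factored independent transitions `P₁ h s¹ a s¹' * P₂ h s² b s²'`, mean rewards
`r h s¹ s² a b ∈ [0, 1]`, and a fixed initial state `(x₁, x₂)`. -/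
structure Game (S₁ S₂ A B : Type*) [Fintype S₁] [Fintype S₂] (H : ℕ) where
  P₁ : ℕ → S₁ → A → S₁ → ℝ
  P₂ : ℕ → S₂ → B → S₂ → ℝ
  r : ℕ → S₁ → S₂ → A → B → ℝ
  x₁ : S₁
  x₂ : S₂
  P₁_mem : ∀ h < H, ∀ s a, P₁ h s a ∈ stdSimplex ℝ S₁
  P₂_mem : ∀ h < H, ∀ s b, P₂ h s b ∈ stdSimplex ℝ S₂
  r_mem : ∀ h < H, ∀ s t a b, r h s t a b ∈ Set.Icc (0 : ℝ) 1

section Value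

variable {S₁ S₂ A B : Type*} [Fintype S₁] [Fintype S₂] [Fintype A] [Fintype B]
  [DecidableEq S₁] [DecidableEq S₂] {H : ℕ}

/-- Probability that the `i`-th entry of the trajectory `τ`, which starts at step `h`, has the state
recorded there, given the previous entry; the starting state is `(s, t)`. -/
def Game.arrive (G : Game S₁ S₂ A B H) (h : ℕ) (s : S₁) (t : S₂) {n : ℕ}
    (τ : Fin n → S₁ × S₂ × A × B) : Fin n → ℝ
  | ⟨0, hi⟩ => if (τ ⟨0, hi⟩).1 = s ∧ (τ ⟨0, hi⟩).2.1 = t then 1 else 0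
  | ⟨i + 1, hi⟩ =>
      let prev := τ ⟨i, Nat.lt_of_succ_lt hi⟩
      let next := τ ⟨i + 1, hi⟩
      G.P₁ (h + i) prev.1 prev.2.2.1 next.1 * G.P₂ (h + i) prev.2.1 prev.2.2.2 next.2.1

/-- Probability of the trajectory `τ = ((s_{h+i}, a_{h+i}, b_{h+i}))_{i < n}` when the game is in
state `(s, t)` at step `h` and the players follow `μ` and `ν`. -/
def Game.trajProb (G : Game S₁ S₂ A B H) (μ : Policy S₁ A) (ν : Policy S₂ B)
    (h : ℕ) (s : S₁) (t : S₂) {n : ℕ} (τ : Fin n → S₁ × S₂ × A × B) : ℝ :=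
  ∏ i : Fin n, G.arrive h s t τ i *
    (μ (h + i) (τ i).1 (τ i).2.2.1 * ν (h + i) (τ i).2.1 (τ i).2.2.2)

/-- The value function: expected total reward collected from step `h` on to the end of the episode,
starting from state `(s, t)`. -/
def Game.value (G : Game S₁ S₂ A B H) (μ : Policy S₁ A) (ν : Policy S₂ B)
    (h : ℕ) (s : S₁) (t : S₂) : ℝ :=
  ∑ τ : Fin (H - h) → S₁ × S₂ × A × B,
    G.trajProb μ ν h s t τ * ∑ i : Fin (H - h), G.r (h + i) (τ i).1 (τ i).2.1 (τ i).2.2.1 (τ i).2.2.2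

/-- Regret of Player 1 over episodes `1, …, K` against the best policy in hindsight
(the supremum over the compact set of policies is attained). -/
def Game.regret₁ (G : Game S₁ S₂ A B H) (K : ℕ)
    (μ : ℕ → Policy S₁ A) (ν : ℕ → Policy S₂ B) : ℝ :=
  (⨆ μ' : {π : Policy S₁ A // IsPolicy H π},
      ∑ k ∈ Finset.Icc 1 K, G.value μ'.1 (ν k) 0 G.x₁ G.x₂) -
    ∑ k ∈ Finset.Icc 1 K, G.value (μ k) (ν k) 0 G.x₁ G.x₂

/-- Regret of Player 2 over episodes `1, …, K` against the best policy in hindsight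
(the infimum over the compact set of policies is attained). -/
def Game.regret₂ (G : Game S₁ S₂ A B H) (K : ℕ)
    (μ : ℕ → Policy S₁ A) (ν : ℕ → Policy S₂ B) : ℝ :=
  (∑ k ∈ Finset.Icc 1 K, G.value (μ k) (ν k) 0 G.x₁ G.x₂) -
    ⨅ ν' : {π : Policy S₂ B // IsPolicy H π},
      ∑ k ∈ Finset.Icc 1 K, G.value (μ k) ν'.1 0 G.x₁ G.x₂

/-- The optimality gap. -/
def Game.gap (G : Game S₁ S₂ A B H) (K : ℕ)
    (μ : ℕ → Policy S₁ A) (ν : ℕ → Policy S₂ B) : ℝ :=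
  G.regret₁ K μ ν + G.regret₂ K μ ν

end Value

/-- The observations: states, actions and bandit rewards, indexed by the episode `k ≥ 1` and the
step. States carry steps `0, …, H`, actions and rewards carry steps `0, …, H - 1`; the other entries
are never used. -/
structure Record (S₁ S₂ A B : Type*) where
  s₁ : ℕ → ℕ → S₁
  s₂ : ℕ → ℕ → S₂
  a : ℕ → ℕ → A
  b : ℕ → ℕ → B
  rew : ℕ → ℕ → ℝ

section Estimates

variable {S₁ S₂ A B : Type*} [Fintype S₁] [Fintype S₂] [Fintype A] [Fintype B]
  [DecidableEq S₁] [DecidableEq S₂] [DecidableEq A] [DecidableEq B]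

/-- Number of visits of `(s¹, s², a, b)` at step `h` in episodes `1, …, k`. -/
def Record.count (D : Record S₁ S₂ A B) (k h : ℕ) (s : S₁) (t : S₂) (a : A) (b : B) : ℕ :=
  ((Finset.Icc 1 k).filter fun j =>
    D.s₁ j h = s ∧ D.s₂ j h = t ∧ D.a j h = a ∧ D.b j h = b).card

/-- Number of visits of `(s¹, a)` at step `h` in episodes `1, …, k`. -/
def Record.count₁ (D : Record S₁ S₂ A B) (k h : ℕ) (s : S₁) (a : A) : ℕ :=
  ((Finset.Icc 1 k).filter fun j => D.s₁ j h = s ∧ D.a j h = a).card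

/-- Number of visits of `(s², b)` at step `h` in episodes `1, …, k`. -/
def Record.count₂ (D : Record S₁ S₂ A B) (k h : ℕ) (t : S₂) (b : B) : ℕ :=
  ((Finset.Icc 1 k).filter fun j => D.s₂ j h = t ∧ D.b j h = b).card

/-- Empirical mean reward (it is `0` for `k = 0`). -/
def Record.rHat (D : Record S₁ S₂ A B) (k h : ℕ) (s : S₁) (t : S₂) (a : A) (b : B) : ℝ :=
  (∑ j ∈ Finset.Icc 1 k,
      if D.s₁ j h = s ∧ D.s₂ j h = t ∧ D.a j h = a ∧ D.b j h = b then D.rew j h else 0) /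
    max (D.count k h s t a b : ℝ) 1

/-- Empirical transition model of Player 1, uniform for `k = 0`. -/
def Record.PHat₁ (D : Record S₁ S₂ A B) (k h : ℕ) (s : S₁) (a : A) (s' : S₁) : ℝ :=
  if k = 0 then 1 / (Fintype.card S₁ : ℝ) else
    (((Finset.Icc 1 k).filter fun j =>
        D.s₁ j h = s ∧ D.a j h = a ∧ D.s₁ j (h + 1) = s').card : ℝ) /
      max (D.count₁ k h s a : ℝ) 1

/-- Empirical transition model of Player 2, uniform for `k = 0`. -/
def Record.PHat₂ (D : Record S₁ S₂ A B) (k h : ℕ) (t : S₂) (b : B) (t' : S₂) : ℝ :=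
  if k = 0 then 1 / (Fintype.card S₂ : ℝ) else
    (((Finset.Icc 1 k).filter fun j =>
        D.s₂ j h = t ∧ D.b j h = b ∧ D.s₂ j (h + 1) = t').card : ℝ) /
      max (D.count₂ k h t b : ℝ) 1

/-- Reward part of the exploration bonus. -/
def Record.bonusR (D : Record S₁ S₂ A B) (H K : ℕ) (δ : ℝ) (k h : ℕ)
    (s : S₁) (t : S₂) (a : A) (b : B) : ℝ :=
  Real.sqrt (4 * Real.log ((Fintype.card S₁ : ℝ) * Fintype.card S₂ * Fintype.card A *
      Fintype.card B * H * K / δ) / max (D.count k h s t a b : ℝ) 1)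

/-- Transition part of the exploration bonus. -/
def Record.bonusP (D : Record S₁ S₂ A B) (H K : ℕ) (δ : ℝ) (k h : ℕ)
    (s : S₁) (t : S₂) (a : A) (b : B) : ℝ :=
  Real.sqrt (2 * (H : ℝ) ^ 2 * Fintype.card S₁ *
      Real.log (2 * (Fintype.card S₁ : ℝ) * Fintype.card A * H * K / δ) /
        max (D.count₁ k h s a : ℝ) 1) +
    Real.sqrt (2 * (H : ℝ) ^ 2 * Fintype.card S₂ *
      Real.log (2 * (Fintype.card S₂ : ℝ) * Fintype.card B * H * K / δ) /
        max (D.count₂ k h t b : ℝ) 1)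

/-- The exploration bonus, `0` for `k = 0`. -/
def Record.bonus (D : Record S₁ S₂ A B) (H K : ℕ) (δ : ℝ) (k h : ℕ)
    (s : S₁) (t : S₂) (a : A) (b : B) : ℝ :=
  if k = 0 then 0 else D.bonusR H K δ k h s t a b + D.bonusP H K δ k h s t a b

/-- The estimated Q-function at step `h` built from the estimated value function `V` of the next
step, with the (signed) bonus `β`: the truncation `min {r̂ + P̂ V + β, H - h}⁺`, where `H - h` is the
number of remaining steps. -/
def Record.backup (D : Record S₁ S₂ A B) (H k : ℕ) (β : ℕ → S₁ → S₂ → A → B → ℝ)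
    (V : S₁ → S₂ → ℝ) (h : ℕ) (s : S₁) (t : S₂) (a : A) (b : B) : ℝ :=
  max (min (D.rHat k h s t a b +
      (∑ s', ∑ t', D.PHat₁ k h s a s' * D.PHat₂ k h t b t' * V s' t') + β h s t a b)
    ((H : ℝ) - h)) 0

/-- The estimated value function with `n` remaining steps, i.e. at step `H - n`. -/
def Record.vEst (D : Record S₁ S₂ A B) (H k : ℕ) (β : ℕ → S₁ → S₂ → A → B → ℝ)
    (μ : Policy S₁ A) (ν : Policy S₂ B) : ℕ → S₁ → S₂ → ℝ
  | 0 => fun _ _ => 0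
  | n + 1 => fun s t =>
      ∑ a, ∑ b, μ (H - (n + 1)) s a *
        D.backup H k β (D.vEst H k β μ ν n) (H - (n + 1)) s t a b * ν (H - (n + 1)) t b

/-- The estimated Q-function at step `h < H`. -/
def Record.qEst (D : Record S₁ S₂ A B) (H k : ℕ) (β : ℕ → S₁ → S₂ → A → B → ℝ)
    (μ : Policy S₁ A) (ν : Policy S₂ B) (h : ℕ) : S₁ → S₂ → A → B → ℝ :=
  D.backup H k β (D.vEst H k β μ ν (H - (h + 1))) h

/-- State reaching probabilities of one player under policy `π` and transition model `P`, from the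
initial state `x`. -/
def reach {S C : Type*} [Fintype S] [Fintype C] [DecidableEq S]
    (x : S) (π : Policy S C) (P : ℕ → S → C → S → ℝ) : ℕ → S → ℝ
  | 0 => fun s => if s = x then 1 else 0
  | h + 1 => fun s => ∑ s', ∑ c, reach x π P h s' * π h s' c * P h s' c s

/-- Kullback–Leibler divergence of two distributions on a finite set. -/
def klFin {C : Type*} [Fintype C] (p q : C → ℝ) : ℝ := ∑ c, p c * Real.log (p c / q c)

/-- Direction used in Player 1's mirror ascent step:
`∑_{s²} ⟨Q̄_h^k(s, a, ·), ν_h^k(· | s²)⟩ d_h(s²)`. -/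
def Record.grad₁ (D : Record S₁ S₂ A B) (H K : ℕ) (δ : ℝ) (x₂ : S₂) (k : ℕ)
    (μ : Policy S₁ A) (ν : Policy S₂ B) (h : ℕ) (s : S₁) (a : A) : ℝ :=
  ∑ t, (∑ b, D.qEst H k (D.bonus H K δ k) μ ν h s t a b * ν h t b) *
    reach x₂ ν (D.PHat₂ k) h t

/-- Direction used in Player 2's mirror descent step:
`∑_{s¹} ⟨Q̲_h^k(s, ·, b), μ_h^k(· | s¹)⟩ d_h(s¹)`; here the bonus is subtracted. -/
def Record.grad₂ (D : Record S₁ S₂ A B) (H K : ℕ) (δ : ℝ) (x₁ : S₁) (k : ℕ)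
    (μ : Policy S₁ A) (ν : Policy S₂ B) (h : ℕ) (t : S₂) (b : B) : ℝ :=
  ∑ s, (∑ a, D.qEst H k (fun h s t a b => -D.bonus H K δ k h s t a b) μ ν h s t a b * μ h s a) *
    reach x₁ μ (D.PHat₁ k) h s

/-- Player 1's policies `μ 0, …, μ K` are those produced by the optimistic policy optimization
algorithm with step size `η`, on the observations `D` and against the opponent's policies `ν`. -/
structure IsAlgorithm₁ (H K : ℕ) (δ η : ℝ) (x₂ : S₂) (D : Record S₁ S₂ A B)
    (μ : ℕ → Policy S₁ A) (ν : ℕ → Policy S₂ B) : Prop where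
  init : ∀ h < H, ∀ s a, μ 0 h s a = 1 / (Fintype.card A : ℝ)
  isPolicy : ∀ k < K, IsPolicy H (μ (k + 1))
  update : ∀ k < K, ∀ s : S₁,
    IsMaxOn (fun p : ℕ → A → ℝ => ∑ h ∈ Finset.range H,
        ((∑ a, (p h a - μ k h s a) * D.grad₁ H K δ x₂ k (μ k) (ν k) h s a) -
          η⁻¹ * klFin (p h) (μ k h s)))
      {p | ∀ h < H, p h ∈ stdSimplex ℝ A} (fun h => μ (k + 1) h s)

/-- Player 2's policies `ν 0, …, ν K` are those produced by the optimistic policy optimization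
algorithm with step size `γ`, on the observations `D` and against the opponent's policies `μ`. -/
structure IsAlgorithm₂ (H K : ℕ) (δ γ : ℝ) (x₁ : S₁) (D : Record S₁ S₂ A B)
    (μ : ℕ → Policy S₁ A) (ν : ℕ → Policy S₂ B) : Prop where
  init : ∀ h < H, ∀ t b, ν 0 h t b = 1 / (Fintype.card B : ℝ)
  isPolicy : ∀ k < K, IsPolicy H (ν (k + 1))
  update : ∀ k < K, ∀ t : S₂,
    IsMinOn (fun p : ℕ → B → ℝ => ∑ h ∈ Finset.range H,
        ((∑ b, (p h b - ν k h t b) * D.grad₂ H K δ x₁ k (μ k) (ν k) h t b) +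
          γ⁻¹ * klFin (p h) (ν k h t)))
      {p | ∀ h < H, p h ∈ stdSimplex ℝ B} (fun h => ν (k + 1) h t)

end Estimates

section Interaction

variable {S₁ S₂ A B Ω : Type*}

/-- σ-algebra generated by the joint state at step `h` of episode `k`. -/
@[reducible] def sigmaState (D : Ω → Record S₁ S₂ A B) (k h : ℕ) : MeasurableSpace Ω :=
  MeasurableSpace.comap (fun ω => ((D ω).s₁ k h, (D ω).s₂ k h)) ⊤

/-- σ-algebra generated by the two actions at step `h` of episode `k`. -/
@[reducible] def sigmaAct (D : Ω → Record S₁ S₂ A B) (k h : ℕ) : MeasurableSpace Ω :=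
  MeasurableSpace.comap (fun ω => ((D ω).a k h, (D ω).b k h)) ⊤

/-- σ-algebra generated by the reward at step `h` of episode `k`. -/
@[reducible] def sigmaRew (D : Ω → Record S₁ S₂ A B) (k h : ℕ) : MeasurableSpace Ω :=
  MeasurableSpace.comap (fun ω => (D ω).rew k h) inferInstance

/-- History just before the actions of step `h` of episode `k` are drawn: everything observed in
episodes `1, …, k - 1` and at the earlier steps of episode `k`, and the current state. -/
@[reducible] def history (H : ℕ) (D : Ω → Record S₁ S₂ A B) (k h : ℕ) : MeasurableSpace Ω :=
  (⨆ (j : ℕ) (i : ℕ) (_ : 1 ≤ j ∧ i ≤ H ∧ (j < k ∨ j = k ∧ i ≤ h)), sigmaState D j i) ⊔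
    ⨆ (j : ℕ) (i : ℕ) (_ : 1 ≤ j ∧ i < H ∧ (j < k ∨ j = k ∧ i < h)),
      sigmaAct D j i ⊔ sigmaRew D j i

/-- History just after the actions of step `h` of episode `k` are drawn. -/
@[reducible] def historyAct (H : ℕ) (D : Ω → Record S₁ S₂ A B) (k h : ℕ) : MeasurableSpace Ω :=
  history H D k h ⊔ sigmaAct D k h

/-- The random observations `D` arise from `K` episodes of the game `G` in which, in episode `k`, the
players simultaneously and independently draw their actions from `μ k` and `ν k`, the next state is
drawn from the true transition model, and the reward is a `[0, 1]`-valued random variable whose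
conditional mean is `G.r`; its law may otherwise depend on the past. -/
structure IsPlay [Fintype S₁] [Fintype S₂] [mΩ : MeasurableSpace Ω] (ℙ : Measure Ω)
    {H : ℕ} (G : Game S₁ S₂ A B H) (K : ℕ) (D : Ω → Record S₁ S₂ A B)
    (μ : Ω → ℕ → Policy S₁ A) (ν : Ω → ℕ → Policy S₂ B) : Prop where
  measurable_state : ∀ k ∈ Finset.Icc 1 K, ∀ h ≤ H, sigmaState D k h ≤ mΩ
  measurable_act : ∀ k ∈ Finset.Icc 1 K, ∀ h < H, sigmaAct D k h ≤ mΩ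
  measurable_rew : ∀ k ∈ Finset.Icc 1 K, ∀ h < H, sigmaRew D k h ≤ mΩ
  start : ∀ k ∈ Finset.Icc 1 K, ∀ᵐ ω ∂ℙ, (D ω).s₁ k 0 = G.x₁ ∧ (D ω).s₂ k 0 = G.x₂
  act : ∀ k ∈ Finset.Icc 1 K, ∀ h < H, ∀ (a : A) (b : B),
    ℙ[Set.indicator {ω | (D ω).a k h = a ∧ (D ω).b k h = b} (fun _ => (1 : ℝ)) | history H D k h]
      =ᵐ[ℙ] fun ω => μ ω k h ((D ω).s₁ k h) a * ν ω k h ((D ω).s₂ k h) b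
  next : ∀ k ∈ Finset.Icc 1 K, ∀ h < H, ∀ (s' : S₁) (t' : S₂),
    ℙ[Set.indicator {ω | (D ω).s₁ k (h + 1) = s' ∧ (D ω).s₂ k (h + 1) = t'} (fun _ => (1 : ℝ)) |
        historyAct H D k h]
      =ᵐ[ℙ] fun ω => G.P₁ h ((D ω).s₁ k h) ((D ω).a k h) s' *
        G.P₂ h ((D ω).s₂ k h) ((D ω).b k h) t'
  rew_mem : ∀ k ∈ Finset.Icc 1 K, ∀ h < H, ∀ᵐ ω ∂ℙ, (D ω).rew k h ∈ Set.Icc (0 : ℝ) 1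
  rew_mean : ∀ k ∈ Finset.Icc 1 K, ∀ h < H,
    ℙ[fun ω => (D ω).rew k h | historyAct H D k h]
      =ᵐ[ℙ] fun ω => G.r h ((D ω).s₁ k h) ((D ω).s₂ k h) ((D ω).a k h) ((D ω).b k h)

end Interaction

end FactoredMG

end

/-!
With `L` the logarithm in the statement, the gap is bounded by three times the expected bonuses per
player plus the regret of exponential weights, on an event of probability at least `1 - 5 δ`.

*Decomposition of one episode.* Fix an episode and a deviation `μ'` of Player 1, and compare three
models with transitions `P₁ × P₂`, `P₁ × P̂₂` and `P̂₁ × P̂₂`. Replacing `P₂` by `P̂₂` in the value of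
`(μ', ν)` costs at most the expected transition bonus of Player 2 under `(μ', ν)`
(`Concentrated.value_le_model₁`). That bonus depends only on Player 2's state and action, and since
the transitions are factored, its expectation is the same under `(μ, ν)`
(`evalReward_congr_left`). In the half-empirical model `P₁ × P̂₂`, optimism and the performance
difference lemma bound the value of `(μ', ν)` by the optimistic estimate for `(μ, ν)` plus a linear
regret (`Concentrated.model_le_vEst₁`). There the state occupancy factorizes
(`evalReward_eq_sum_reach`): Player 2's factor is exactly the weight in the gradient that Player 1
uses, and Player 1's factor is the law of the own states under `μ'` and the true `P₁`, the same in
all episodes. So the linear regrets of all episodes add up to a fixed mixture of regrets of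
exponential weights, one for each step and own state (`expWeights_regret_Icc`). Finally the
optimistic estimate exceeds the true value by at most twice the expected bonus on policy
(`Concentrated.vEst_le_value`). Player 2 is symmetric, with pessimistic estimates.

*Concentration.* The number of visits of a state-action pair is random, so Hoeffding's inequality is
applied to the exponential supermartingale stopped after `n` visits (`measure_visits_le`), with a
union bound over `n`, the pairs, and, for the `ℓ¹` distance, the subsets of successor states
(`exists_l1_confidence`).

*Sum of the bonuses.* The bonus of an episode is at most its value before the episode, which is a
function of the past. A multiplicative Chernoff bound replaces the expected bonuses by twice the
realized ones (`IsPlay.measure_expected_bonus_ge`), and these are summed with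
`∑ 1 / √n ≤ 3 √N` and the Cauchy–Schwarz inequality (`sum_one_div_sqrt_visits_le`). Collecting the
terms gives a multiple of `C √T L ^ 2` (`regret_terms_le`).
-/

set_option linter.unusedSectionVars false

noncomputable section

namespace FactoredMG

/-! ### Bilinear averages -/

section Bilinear

variable {X Y : Type*} [Fintype X] [Fintype Y]

/-- The average of `f` under the product of the weights `p` and `q`; the order of the factors is
the one of the estimated value functions. -/
def pairAvg (p : X → ℝ) (q : Y → ℝ) (f : X → Y → ℝ) : ℝ :=
  ∑ x, ∑ y, p x * f x y * q y

variable {p : X → ℝ} {q : Y → ℝ} {f g : X → Y → ℝ}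

theorem pairAvg_add : pairAvg p q (fun x y => f x y + g x y) = pairAvg p q f + pairAvg p q g := by
  simp only [pairAvg, ← Finset.sum_add_distrib]
  refine Finset.sum_congr rfl fun x _ => Finset.sum_congr rfl fun y _ => by ring

theorem pairAvg_sub : pairAvg p q (fun x y => f x y - g x y) = pairAvg p q f - pairAvg p q g := by
  simp only [pairAvg, ← Finset.sum_sub_distrib]
  refine Finset.sum_congr rfl fun x _ => Finset.sum_congr rfl fun y _ => by ring

theorem pairAvg_const_mul (c : ℝ) : pairAvg p q (fun x y => c * f x y) = c * pairAvg p q f := by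
  simp only [pairAvg, Finset.mul_sum]
  refine Finset.sum_congr rfl fun x _ => Finset.sum_congr rfl fun y _ => by ring

theorem pairAvg_mono (hp : ∀ x, 0 ≤ p x) (hq : ∀ y, 0 ≤ q y) (h : ∀ x y, f x y ≤ g x y) :
    pairAvg p q f ≤ pairAvg p q g := by
  refine Finset.sum_le_sum fun x _ => Finset.sum_le_sum fun y _ => ?_
  exact mul_le_mul_of_nonneg_right (mul_le_mul_of_nonneg_left (h x y) (hp x)) (hq y)

theorem pairAvg_nonneg (hp : ∀ x, 0 ≤ p x) (hq : ∀ y, 0 ≤ q y) (h : ∀ x y, 0 ≤ f x y) :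
    0 ≤ pairAvg p q f :=
  Finset.sum_nonneg fun x _ => Finset.sum_nonneg fun y _ =>
    mul_nonneg (mul_nonneg (hp x) (h x y)) (hq y)

theorem pairAvg_eq_left : pairAvg p q f = ∑ x, p x * ∑ y, f x y * q y := by
  simp only [pairAvg, Finset.mul_sum, mul_assoc]

theorem pairAvg_eq_right : pairAvg p q f = ∑ y, (∑ x, p x * f x y) * q y := by
  simp only [pairAvg, Finset.sum_mul]
  exact Finset.sum_comm

theorem pairAvg_const (hp : ∑ x, p x = 1) (hq : ∑ y, q y = 1) (c : ℝ) :
    pairAvg p q (fun _ _ => c) = c := by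
  rw [pairAvg_eq_left]
  simp [← Finset.mul_sum, ← Finset.sum_mul, hp, hq]

theorem pairAvg_le (hp : ∀ x, 0 ≤ p x) (hq : ∀ y, 0 ≤ q y) (hp1 : ∑ x, p x ≤ 1)
    (hq1 : ∑ y, q y ≤ 1) {c : ℝ} (hc : 0 ≤ c) (h : ∀ x y, f x y ≤ c) : pairAvg p q f ≤ c := by
  refine (pairAvg_mono hp hq h).trans ?_
  rw [pairAvg_eq_left, ← Finset.mul_sum, ← Finset.sum_mul]
  have hp0 : 0 ≤ ∑ x, p x := Finset.sum_nonneg fun x _ => hp x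
  have hq0 : 0 ≤ ∑ y, q y := Finset.sum_nonneg fun y _ => hq y
  nlinarith [mul_le_one₀ hp1 hq0 hq1]

/-- Changing the first weight changes the average by at most the `ℓ¹` distance times the bound on
the integrand. -/
theorem abs_pairAvg_sub_left (hq : ∀ y, 0 ≤ q y) (hq1 : ∑ y, q y ≤ 1) (p' : X → ℝ) {c : ℝ}
    (hc : 0 ≤ c) (hf : ∀ x y, |f x y| ≤ c) :
    |pairAvg p q f - pairAvg p' q f| ≤ (∑ x, |p x - p' x|) * c := by
  rw [pairAvg_eq_left, pairAvg_eq_left, ← Finset.sum_sub_distrib, Finset.sum_mul]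
  refine (Finset.abs_sum_le_sum_abs _ _).trans (Finset.sum_le_sum fun x _ => ?_)
  rw [← sub_mul, abs_mul]
  refine mul_le_mul_of_nonneg_left ?_ (abs_nonneg _)
  calc |∑ y, f x y * q y| ≤ ∑ y, |f x y * q y| := Finset.abs_sum_le_sum_abs _ _
    _ ≤ ∑ y, c * q y := Finset.sum_le_sum fun y _ => by
        rw [abs_mul, abs_of_nonneg (hq y)]
        exact mul_le_mul_of_nonneg_right (hf x y) (hq y)
    _ ≤ c := by rw [← Finset.mul_sum]; nlinarith

theorem pairAvg_swap : pairAvg p q f = pairAvg q p (fun y x => f x y) := by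
  rw [pairAvg, pairAvg, Finset.sum_comm]
  refine Finset.sum_congr rfl fun x _ => Finset.sum_congr rfl fun y _ => by ring

theorem abs_pairAvg_sub_right (hp : ∀ x, 0 ≤ p x) (hp1 : ∑ x, p x ≤ 1) (q' : Y → ℝ) {c : ℝ}
    (hc : 0 ≤ c) (hf : ∀ x y, |f x y| ≤ c) :
    |pairAvg p q f - pairAvg p q' f| ≤ (∑ y, |q y - q' y|) * c := by
  rw [pairAvg_swap, pairAvg_swap (q := q')]
  exact abs_pairAvg_sub_left hp hp1 q' hc fun y x => hf x y

end Bilinear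

/-! ### Evaluation of a pair of policies in a factored model -/

section Evaluation

variable {S₁ S₂ A B : Type*} [Fintype S₁] [Fintype S₂] [Fintype A] [Fintype B]

/-- A transition model with nonnegative weights of mass at most one. The empirical models are of
this kind: they vanish at unvisited state-action pairs. -/
def IsSubKernel {S C : Type*} [Fintype S] (H : ℕ) (P : ℕ → S → C → S → ℝ) : Prop :=
  ∀ h < H, ∀ s c, (∀ s', 0 ≤ P h s c s') ∧ ∑ s', P h s c s' ≤ 1

/-- Expected total reward `g` over the last `n` steps of the episode in the factored model
`P₁ × P₂`, when the players follow `μ` and `ν`. -/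
def evalReward (H : ℕ) (P₁ : ℕ → S₁ → A → S₁ → ℝ) (P₂ : ℕ → S₂ → B → S₂ → ℝ)
    (μ : Policy S₁ A) (ν : Policy S₂ B) (g : ℕ → S₁ → S₂ → A → B → ℝ) : ℕ → S₁ → S₂ → ℝ
  | 0 => fun _ _ => 0
  | n + 1 => fun s t => pairAvg (μ (H - (n + 1)) s) (ν (H - (n + 1)) t) fun a b =>
      g (H - (n + 1)) s t a b + pairAvg (P₁ (H - (n + 1)) s a) (P₂ (H - (n + 1)) t b)
        (evalReward H P₁ P₂ μ ν g n)

variable {H : ℕ} {P₁ P₁' : ℕ → S₁ → A → S₁ → ℝ} {P₂ P₂' : ℕ → S₂ → B → S₂ → ℝ}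
  {μ μ' : Policy S₁ A} {ν ν' : Policy S₂ B} {g g' : ℕ → S₁ → S₂ → A → B → ℝ}

theorem evalReward_zero (s : S₁) (t : S₂) : evalReward H P₁ P₂ μ ν g 0 s t = 0 := rfl

theorem evalReward_succ (n : ℕ) (s : S₁) (t : S₂) :
    evalReward H P₁ P₂ μ ν g (n + 1) s t =
      pairAvg (μ (H - (n + 1)) s) (ν (H - (n + 1)) t) fun a b =>
        g (H - (n + 1)) s t a b + pairAvg (P₁ (H - (n + 1)) s a) (P₂ (H - (n + 1)) t b)
          (evalReward H P₁ P₂ μ ν g n) := rfl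

theorem sub_succ_sub {n : ℕ} (hn : n + 1 ≤ H) : H - (H - (n + 1) + 1) = n := by omega

theorem evalReward_mono (hμ : IsPolicy H μ) (hν : IsPolicy H ν) (h₁ : IsSubKernel H P₁)
    (h₂ : IsSubKernel H P₂) (h : ∀ h < H, ∀ s t a b, g h s t a b ≤ g' h s t a b) :
    ∀ n ≤ H, ∀ s t, evalReward H P₁ P₂ μ ν g n s t ≤ evalReward H P₁ P₂ μ ν g' n s t := by
  intro n
  induction n with
  | zero => intro _ s t; exact le_rfl
  | succ n ih =>
    intro hn s t
    have hlt : H - (n + 1) < H := by omega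
    refine pairAvg_mono (hμ _ hlt s).1 (hν _ hlt t).1 fun a b => ?_
    exact add_le_add (h _ hlt s t a b)
      (pairAvg_mono (h₁ _ hlt s a).1 (h₂ _ hlt t b).1 (ih (by omega)))

theorem evalReward_nonneg (hμ : IsPolicy H μ) (hν : IsPolicy H ν) (h₁ : IsSubKernel H P₁)
    (h₂ : IsSubKernel H P₂) (h : ∀ h < H, ∀ s t a b, 0 ≤ g h s t a b) :
    ∀ n ≤ H, ∀ s t, 0 ≤ evalReward H P₁ P₂ μ ν g n s t := by
  intro n
  induction n with
  | zero => intro _ s t; exact le_rfl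
  | succ n ih =>
    intro hn s t
    have hlt : H - (n + 1) < H := by omega
    refine pairAvg_nonneg (hμ _ hlt s).1 (hν _ hlt t).1 fun a b => ?_
    exact add_nonneg (h _ hlt s t a b)
      (pairAvg_nonneg (h₁ _ hlt s a).1 (h₂ _ hlt t b).1 (ih (by omega)))

theorem evalReward_le (hμ : IsPolicy H μ) (hν : IsPolicy H ν) (h₁ : IsSubKernel H P₁)
    (h₂ : IsSubKernel H P₂) {c : ℝ} (hc : 0 ≤ c) (h : ∀ h < H, ∀ s t a b, g h s t a b ≤ c) :
    ∀ n ≤ H, ∀ s t, evalReward H P₁ P₂ μ ν g n s t ≤ n * c := by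
  intro n
  induction n with
  | zero => intro _ s t; simp [evalReward_zero]
  | succ n ih =>
    intro hn s t
    have hlt : H - (n + 1) < H := by omega
    refine pairAvg_le (hμ _ hlt s).1 (hν _ hlt t).1 (hμ _ hlt s).2.le (hν _ hlt t).2.le
      (by positivity) fun a b => ?_
    have := pairAvg_le (h₁ _ hlt s a).1 (h₂ _ hlt t b).1 (h₁ _ hlt s a).2 (h₂ _ hlt t b).2
      (by positivity) (ih (by omega))
    have := h _ hlt s t a b
    push_cast
    linarith

theorem evalReward_add :
    ∀ n s t, evalReward H P₁ P₂ μ ν (fun h s t a b => g h s t a b + g' h s t a b) n s t =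
      evalReward H P₁ P₂ μ ν g n s t + evalReward H P₁ P₂ μ ν g' n s t := by
  intro n
  induction n with
  | zero => intro s t; simp [evalReward_zero]
  | succ n ih =>
    intro s t
    rw [evalReward_succ, evalReward_succ, evalReward_succ, ← pairAvg_add]
    congr 1
    funext a b
    rw [show evalReward H P₁ P₂ μ ν (fun h s t a b => g h s t a b + g' h s t a b) n =
      fun s t => evalReward H P₁ P₂ μ ν g n s t + evalReward H P₁ P₂ μ ν g' n s t from
        funext₂ ih, pairAvg_add]
    ring

theorem evalReward_const_mul (c : ℝ) :
    ∀ n s t, evalReward H P₁ P₂ μ ν (fun h s t a b => c * g h s t a b) n s t =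
      c * evalReward H P₁ P₂ μ ν g n s t := by
  intro n
  induction n with
  | zero => intro s t; simp [evalReward_zero]
  | succ n ih =>
    intro s t
    rw [evalReward_succ, evalReward_succ, ← pairAvg_const_mul]
    congr 1
    funext a b
    rw [show evalReward H P₁ P₂ μ ν (fun h s t a b => c * g h s t a b) n =
      fun s t => c * evalReward H P₁ P₂ μ ν g n s t from funext₂ ih, pairAvg_const_mul]
    ring

/-- Value difference lemma. If `V` is obtained by averaging `q` under the same policies, then the
value of `g` differs from `V` by the accumulated Bellman residuals of `V`. -/
theorem evalReward_eq_add (V : ℕ → S₁ → S₂ → ℝ) (q : ℕ → S₁ → S₂ → A → B → ℝ)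
    (hV0 : ∀ s t, V 0 s t = 0)
    (hV : ∀ n, n + 1 ≤ H → ∀ s t, V (n + 1) s t =
      pairAvg (μ (H - (n + 1)) s) (ν (H - (n + 1)) t) (q (H - (n + 1)) s t)) :
    ∀ n ≤ H, ∀ s t, evalReward H P₁ P₂ μ ν g n s t = V n s t +
      evalReward H P₁ P₂ μ ν (fun h s t a b =>
        g h s t a b + pairAvg (P₁ h s a) (P₂ h t b) (V (H - (h + 1))) - q h s t a b) n s t := by
  intro n
  induction n with
  | zero => intro _ s t; simp [evalReward_zero, hV0]
  | succ n ih =>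
    intro hn s t
    rw [evalReward_succ, evalReward_succ, hV n hn, ← pairAvg_add]
    congr 1
    funext a b
    rw [sub_succ_sub hn]
    conv_lhs => rw [show evalReward H P₁ P₂ μ ν g n = fun s t => V n s t + _ from
      funext₂ (ih (by omega)), pairAvg_add]
    ring

/-- If the reward does not depend on Player 1's side, neither does its value. -/
theorem evalReward_congr_left (hμ : IsPolicy H μ) (hμ' : IsPolicy H μ')
    (h₁ : ∀ h < H, ∀ s a, P₁ h s a ∈ stdSimplex ℝ S₁) (f : ℕ → S₂ → B → ℝ) :
    ∀ n ≤ H, ∀ s s' t, evalReward H P₁ P₂ μ ν (fun h _ t _ b => f h t b) n s t =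
      evalReward H P₁ P₂ μ' ν (fun h _ t _ b => f h t b) n s' t := by
  intro n
  induction n with
  | zero => intro _ s s' t; rfl
  | succ n ih =>
    intro hn s s' t
    have hlt : H - (n + 1) < H := by omega
    rw [evalReward_succ, evalReward_succ, pairAvg_eq_left, pairAvg_eq_left]
    set F : B → ℝ := fun b => ∑ t', evalReward H P₁ P₂ μ ν (fun h _ t _ b => f h t b) n s t' *
      P₂ (H - (n + 1)) t b t' with hF
    have key : ∀ (π : Policy S₁ A) (hπ : IsPolicy H π) (u : S₁)
        (hu : ∀ u' t', evalReward H P₁ P₂ π ν (fun h _ t _ b => f h t b) n u' t' =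
          evalReward H P₁ P₂ μ ν (fun h _ t _ b => f h t b) n s t'),
        ∑ x, π (H - (n + 1)) u x * ∑ y, (f (H - (n + 1)) t y +
          pairAvg (P₁ (H - (n + 1)) u x) (P₂ (H - (n + 1)) t y)
            (evalReward H P₁ P₂ π ν (fun h _ t _ b => f h t b) n)) * ν (H - (n + 1)) t y =
        ∑ y, (f (H - (n + 1)) t y + F y) * ν (H - (n + 1)) t y := by
      intro π hπ u hu
      have : ∀ x y, pairAvg (P₁ (H - (n + 1)) u x) (P₂ (H - (n + 1)) t y)
            (evalReward H P₁ P₂ π ν (fun h _ t _ b => f h t b) n) = F y := by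
        intro x y
        rw [pairAvg_eq_left]
        simp only [hu]
        rw [← Finset.sum_mul, (h₁ _ hlt u x).2, one_mul]
      simp only [this]
      rw [← Finset.sum_mul, (hπ _ hlt u).2, one_mul]
    rw [key μ hμ s fun u' t' => ih (by omega) u' s t' |>.trans (ih (by omega) s s t').symm,
      key μ' hμ' s' fun u' t' => (ih (by omega) s u' t').symm]

/-- Exchange of the roles of the players. -/
theorem evalReward_swap :
    ∀ n s t, evalReward H P₁ P₂ μ ν g n s t =
      evalReward H P₂ P₁ ν μ (fun h t s b a => g h s t a b) n t s := by
  intro n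
  induction n with
  | zero => intro s t; rfl
  | succ n ih =>
    intro s t
    rw [evalReward_succ, evalReward_succ, pairAvg_swap]
    congr 1
    funext b a
    rw [pairAvg_swap]
    congr 2
    funext t' s'
    exact ih s' t'

/-- If the reward does not depend on Player 2's side, neither does its value. -/
theorem evalReward_congr_right (hν : IsPolicy H ν) (hν' : IsPolicy H ν')
    (h₂ : ∀ h < H, ∀ t b, P₂ h t b ∈ stdSimplex ℝ S₂) (f : ℕ → S₁ → A → ℝ) :
    ∀ n ≤ H, ∀ s t t', evalReward H P₁ P₂ μ ν (fun h s _ a _ => f h s a) n s t =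
      evalReward H P₁ P₂ μ ν' (fun h s _ a _ => f h s a) n s t' := by
  intro n hn s t t'
  exact (evalReward_swap n s t).trans
    ((evalReward_congr_left hν hν' h₂ f n hn t t' s).trans (evalReward_swap n s t').symm)

section Occupancy

variable [DecidableEq S₁] [DecidableEq S₂]

/-- In a factored model the state occupancy of the joint process is the product of the two
reaching probabilities. -/
theorem evalReward_eq_sum_reach (x₁ : S₁) (x₂ : S₂) :
    ∀ h ≤ H, evalReward H P₁ P₂ μ ν g H x₁ x₂ =
      (∑ i ∈ Finset.range h, pairAvg (reach x₁ μ P₁ i) (reach x₂ ν P₂ i) fun s t =>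
        pairAvg (μ i s) (ν i t) (g i s t)) +
      pairAvg (reach x₁ μ P₁ h) (reach x₂ ν P₂ h) (evalReward H P₁ P₂ μ ν g (H - h)) := by
  intro h
  induction h with
  | zero =>
    intro _
    simp [pairAvg, reach]
  | succ h ih =>
    intro hh
    rw [ih (by omega), Finset.sum_range_succ, add_assoc]
    congr 1
    have hn : H - h = H - (h + 1) + 1 := by omega
    have hh' : H - (H - (h + 1) + 1) = h := by omega
    have hstep : evalReward H P₁ P₂ μ ν g (H - h) = fun s t =>
        pairAvg (μ h s) (ν h t) (g h s t) +
          pairAvg (μ h s) (ν h t) (fun a b => pairAvg (P₁ h s a) (P₂ h t b)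
            (evalReward H P₁ P₂ μ ν g (H - (h + 1)))) := by
      funext s t
      rw [hn, evalReward_succ, hh', pairAvg_add]
    rw [hstep, pairAvg_add]
    congr 1
    generalize evalReward H P₁ P₂ μ ν g (H - (h + 1)) = V
    -- Both sides are the same sixfold sum, with the summation variables in different orders.
    let F : S₁ × S₂ × A × B × S₁ × S₂ → ℝ := fun x =>
      (reach x₁ μ P₁ h x.1 * μ h x.1 x.2.2.1 * P₁ h x.1 x.2.2.1 x.2.2.2.2.1) *
        V x.2.2.2.2.1 x.2.2.2.2.2 *
        (reach x₂ ν P₂ h x.2.1 * ν h x.2.1 x.2.2.2.1 * P₂ h x.2.1 x.2.2.2.1 x.2.2.2.2.2)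
    let e : S₁ × S₂ × S₂ × B × S₁ × A ≃ S₁ × S₂ × A × B × S₁ × S₂ :=
      { toFun := fun x => (x.2.2.2.2.1, x.2.2.1, x.2.2.2.2.2, x.2.2.2.1, x.1, x.2.1)
        invFun := fun x => (x.2.2.2.2.1, x.2.2.2.2.2, x.2.1, x.2.2.2.1, x.1, x.2.2.1)
        left_inv := fun _ => rfl
        right_inv := fun _ => rfl }
    have hl : pairAvg (reach x₁ μ P₁ h) (reach x₂ ν P₂ h) (fun s t =>
        pairAvg (μ h s) (ν h t) fun a b => pairAvg (P₁ h s a) (P₂ h t b) V) = ∑ x, F x := by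
      simp only [pairAvg, Finset.mul_sum, Finset.sum_mul, Fintype.sum_prod_type, F]
      refine Finset.sum_congr rfl fun s _ => Finset.sum_congr rfl fun t _ =>
        Finset.sum_congr rfl fun a _ => Finset.sum_congr rfl fun b _ =>
        Finset.sum_congr rfl fun s' _ => Finset.sum_congr rfl fun t' _ => by ring
    have hr : pairAvg (reach x₁ μ P₁ (h + 1)) (reach x₂ ν P₂ (h + 1)) V = ∑ x, F (e x) := by
      simp only [pairAvg, reach, Fintype.sum_prod_type, F, e, Equiv.coe_fn_mk,
        Finset.mul_sum, Finset.sum_mul]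
    rw [hl, hr, e.sum_comp]

theorem reach_nonneg {S C : Type*} [Fintype S] [Fintype C] [DecidableEq S] {x : S}
    {π : Policy S C} {P : ℕ → S → C → S → ℝ} (hπ : IsPolicy H π) (hP : IsSubKernel H P) :
    ∀ h ≤ H, ∀ s, 0 ≤ reach x π P h s := by
  intro h
  induction h with
  | zero => intro _ s; simp only [reach]; split_ifs <;> norm_num
  | succ h ih =>
    intro hh s
    exact Finset.sum_nonneg fun s' _ => Finset.sum_nonneg fun c _ =>
      mul_nonneg (mul_nonneg (ih (by omega) s') ((hπ h hh s').1 c)) ((hP h hh s' c).1 s)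

theorem sum_reach_le_one {S C : Type*} [Fintype S] [Fintype C] [DecidableEq S] {x : S}
    {π : Policy S C} {P : ℕ → S → C → S → ℝ} (hπ : IsPolicy H π) (hP : IsSubKernel H P) :
    ∀ h ≤ H, ∑ s, reach x π P h s ≤ 1 := by
  intro h
  induction h with
  | zero => intro _; simp [reach]
  | succ h ih =>
    intro hh
    calc ∑ s, reach x π P (h + 1) s
        = ∑ s', ∑ c, reach x π P h s' * π h s' c * ∑ s, P h s' c s := by
          simp only [reach, Finset.mul_sum]
          rw [Finset.sum_comm]
          exact Finset.sum_congr rfl fun _ _ => Finset.sum_comm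
      _ ≤ ∑ s', ∑ c, reach x π P h s' * π h s' c * 1 := by
          refine Finset.sum_le_sum fun s' _ => Finset.sum_le_sum fun c _ => ?_
          exact mul_le_mul_of_nonneg_left (hP h hh s' c).2
            (mul_nonneg (reach_nonneg hπ hP h (by omega) s') ((hπ h hh s').1 c))
      _ = ∑ s', reach x π P h s' := by
          simp only [mul_one, ← Finset.mul_sum, (hπ h hh _).2]
      _ ≤ 1 := ih (by omega)

end Occupancy

end Evaluation

/-! ### Bellman recursion for the value function -/

section Bellman

variable {S₁ S₂ A B : Type*} [Fintype S₁] [Fintype S₂] {H : ℕ}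

theorem Game.isSubKernel₁ (G : Game S₁ S₂ A B H) : IsSubKernel H G.P₁ :=
  fun h hh s a => ⟨(G.P₁_mem h hh s a).1, (G.P₁_mem h hh s a).2.le⟩

theorem Game.isSubKernel₂ (G : Game S₁ S₂ A B H) : IsSubKernel H G.P₂ :=
  fun h hh t b => ⟨(G.P₂_mem h hh t b).1, (G.P₂_mem h hh t b).2.le⟩

variable [Fintype A] [Fintype B] [DecidableEq S₁] [DecidableEq S₂]

theorem Game.trajProb_cons (G : Game S₁ S₂ A B H) (μ : Policy S₁ A) (ν : Policy S₂ B) {h : ℕ}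
    (hh : h < H) (s : S₁) (t : S₂) {n : ℕ} (x : S₁ × S₂ × A × B)
    (τ : Fin n → S₁ × S₂ × A × B) :
    G.trajProb μ ν h s t (Fin.cons x τ : Fin (n + 1) → S₁ × S₂ × A × B) =
      (if x.1 = s ∧ x.2.1 = t then 1 else 0) * (μ h x.1 x.2.2.1 * ν h x.2.1 x.2.2.2) *
        pairAvg (G.P₁ h x.1 x.2.2.1) (G.P₂ h x.2.1 x.2.2.2)
          fun s' t' => G.trajProb μ ν (h + 1) s' t' τ := by
  rw [trajProb, Fin.prod_univ_succ]
  congr 1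
  cases n with
  | zero =>
    simp [trajProb, pairAvg_const (G.P₁_mem h hh x.1 x.2.2.1).2 (G.P₂_mem h hh x.2.1 x.2.2.2).2]
  | succ n =>
    have hshift : ∀ i : ℕ, h + 1 + i = h + (i + 1) := fun i => by omega
    have harr : ∀ (s' : S₁) (t' : S₂) (i : Fin n), G.arrive (h + 1) s' t' τ i.succ =
        G.arrive h s t (Fin.cons x τ : Fin (n + 2) → S₁ × S₂ × A × B) i.succ.succ := by
      intro s' t' i
      change G.P₁ (h + 1 + i) _ _ _ * G.P₂ (h + 1 + i) _ _ _ =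
        G.P₁ (h + (i + 1)) _ _ _ * G.P₂ (h + (i + 1)) _ _ _
      rw [hshift]
      rfl
    simp only [trajProb]
    rw [Fin.prod_univ_succ]
    have hsum : ∀ c : ℝ, pairAvg (G.P₁ h x.1 x.2.2.1) (G.P₂ h x.2.1 x.2.2.2) (fun s' t' =>
        (if (τ 0).1 = s' ∧ (τ 0).2.1 = t' then 1 else 0) * c) =
        G.P₁ h x.1 x.2.2.1 (τ 0).1 * G.P₂ h x.2.1 x.2.2.2 (τ 0).2.1 * c := by
      intro c
      rw [pairAvg, Finset.sum_eq_single (τ 0).1, Finset.sum_eq_single (τ 0).2.1]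
      · simp; ring
      · intro b _ hb; simp [hb.symm]
      · simp
      · intro b _ hb
        exact Finset.sum_eq_zero fun y _ => by simp [hb.symm]
      · simp
    have hprod : (fun s' t' => ∏ i : Fin (n + 1), G.arrive (h + 1) s' t' τ i *
        (μ (h + 1 + i) (τ i).1 (τ i).2.2.1 * ν (h + 1 + i) (τ i).2.1 (τ i).2.2.2)) =
        fun s' t' => (if (τ 0).1 = s' ∧ (τ 0).2.1 = t' then 1 else 0) *
          ((μ (h + 1) (τ 0).1 (τ 0).2.2.1 * ν (h + 1) (τ 0).2.1 (τ 0).2.2.2) *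
          ∏ i : Fin n, G.arrive h s t (Fin.cons x τ : Fin (n + 2) → S₁ × S₂ × A × B) i.succ.succ *
            (μ (h + (i + 1 + 1)) (τ i.succ).1 (τ i.succ).2.2.1 *
              ν (h + (i + 1 + 1)) (τ i.succ).2.1 (τ i.succ).2.2.2)) := by
      funext s' t'
      rw [Fin.prod_univ_succ, mul_assoc]
      refine congrArg₂ (· * ·) rfl (congrArg₂ (· * ·) rfl (Finset.prod_congr rfl fun i _ => ?_))
      rw [harr]
      simp only [Fin.val_succ, hshift]
    rw [hprod, hsum, mul_assoc]
    rfl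

/-- Total probability of the trajectories of length `n`. -/
theorem Game.sum_trajProb (G : Game S₁ S₂ A B H) {μ : Policy S₁ A} {ν : Policy S₂ B}
    (hμ : IsPolicy H μ) (hν : IsPolicy H ν) : ∀ (n h : ℕ), h + n ≤ H → ∀ s t,
    ∑ τ : Fin n → S₁ × S₂ × A × B, G.trajProb μ ν h s t τ = 1 := by
  intro n
  induction n with
  | zero => intro h _ s t; simp [trajProb]
  | succ n ih =>
    intro h hh s t
    rw [← (Fin.consEquiv fun _ : Fin (n + 1) => S₁ × S₂ × A × B).sum_comp, Fintype.sum_prod_type]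
    simp only [Fin.consEquiv, Equiv.coe_fn_mk, G.trajProb_cons μ ν (show h < H by omega)]
    have : ∀ x : S₁ × S₂ × A × B, ∑ τ : Fin n → S₁ × S₂ × A × B,
        pairAvg (G.P₁ h x.1 x.2.2.1) (G.P₂ h x.2.1 x.2.2.2)
          (fun s' t' => G.trajProb μ ν (h + 1) s' t' τ) = 1 := by
      intro x
      simp only [pairAvg]
      rw [Finset.sum_comm]
      conv_lhs => enter [2, s']; rw [Finset.sum_comm]
      simp only [← Finset.mul_sum, ← Finset.sum_mul, ih (h + 1) (by omega)]
      rw [mul_one, (G.P₁_mem h (by omega) _ _).2, (G.P₂_mem h (by omega) _ _).2, one_mul]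
    simp only [← Finset.mul_sum, this, mul_one, Fintype.sum_prod_type]
    rw [Finset.sum_eq_single s, Finset.sum_eq_single t]
    · simp [← Finset.mul_sum, (hμ h (by omega) s).2, (hν h (by omega) t).2]
    · intro b _ hb; simp [hb]
    · simp
    · intro b _ hb; simp [hb]
    · simp

theorem Game.sum_trajProb_mul_sum (G : Game S₁ S₂ A B H) {μ : Policy S₁ A} {ν : Policy S₂ B}
    (hμ : IsPolicy H μ) (hν : IsPolicy H ν) : ∀ (n h : ℕ), h + n = H → ∀ s t,
    ∑ τ : Fin n → S₁ × S₂ × A × B, G.trajProb μ ν h s t τ *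
        ∑ i : Fin n, G.r (h + i) (τ i).1 (τ i).2.1 (τ i).2.2.1 (τ i).2.2.2 =
      evalReward H G.P₁ G.P₂ μ ν G.r n s t := by
  intro n
  induction n with
  | zero => intro h _ s t; simp [evalReward_zero]
  | succ n ih =>
    intro h hh s t
    have hlt : h < H := by omega
    rw [evalReward_succ, show H - (n + 1) = h by omega]
    rw [← (Fin.consEquiv fun _ : Fin (n + 1) => S₁ × S₂ × A × B).sum_comp, Fintype.sum_prod_type]
    simp only [Fin.consEquiv, Equiv.coe_fn_mk, G.trajProb_cons μ ν hlt, Fin.sum_univ_succ,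
      Fin.cons_zero, Fin.cons_succ, Fin.val_zero, add_zero, Fin.val_succ]
    have key : ∀ x : S₁ × S₂ × A × B, ∑ τ : Fin n → S₁ × S₂ × A × B,
        (pairAvg (G.P₁ h x.1 x.2.2.1) (G.P₂ h x.2.1 x.2.2.2)
          (fun s' t' => G.trajProb μ ν (h + 1) s' t' τ)) *
        (G.r h x.1 x.2.1 x.2.2.1 x.2.2.2 +
          ∑ i : Fin n, G.r (h + (i + 1)) (τ i).1 (τ i).2.1 (τ i).2.2.1 (τ i).2.2.2) =
        G.r h x.1 x.2.1 x.2.2.1 x.2.2.2 + pairAvg (G.P₁ h x.1 x.2.2.1) (G.P₂ h x.2.1 x.2.2.2)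
          (evalReward H G.P₁ G.P₂ μ ν G.r n) := by
      intro x
      have h1 : G.r h x.1 x.2.1 x.2.2.1 x.2.2.2 = pairAvg (G.P₁ h x.1 x.2.2.1)
          (G.P₂ h x.2.1 x.2.2.2) (fun _ _ => G.r h x.1 x.2.1 x.2.2.1 x.2.2.2) :=
        (pairAvg_const (G.P₁_mem h hlt _ _).2 (G.P₂_mem h hlt _ _).2 _).symm
      conv_rhs => rw [h1, ← pairAvg_add]
      simp only [pairAvg, Finset.sum_mul]
      rw [Finset.sum_comm]
      refine Finset.sum_congr rfl fun s' _ => ?_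
      rw [Finset.sum_comm]
      refine Finset.sum_congr rfl fun t' _ => ?_
      have hτ : ∑ τ : Fin n → S₁ × S₂ × A × B, G.trajProb μ ν (h + 1) s' t' τ *
          (G.r h x.1 x.2.1 x.2.2.1 x.2.2.2 +
            ∑ i : Fin n, G.r (h + (i + 1)) (τ i).1 (τ i).2.1 (τ i).2.2.1 (τ i).2.2.2) =
          G.r h x.1 x.2.1 x.2.2.1 x.2.2.2 + evalReward H G.P₁ G.P₂ μ ν G.r n s' t' := by
        simp only [mul_add, Finset.sum_add_distrib, ← Finset.sum_mul,
          G.sum_trajProb hμ hν n (h + 1) (by omega) s' t', one_mul, ← ih (h + 1) (by omega),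
          show ∀ i : ℕ, h + 1 + i = h + (i + 1) from fun i => by omega]
      rw [← hτ, Finset.mul_sum, Finset.sum_mul]
      refine Finset.sum_congr rfl fun τ _ => by ring
    simp only [mul_assoc] at key ⊢
    simp only [← Finset.mul_sum, key, Fintype.sum_prod_type]
    rw [Finset.sum_eq_single s, Finset.sum_eq_single t]
    · simp only [and_self, if_true, one_mul, pairAvg]
      refine Finset.sum_congr rfl fun a _ => Finset.sum_congr rfl fun b _ => by ring
    · intro b _ hb; simp [hb]
    · simp
    · intro b _ hb; simp [hb]
    · simp

/-- The value function satisfies the Bellman recursion. -/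
theorem Game.value_eq_evalReward (G : Game S₁ S₂ A B H) {μ : Policy S₁ A} {ν : Policy S₂ B}
    (hμ : IsPolicy H μ) (hν : IsPolicy H ν) (s : S₁) (t : S₂) :
    G.value μ ν 0 s t = evalReward H G.P₁ G.P₂ μ ν G.r H s t :=
  G.sum_trajProb_mul_sum hμ hν H 0 (Nat.zero_add H) s t

end Bellman

/-! ### Regret decomposition of a single episode -/

section Episode

variable {S₁ S₂ A B : Type*} [Fintype S₁] [Fintype S₂] [Fintype A] [Fintype B]
  [DecidableEq S₁] [DecidableEq S₂] [DecidableEq A] [DecidableEq B]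

theorem sum_card_filter_fiber {S : Type*} [Fintype S] [DecidableEq S] (J : Finset ℕ)
    (v : ℕ → Prop) [DecidablePred v] (x : ℕ → S) (q : ℕ → S → Prop)
    [∀ j s, Decidable (q j s)] (hq : ∀ j s, q j s ↔ v j ∧ x j = s) :
    ∑ s, (((J.filter fun j => q j s).card : ℝ)) = ((J.filter v).card : ℝ) := by
  simp only [hq, ← Finset.filter_filter]
  rw [Finset.card_eq_sum_card_fiberwise (f := x) (t := Finset.univ) (fun _ _ => Finset.mem_univ _)]
  push_cast
  refine Finset.sum_congr rfl fun s _ => ?_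
  congr 2

theorem Record.sum_PHat₁_of_pos (D : Record S₁ S₂ A B) {k h : ℕ} (hk : k ≠ 0) (s : S₁) (a : A) :
    ∑ s', D.PHat₁ k h s a s' = (D.count₁ k h s a : ℝ) / max (D.count₁ k h s a : ℝ) 1 := by
  simp only [PHat₁, hk, if_false, ← Finset.sum_div]
  congr 1
  exact sum_card_filter_fiber _ _ (fun j => D.s₁ j (h + 1)) _ fun j s => and_assoc.symm

theorem Record.sum_PHat₂_of_pos (D : Record S₁ S₂ A B) {k h : ℕ} (hk : k ≠ 0) (t : S₂) (b : B) :
    ∑ t', D.PHat₂ k h t b t' = (D.count₂ k h t b : ℝ) / max (D.count₂ k h t b : ℝ) 1 := by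
  simp only [PHat₂, hk, if_false, ← Finset.sum_div]
  congr 1
  exact sum_card_filter_fiber _ _ (fun j => D.s₂ j (h + 1)) _ fun j s => and_assoc.symm

theorem Record.isSubKernel_PHat₁ (D : Record S₁ S₂ A B) (H k : ℕ) :
    IsSubKernel H (D.PHat₁ k) := by
  intro h _ s a
  refine ⟨fun s' => ?_, ?_⟩
  · unfold PHat₁
    split_ifs <;> positivity
  · by_cases hk : k = 0
    · simp only [PHat₁, hk, if_true, Finset.sum_const, Finset.card_univ, nsmul_eq_mul]
      rw [mul_one_div]
      exact div_self_le_one _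
    · rw [D.sum_PHat₁_of_pos hk]
      exact div_le_one_of_le₀ (le_max_left _ _) (by positivity)

theorem Record.isSubKernel_PHat₂ (D : Record S₁ S₂ A B) (H k : ℕ) :
    IsSubKernel H (D.PHat₂ k) := by
  intro h _ s a
  refine ⟨fun s' => ?_, ?_⟩
  · unfold PHat₂
    split_ifs <;> positivity
  · by_cases hk : k = 0
    · simp only [PHat₂, hk, if_true, Finset.sum_const, Finset.card_univ, nsmul_eq_mul]
      rw [mul_one_div]
      exact div_self_le_one _
    · rw [D.sum_PHat₂_of_pos hk]
      exact div_le_one_of_le₀ (le_max_left _ _) (by positivity)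

/-- Confidence width for the `ℓ¹` error of an empirical distribution on `m` points after `n`
visits, scaled by the horizon. -/
def transBonus (H m : ℕ) (L : ℝ) (n : ℕ) : ℝ :=
  Real.sqrt (2 * (H : ℝ) ^ 2 * m * L / max (n : ℝ) 1)

/-- Part of the exploration bonus that covers the transitions of Player 1. -/
def Record.bonusP₁ (D : Record S₁ S₂ A B) (H K : ℕ) (δ : ℝ) (k h : ℕ) (s : S₁) (a : A) : ℝ :=
  transBonus H (Fintype.card S₁) (Real.log (2 * (Fintype.card S₁ : ℝ) * Fintype.card A * H * K / δ))
    (D.count₁ k h s a)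

/-- Part of the exploration bonus that covers the transitions of Player 2. -/
def Record.bonusP₂ (D : Record S₁ S₂ A B) (H K : ℕ) (δ : ℝ) (k h : ℕ) (t : S₂) (b : B) : ℝ :=
  transBonus H (Fintype.card S₂) (Real.log (2 * (Fintype.card S₂ : ℝ) * Fintype.card B * H * K / δ))
    (D.count₂ k h t b)

theorem Record.bonus_eq (D : Record S₁ S₂ A B) (H K : ℕ) (δ : ℝ) {k : ℕ} (hk : k ≠ 0) (h : ℕ)
    (s : S₁) (t : S₂) (a : A) (b : B) : D.bonus H K δ k h s t a b =
      D.bonusR H K δ k h s t a b + (D.bonusP₁ H K δ k h s a + D.bonusP₂ H K δ k h t b) := by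
  rw [bonus, if_neg hk]
  rfl

theorem Record.bonusR_nonneg (D : Record S₁ S₂ A B) (H K : ℕ) (δ : ℝ) (k h : ℕ)
    (s : S₁) (t : S₂) (a : A) (b : B) : 0 ≤ D.bonusR H K δ k h s t a b := Real.sqrt_nonneg _

theorem Record.bonusP₁_nonneg (D : Record S₁ S₂ A B) (H K : ℕ) (δ : ℝ) (k h : ℕ)
    (s : S₁) (a : A) : 0 ≤ D.bonusP₁ H K δ k h s a := Real.sqrt_nonneg _

theorem Record.bonusP₂_nonneg (D : Record S₁ S₂ A B) (H K : ℕ) (δ : ℝ) (k h : ℕ)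
    (t : S₂) (b : B) : 0 ≤ D.bonusP₂ H K δ k h t b := Real.sqrt_nonneg _

theorem Record.bonus_nonneg (D : Record S₁ S₂ A B) (H K : ℕ) (δ : ℝ) {k : ℕ} (hk : k ≠ 0) (h : ℕ)
    (s : S₁) (t : S₂) (a : A) (b : B) : 0 ≤ D.bonus H K δ k h s t a b := by
  rw [D.bonus_eq H K δ hk]
  have := D.bonusR_nonneg H K δ k h s t a b
  have := D.bonusP₁_nonneg H K δ k h s a
  have := D.bonusP₂_nonneg H K δ k h t b
  linarith

theorem Record.backup_eq (D : Record S₁ S₂ A B) (H k : ℕ) (β : ℕ → S₁ → S₂ → A → B → ℝ)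
    (V : S₁ → S₂ → ℝ) (h : ℕ) (s : S₁) (t : S₂) (a : A) (b : B) :
    D.backup H k β V h s t a b = max (min (D.rHat k h s t a b +
      pairAvg (D.PHat₁ k h s a) (D.PHat₂ k h t b) V + β h s t a b) ((H : ℝ) - h)) 0 := by
  simp only [backup, pairAvg, mul_right_comm]

section Estimates

variable {H k : ℕ} {β : ℕ → S₁ → S₂ → A → B → ℝ} {μ : Policy S₁ A} {ν : Policy S₂ B}

theorem Record.backup_nonneg (D : Record S₁ S₂ A B) (V : S₁ → S₂ → ℝ) (h : ℕ) (s : S₁) (t : S₂)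
    (a : A) (b : B) : 0 ≤ D.backup H k β V h s t a b := le_max_right _ _

theorem Record.backup_le (D : Record S₁ S₂ A B) (V : S₁ → S₂ → ℝ) {h : ℕ} (hh : h ≤ H) (s : S₁)
    (t : S₂) (a : A) (b : B) : D.backup H k β V h s t a b ≤ (H : ℝ) - h :=
  max_le (min_le_right _ _) (by have : (h : ℝ) ≤ H := by exact_mod_cast hh
                                linarith)

theorem Record.vEst_succ (D : Record S₁ S₂ A B) {n : ℕ} (hn : n + 1 ≤ H) (s : S₁) (t : S₂) :
    D.vEst H k β μ ν (n + 1) s t = pairAvg (μ (H - (n + 1)) s) (ν (H - (n + 1)) t)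
      (D.qEst H k β μ ν (H - (n + 1)) s t) := by
  rw [qEst, sub_succ_sub hn]
  rfl

theorem Record.vEst_nonneg (D : Record S₁ S₂ A B) (hμ : IsPolicy H μ) (hν : IsPolicy H ν) :
    ∀ n ≤ H, ∀ s t, 0 ≤ D.vEst H k β μ ν n s t := by
  intro n hn s t
  cases n with
  | zero => exact le_rfl
  | succ n =>
    exact pairAvg_nonneg (hμ _ (by omega) s).1 (hν _ (by omega) t).1
      fun a b => D.backup_nonneg _ _ _ _ _ _

theorem Record.vEst_le (D : Record S₁ S₂ A B) (hμ : IsPolicy H μ) (hν : IsPolicy H ν) :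
    ∀ n ≤ H, ∀ s t, D.vEst H k β μ ν n s t ≤ n := by
  intro n hn s t
  cases n with
  | zero => exact le_of_eq (by simp [vEst])
  | succ n =>
    refine pairAvg_le (hμ _ (by omega) s).1 (hν _ (by omega) t).1 (hμ _ (by omega) s).2.le
      (hν _ (by omega) t).2.le (by positivity) fun a b => ?_
    refine (D.backup_le _ (by omega) _ _ _ _).trans (le_of_eq ?_)
    rw [Nat.cast_sub hn]
    ring

theorem Record.qEst_mem (D : Record S₁ S₂ A B) {h : ℕ} (hh : h < H) (s : S₁) (t : S₂) (a : A)
    (b : B) : D.qEst H k β μ ν h s t a b ∈ Set.Icc (0 : ℝ) H :=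
  ⟨D.backup_nonneg _ _ _ _ _ _, (D.backup_le _ hh.le _ _ _ _).trans (by
    have : (0 : ℝ) ≤ h := by positivity
    linarith)⟩

end Estimates

/-- The estimates after episode `k` are within their confidence widths. -/
structure Concentrated {H : ℕ} (G : Game S₁ S₂ A B H) (K : ℕ) (δ : ℝ) (D : Record S₁ S₂ A B)
    (k : ℕ) : Prop where
  rHat_nonneg : ∀ h < H, ∀ s t a b, 0 ≤ D.rHat k h s t a b
  reward : ∀ h < H, ∀ s t a b, |D.rHat k h s t a b - G.r h s t a b| ≤ D.bonusR H K δ k h s t a b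
  trans₁ : ∀ h < H, ∀ s a,
    (∑ s', |D.PHat₁ k h s a s' - G.P₁ h s a s'|) * H ≤ D.bonusP₁ H K δ k h s a
  trans₂ : ∀ h < H, ∀ t b,
    (∑ t', |D.PHat₂ k h t b t' - G.P₂ h t b t'|) * H ≤ D.bonusP₂ H K δ k h t b

section Decomposition

variable {H K k : ℕ} {δ : ℝ} {G : Game S₁ S₂ A B H} {D : Record S₁ S₂ A B}
  {μ : Policy S₁ A} {ν : Policy S₂ B}

theorem Concentrated.trans_error₁ (hc : Concentrated G K δ D k) {Q : ℕ → S₂ → B → S₂ → ℝ}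
    (hQ : IsSubKernel H Q) {h : ℕ} (hh : h < H) (s : S₁) (t : S₂) (a : A) (b : B)
    {V : S₁ → S₂ → ℝ} (hV : ∀ s t, |V s t| ≤ H) :
    |pairAvg (D.PHat₁ k h s a) (Q h t b) V - pairAvg (G.P₁ h s a) (Q h t b) V| ≤
      D.bonusP₁ H K δ k h s a :=
  (abs_pairAvg_sub_left (hQ h hh t b).1 (hQ h hh t b).2 _ (by positivity) hV).trans
    (hc.trans₁ h hh s a)

theorem Concentrated.trans_error₂ (hc : Concentrated G K δ D k) {Q : ℕ → S₁ → A → S₁ → ℝ}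
    (hQ : IsSubKernel H Q) {h : ℕ} (hh : h < H) (s : S₁) (t : S₂) (a : A) (b : B)
    {V : S₁ → S₂ → ℝ} (hV : ∀ s t, |V s t| ≤ H) :
    |pairAvg (Q h s a) (D.PHat₂ k h t b) V - pairAvg (Q h s a) (G.P₂ h t b) V| ≤
      D.bonusP₂ H K δ k h t b :=
  (abs_pairAvg_sub_right (hQ h hh s a).1 (hQ h hh s a).2 _ (by positivity) hV).trans
    (hc.trans₂ h hh t b)

theorem abs_vEst_le (hμ : IsPolicy H μ) (hν : IsPolicy H ν) (β : ℕ → S₁ → S₂ → A → B → ℝ)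
    (h : ℕ) (s : S₁) (t : S₂) : |D.vEst H k β μ ν (H - (h + 1)) s t| ≤ H := by
  rw [abs_of_nonneg (D.vEst_nonneg hμ hν _ (by omega) s t)]
  refine (D.vEst_le hμ hν _ (by omega) s t).trans ?_
  exact_mod_cast Nat.sub_le _ _

theorem vEst_next_le (hμ : IsPolicy H μ) (hν : IsPolicy H ν) (β : ℕ → S₁ → S₂ → A → B → ℝ)
    {h : ℕ} (hh : h < H) (s : S₁) (t : S₂) :
    D.vEst H k β μ ν (H - (h + 1)) s t ≤ (H : ℝ) - h - 1 := by
  refine (D.vEst_le hμ hν _ (by omega) s t).trans (le_of_eq ?_)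
  rw [Nat.cast_sub hh]
  push_cast
  ring

/-- The optimistic value overestimates the true value of the same policies by at most twice the
expected bonuses. -/
theorem Concentrated.vEst_le_value (hc : Concentrated G K δ D k) (hk : k ≠ 0)
    (hμ : IsPolicy H μ) (hν : IsPolicy H ν) (s : S₁) (t : S₂) :
    D.vEst H k (D.bonus H K δ k) μ ν H s t ≤ evalReward H G.P₁ G.P₂ μ ν G.r H s t +
      2 * evalReward H G.P₁ G.P₂ μ ν (D.bonus H K δ k) H s t := by
  rw [evalReward_eq_add (g := G.r) (D.vEst H k (D.bonus H K δ k) μ ν)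
    (D.qEst H k (D.bonus H K δ k) μ ν) (fun _ _ => rfl) (fun n hn s t => D.vEst_succ hn s t)
    H le_rfl s t, ← evalReward_const_mul, add_assoc, ← evalReward_add]
  refine le_add_of_nonneg_right (evalReward_nonneg hμ hν G.isSubKernel₁ G.isSubKernel₂ ?_ H le_rfl
    s t)
  intro h hh s t a b
  set V := D.vEst H k (D.bonus H K δ k) μ ν (H - (h + 1)) with hVdef
  have hV : ∀ s t, |V s t| ≤ H := abs_vEst_le hμ hν _ h
  have hV0 : ∀ s t, 0 ≤ V s t := D.vEst_nonneg hμ hν _ (by omega)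
  have e1 := abs_le.1 (hc.trans_error₁ (D.isSubKernel_PHat₂ H k) hh s t a b hV)
  have e2 := abs_le.1 (hc.trans_error₂ G.isSubKernel₁ hh s t a b hV)
  have e3 := abs_le.1 (hc.reward h hh s t a b)
  have hP := pairAvg_nonneg (D.isSubKernel_PHat₁ H k h hh s a).1
    (D.isSubKernel_PHat₂ H k h hh t b).1 hV0
  have hr := hc.rHat_nonneg h hh s t a b
  have hb := D.bonus_nonneg H K δ hk h s t a b
  have hq : D.qEst H k (D.bonus H K δ k) μ ν h s t a b ≤ D.rHat k h s t a b +
      pairAvg (D.PHat₁ k h s a) (D.PHat₂ k h t b) V + D.bonus H K δ k h s t a b := by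
    rw [Record.qEst, D.backup_eq]
    exact max_le (min_le_left _ _) (by linarith)
  rw [D.bonus_eq H K δ hk] at hq hb ⊢
  linarith

/-- The pessimistic value underestimates the true value of the same policies by at most twice the
expected bonuses. -/
theorem Concentrated.value_le_vEst (hc : Concentrated G K δ D k) (hk : k ≠ 0)
    (hμ : IsPolicy H μ) (hν : IsPolicy H ν) (s : S₁) (t : S₂) :
    evalReward H G.P₁ G.P₂ μ ν G.r H s t ≤
      D.vEst H k (fun h s t a b => -D.bonus H K δ k h s t a b) μ ν H s t +
      2 * evalReward H G.P₁ G.P₂ μ ν (D.bonus H K δ k) H s t := by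
  set β : ℕ → S₁ → S₂ → A → B → ℝ := fun h s t a b => -D.bonus H K δ k h s t a b with hβ
  rw [evalReward_eq_add (g := G.r) (D.vEst H k β μ ν)
    (D.qEst H k β μ ν) (fun _ _ => rfl) (fun n hn s t => D.vEst_succ hn s t)
    H le_rfl s t, ← evalReward_const_mul]
  refine add_le_add le_rfl (evalReward_mono hμ hν G.isSubKernel₁ G.isSubKernel₂ ?_ H le_rfl s t)
  intro h hh s t a b
  set V := D.vEst H k β μ ν (H - (h + 1)) with hVdef
  have hV : ∀ s t, |V s t| ≤ H := abs_vEst_le hμ hν _ h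
  have e1 := abs_le.1 (hc.trans_error₁ (D.isSubKernel_PHat₂ H k) hh s t a b hV)
  have e2 := abs_le.1 (hc.trans_error₂ G.isSubKernel₁ hh s t a b hV)
  have e3 := abs_le.1 (hc.reward h hh s t a b)
  have hr := (G.r_mem h hh s t a b).2
  have hh1 : (h : ℝ) + 1 ≤ H := by exact_mod_cast hh
  have hP := pairAvg_le (G.P₁_mem h hh s a).1 (G.P₂_mem h hh t b).1 (G.P₁_mem h hh s a).2.le
    (G.P₂_mem h hh t b).2.le (c := (H : ℝ) - h - 1) (by linarith)
    (vEst_next_le (D := D) (k := k) hμ hν β hh)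
  have hb := D.bonus_nonneg H K δ hk h s t a b
  have hq : min (D.rHat k h s t a b + pairAvg (D.PHat₁ k h s a) (D.PHat₂ k h t b) V -
      D.bonus H K δ k h s t a b) ((H : ℝ) - h) ≤ D.qEst H k β μ ν h s t a b := by
    rw [Record.qEst, D.backup_eq]
    exact le_max_left _ _
  rcases min_le_iff.1 hq with hq | hq
  · rw [D.bonus_eq H K δ hk] at hq hb ⊢
    linarith
  · linarith

end Decomposition

end Episode

section Hindsight

variable {S₁ S₂ A B : Type*} [Fintype S₁] [Fintype S₂] [Fintype A] [Fintype B]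
  [DecidableEq S₁] [DecidableEq S₂] [DecidableEq A] [DecidableEq B]
  {H K k : ℕ} {δ : ℝ} {G : Game S₁ S₂ A B H} {D : Record S₁ S₂ A B}
  {μ μ' : Policy S₁ A} {ν ν' : Policy S₂ B}

/-- The first-order regret of `μ` against `μ'` in the direction of Player 1's gradient, weighted by
the state reaching probabilities of `μ'` under the true transitions. These weights do not change
from episode to episode. -/
def linRegret₁ (G : Game S₁ S₂ A B H) (D : Record S₁ S₂ A B) (K : ℕ) (δ : ℝ) (k : ℕ)
    (μ' μ : Policy S₁ A) (ν : Policy S₂ B) : ℝ :=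
  ∑ h ∈ Finset.range H, ∑ s, reach G.x₁ μ' G.P₁ h s *
    ∑ a, (μ' h s a - μ h s a) * D.grad₁ H K δ G.x₂ k μ ν h s a

/-- The first-order regret of `ν` against `ν'` in the direction of Player 2's gradient. -/
def linRegret₂ (G : Game S₁ S₂ A B H) (D : Record S₁ S₂ A B) (K : ℕ) (δ : ℝ) (k : ℕ)
    (ν' : Policy S₂ B) (μ : Policy S₁ A) (ν : Policy S₂ B) : ℝ :=
  ∑ h ∈ Finset.range H, ∑ t, reach G.x₂ ν' G.P₂ h t *
    ∑ b, (ν' h t b - ν h t b) * D.grad₂ H K δ G.x₁ k μ ν h t b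

theorem pairAvg_evalReward_zero (p : S₁ → ℝ) (q : S₂ → ℝ) (P₁ : ℕ → S₁ → A → S₁ → ℝ)
    (P₂ : ℕ → S₂ → B → S₂ → ℝ) (g : ℕ → S₁ → S₂ → A → B → ℝ) :
    pairAvg p q (evalReward H P₁ P₂ μ ν g 0) = 0 := by
  simp [pairAvg, evalReward]

/-- If Player 1 deviates in the model made of the true transitions of Player 1 and the empirical
ones of Player 2, the accumulated advantage is the linearized regret. -/
theorem evalReward_advantage₁ (hν : IsPolicy H ν) (hμ' : IsPolicy H μ') :
    evalReward H G.P₁ (D.PHat₂ k) μ' ν (fun h s t a b =>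
        D.qEst H k (D.bonus H K δ k) μ ν h s t a b -
          D.vEst H k (D.bonus H K δ k) μ ν (H - h) s t) H G.x₁ G.x₂ =
      linRegret₁ G D K δ k μ' μ ν := by
  rw [evalReward_eq_sum_reach G.x₁ G.x₂ H le_rfl, Nat.sub_self]
  rw [pairAvg_evalReward_zero, add_zero]
  refine Finset.sum_congr rfl fun h hh => ?_
  have hh : h < H := Finset.mem_range.1 hh
  rw [pairAvg_eq_left]
  refine Finset.sum_congr rfl fun s _ => ?_
  congr 1
  have hV : ∀ t, D.vEst H k (D.bonus H K δ k) μ ν (H - h) s t =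
      pairAvg (μ h s) (ν h t) (D.qEst H k (D.bonus H K δ k) μ ν h s t) := by
    intro t
    have := D.vEst_succ (k := k) (β := D.bonus H K δ k) (μ := μ) (ν := ν)
      (show H - (h + 1) + 1 ≤ H by omega) s t
    rwa [show H - (H - (h + 1) + 1) = h by omega, show H - (h + 1) + 1 = H - h by omega] at this
  simp only [pairAvg_sub, pairAvg_const (hμ' h hh s).2 (hν h hh _).2, hV]
  simp only [pairAvg_eq_left (p := μ h s), pairAvg_eq_left (p := μ' h s), ← Finset.sum_sub_distrib,
    ← sub_mul, Record.grad₁, Finset.mul_sum (s := (Finset.univ : Finset S₂)),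
    Finset.sum_mul (s := (Finset.univ : Finset A))]
  rw [Finset.sum_comm]
  refine Finset.sum_congr rfl fun a _ => Finset.sum_congr rfl fun t _ => by ring

theorem evalReward_advantage₂ (hμ : IsPolicy H μ) (hν' : IsPolicy H ν') :
    evalReward H (D.PHat₁ k) G.P₂ μ ν' (fun h s t a b =>
        D.qEst H k (fun h s t a b => -D.bonus H K δ k h s t a b) μ ν h s t a b -
          D.vEst H k (fun h s t a b => -D.bonus H K δ k h s t a b) μ ν (H - h) s t) H G.x₁ G.x₂ =
      linRegret₂ G D K δ k ν' μ ν := by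
  set β : ℕ → S₁ → S₂ → A → B → ℝ := fun h s t a b => -D.bonus H K δ k h s t a b with hβ
  rw [evalReward_eq_sum_reach G.x₁ G.x₂ H le_rfl, Nat.sub_self]
  rw [pairAvg_evalReward_zero, add_zero]
  refine Finset.sum_congr rfl fun h hh => ?_
  have hh : h < H := Finset.mem_range.1 hh
  rw [pairAvg_swap, pairAvg_eq_left]
  refine Finset.sum_congr rfl fun t _ => ?_
  congr 1
  have hV : ∀ s, D.vEst H k β μ ν (H - h) s t =
      pairAvg (μ h s) (ν h t) (D.qEst H k β μ ν h s t) := by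
    intro s
    have := D.vEst_succ (k := k) (β := β) (μ := μ) (ν := ν)
      (show H - (h + 1) + 1 ≤ H by omega) s t
    rwa [show H - (H - (h + 1) + 1) = h by omega, show H - (h + 1) + 1 = H - h by omega] at this
  simp only [pairAvg_sub, pairAvg_const (hμ h hh _).2 (hν' h hh _).2, hV]
  simp only [pairAvg_eq_right (q := ν h t), pairAvg_eq_right (q := ν' h t),
    ← Finset.sum_sub_distrib, ← mul_sub, Record.grad₂, ← hβ,
    Finset.mul_sum (s := (Finset.univ : Finset S₁)), Finset.sum_mul (s := (Finset.univ : Finset B))]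
  rw [Finset.sum_comm]
  refine Finset.sum_congr rfl fun b _ => Finset.sum_congr rfl fun s _ => ?_
  simp only [mul_comm (μ h s _)]
  ring

/-- Player 2's transition error costs a deviating Player 1 no more than it costs on-policy: the
error bound depends only on Player 2's side, whose law does not change. -/
theorem Concentrated.value_le_model₁ (hc : Concentrated G K δ D k) (hμ : IsPolicy H μ)
    (hν : IsPolicy H ν) (hμ' : IsPolicy H μ') (s : S₁) (t : S₂) :
    evalReward H G.P₁ G.P₂ μ' ν G.r H s t ≤ evalReward H G.P₁ (D.PHat₂ k) μ' ν G.r H s t +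
      evalReward H G.P₁ G.P₂ μ ν (fun h _ t _ b => D.bonusP₂ H K δ k h t b) H s t := by
  set U := evalReward H G.P₁ (D.PHat₂ k) μ' ν G.r with hU
  have hP₂ := D.isSubKernel_PHat₂ H k
  rw [evalReward_eq_add (g := G.r) U (fun h s t a b => G.r h s t a b +
      pairAvg (G.P₁ h s a) (D.PHat₂ k h t b) (U (H - (h + 1)))) (fun _ _ => rfl)
    (fun n hn s t => by rw [hU, evalReward_succ, sub_succ_sub hn]) H le_rfl s t,
    evalReward_congr_left hμ hμ' G.P₁_mem (fun h t b => D.bonusP₂ H K δ k h t b) H le_rfl s s t]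
  refine add_le_add le_rfl (evalReward_mono hμ' hν G.isSubKernel₁ G.isSubKernel₂ ?_ H le_rfl s t)
  intro h hh s t a b
  have hUH : ∀ s t, |U (H - (h + 1)) s t| ≤ H := by
    intro s t
    rw [abs_of_nonneg (evalReward_nonneg hμ' hν G.isSubKernel₁ hP₂
      (fun h hh s t a b => (G.r_mem h hh s t a b).1) _ (by omega) s t)]
    refine (evalReward_le hμ' hν G.isSubKernel₁ hP₂ zero_le_one
      (fun h hh s t a b => (G.r_mem h hh s t a b).2) _ (by omega) s t).trans ?_
    rw [mul_one]
    exact_mod_cast Nat.sub_le _ _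
  have := abs_le.1 (hc.trans_error₂ G.isSubKernel₁ hh s t a b hUH)
  linarith

theorem Concentrated.model_le_value₂ (hc : Concentrated G K δ D k) (hμ : IsPolicy H μ)
    (hν : IsPolicy H ν) (hν' : IsPolicy H ν') (s : S₁) (t : S₂) :
    evalReward H (D.PHat₁ k) G.P₂ μ ν' G.r H s t ≤ evalReward H G.P₁ G.P₂ μ ν' G.r H s t +
      evalReward H G.P₁ G.P₂ μ ν (fun h s _ a _ => D.bonusP₁ H K δ k h s a) H s t := by
  set U := evalReward H (D.PHat₁ k) G.P₂ μ ν' G.r with hU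
  have hP₁ := D.isSubKernel_PHat₁ H k
  rw [evalReward_eq_add (g := G.r) U (fun h s t a b => G.r h s t a b +
      pairAvg (D.PHat₁ k h s a) (G.P₂ h t b) (U (H - (h + 1)))) (fun _ _ => rfl)
    (fun n hn s t => by rw [hU, evalReward_succ, sub_succ_sub hn]) H le_rfl s t,
    evalReward_congr_right hν hν' G.P₂_mem (fun h s a => D.bonusP₁ H K δ k h s a) H le_rfl s t t,
    add_assoc, ← evalReward_add]
  refine le_add_of_nonneg_right (evalReward_nonneg hμ hν' G.isSubKernel₁ G.isSubKernel₂ ?_ H le_rfl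
    s t)
  intro h hh s t a b
  have hUH : ∀ s t, |U (H - (h + 1)) s t| ≤ H := by
    intro s t
    rw [abs_of_nonneg (evalReward_nonneg hμ hν' hP₁ G.isSubKernel₂
      (fun h hh s t a b => (G.r_mem h hh s t a b).1) _ (by omega) s t)]
    refine (evalReward_le hμ hν' hP₁ G.isSubKernel₂ zero_le_one
      (fun h hh s t a b => (G.r_mem h hh s t a b).2) _ (by omega) s t).trans ?_
    rw [mul_one]
    exact_mod_cast Nat.sub_le _ _
  have := abs_le.1 (hc.trans_error₁ G.isSubKernel₂ hh s t a b hUH)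
  linarith

/-- Optimism: in the half-empirical model, a deviating Player 1 gains at most the linearized
regret over the optimistic value. -/
theorem Concentrated.model_le_vEst₁ (hc : Concentrated G K δ D k) (hk : k ≠ 0) (hμ : IsPolicy H μ)
    (hν : IsPolicy H ν) (hμ' : IsPolicy H μ') :
    evalReward H G.P₁ (D.PHat₂ k) μ' ν G.r H G.x₁ G.x₂ ≤
      D.vEst H k (D.bonus H K δ k) μ ν H G.x₁ G.x₂ + linRegret₁ G D K δ k μ' μ ν := by
  have hP₂ := D.isSubKernel_PHat₂ H k
  rw [← evalReward_advantage₁ hν hμ']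
  set V := D.vEst H k (D.bonus H K δ k) μ ν with hVdef
  set Q := D.qEst H k (D.bonus H K δ k) μ ν with hQ
  have key := evalReward_eq_add (P₁ := G.P₁) (P₂ := D.PHat₂ k) (μ := μ') (ν := ν)
    (g := fun h s t a b => Q h s t a b -
      pairAvg (G.P₁ h s a) (D.PHat₂ k h t b) (V (H - (h + 1)))) V
    (fun h s t _ _ => V (H - h) s t) (fun _ _ => rfl)
    (fun n hn s t => by
      rw [pairAvg_const (hμ' _ (by omega) s).2 (hν _ (by omega) t).2, Nat.sub_sub_self hn])
    H le_rfl G.x₁ G.x₂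
  simp only [sub_add_cancel] at key
  rw [← key]
  refine evalReward_mono hμ' hν G.isSubKernel₁ hP₂ ?_ H le_rfl _ _
  intro h hh s t a b
  have hV : ∀ s t, |V (H - (h + 1)) s t| ≤ H := abs_vEst_le hμ hν _ h
  have e1 := abs_le.1 (hc.trans_error₁ hP₂ hh s t a b hV)
  have e3 := abs_le.1 (hc.reward h hh s t a b)
  have hr := (G.r_mem h hh s t a b).2
  have hh1 : (h : ℝ) + 1 ≤ H := by exact_mod_cast hh
  have hP := pairAvg_le (G.P₁_mem h hh s a).1 (hP₂ h hh t b).1 (G.P₁_mem h hh s a).2.le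
    (hP₂ h hh t b).2 (c := (H : ℝ) - h - 1) (by linarith)
    (vEst_next_le (D := D) (k := k) hμ hν (D.bonus H K δ k) hh)
  rw [← hVdef] at hP
  have hb := D.bonusP₂_nonneg H K δ k h t b
  have hq : min (D.rHat k h s t a b + pairAvg (D.PHat₁ k h s a) (D.PHat₂ k h t b)
      (V (H - (h + 1))) + D.bonus H K δ k h s t a b) ((H : ℝ) - h) ≤ Q h s t a b := by
    rw [hQ, Record.qEst, D.backup_eq]
    exact le_max_left _ _
  rcases min_le_iff.1 hq with hq | hq
  · rw [D.bonus_eq H K δ hk] at hq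
    linarith
  · linarith

/-- Pessimism: in the half-empirical model, a deviating Player 2 improves on the pessimistic value
by at most the linearized regret. -/
theorem Concentrated.vEst_le_model₂ (hc : Concentrated G K δ D k) (hk : k ≠ 0) (hμ : IsPolicy H μ)
    (hν : IsPolicy H ν) (hν' : IsPolicy H ν') :
    D.vEst H k (fun h s t a b => -D.bonus H K δ k h s t a b) μ ν H G.x₁ G.x₂ +
      linRegret₂ G D K δ k ν' μ ν ≤ evalReward H (D.PHat₁ k) G.P₂ μ ν' G.r H G.x₁ G.x₂ := by
  have hP₁ := D.isSubKernel_PHat₁ H k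
  rw [← evalReward_advantage₂ hμ hν']
  set β : ℕ → S₁ → S₂ → A → B → ℝ := fun h s t a b => -D.bonus H K δ k h s t a b with hβ
  set V := D.vEst H k β μ ν with hVdef
  set Q := D.qEst H k β μ ν with hQ
  have key := evalReward_eq_add (P₁ := D.PHat₁ k) (P₂ := G.P₂) (μ := μ) (ν := ν')
    (g := fun h s t a b => Q h s t a b -
      pairAvg (D.PHat₁ k h s a) (G.P₂ h t b) (V (H - (h + 1)))) V
    (fun h s t _ _ => V (H - h) s t) (fun _ _ => rfl)
    (fun n hn s t => by
      rw [pairAvg_const (hμ _ (by omega) s).2 (hν' _ (by omega) t).2, Nat.sub_sub_self hn])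
    H le_rfl G.x₁ G.x₂
  simp only [sub_add_cancel] at key
  rw [← key]
  refine evalReward_mono hμ hν' hP₁ G.isSubKernel₂ ?_ H le_rfl _ _
  intro h hh s t a b
  have hV : ∀ s t, |V (H - (h + 1)) s t| ≤ H := abs_vEst_le hμ hν _ h
  have hV0 : ∀ s t, 0 ≤ V (H - (h + 1)) s t := D.vEst_nonneg hμ hν _ (by omega)
  have e2 := abs_le.1 (hc.trans_error₂ hP₁ hh s t a b hV)
  have e3 := abs_le.1 (hc.reward h hh s t a b)
  have hr := (G.r_mem h hh s t a b).1
  have hP := pairAvg_nonneg (hP₁ h hh s a).1 (G.P₂_mem h hh t b).1 hV0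
  have hb := D.bonusP₁_nonneg H K δ k h s a
  have hq : Q h s t a b ≤ max (D.rHat k h s t a b + pairAvg (D.PHat₁ k h s a) (D.PHat₂ k h t b)
      (V (H - (h + 1))) - D.bonus H K δ k h s t a b) 0 := by
    rw [hQ, Record.qEst, D.backup_eq]
    exact max_le_max (min_le_left _ _) le_rfl
  rcases le_max_iff.1 hq with hq | hq
  · rw [D.bonus_eq H K δ hk] at hq
    linarith
  · linarith

theorem evalReward_bonusP₂_le (hk : k ≠ 0) (hμ : IsPolicy H μ) (hν : IsPolicy H ν) (s : S₁)
    (t : S₂) :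
    evalReward H G.P₁ G.P₂ μ ν (fun h _ t _ b => D.bonusP₂ H K δ k h t b) H s t ≤
      evalReward H G.P₁ G.P₂ μ ν (D.bonus H K δ k) H s t := by
  refine evalReward_mono hμ hν G.isSubKernel₁ G.isSubKernel₂ (fun h _ s t a b => ?_) H le_rfl s t
  have := D.bonusR_nonneg H K δ k h s t a b
  have := D.bonusP₁_nonneg H K δ k h s a
  rw [D.bonus_eq H K δ hk]
  linarith

theorem evalReward_bonusP₁_le (hk : k ≠ 0) (hμ : IsPolicy H μ) (hν : IsPolicy H ν) (s : S₁)
    (t : S₂) :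
    evalReward H G.P₁ G.P₂ μ ν (fun h s _ a _ => D.bonusP₁ H K δ k h s a) H s t ≤
      evalReward H G.P₁ G.P₂ μ ν (D.bonus H K δ k) H s t := by
  refine evalReward_mono hμ hν G.isSubKernel₁ G.isSubKernel₂ (fun h _ s t a b => ?_) H le_rfl s t
  have := D.bonusR_nonneg H K δ k h s t a b
  have := D.bonusP₂_nonneg H K δ k h t b
  rw [D.bonus_eq H K δ hk]
  linarith

/-- The gain of a deviation of Player 1 in one episode. The three bonuses pay for Player 2's
transitions under the deviation and, twice, for the optimism of the estimate on policy. -/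
theorem Concentrated.regret₁_le (hc : Concentrated G K δ D k) (hk : k ≠ 0) (hμ : IsPolicy H μ)
    (hν : IsPolicy H ν) (hμ' : IsPolicy H μ') :
    G.value μ' ν 0 G.x₁ G.x₂ - G.value μ ν 0 G.x₁ G.x₂ ≤
      3 * evalReward H G.P₁ G.P₂ μ ν (D.bonus H K δ k) H G.x₁ G.x₂ +
        linRegret₁ G D K δ k μ' μ ν := by
  rw [G.value_eq_evalReward hμ' hν, G.value_eq_evalReward hμ hν]
  have h1 := hc.value_le_model₁ hμ hν hμ' G.x₁ G.x₂
  have h2 := hc.model_le_vEst₁ hk hμ hν hμ'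
  have h3 := hc.vEst_le_value hk hμ hν G.x₁ G.x₂
  have h4 := evalReward_bonusP₂_le (D := D) (G := G) (K := K) (δ := δ) hk hμ hν G.x₁ G.x₂
  linarith

theorem Concentrated.regret₂_le (hc : Concentrated G K δ D k) (hk : k ≠ 0) (hμ : IsPolicy H μ)
    (hν : IsPolicy H ν) (hν' : IsPolicy H ν') :
    G.value μ ν 0 G.x₁ G.x₂ - G.value μ ν' 0 G.x₁ G.x₂ ≤
      3 * evalReward H G.P₁ G.P₂ μ ν (D.bonus H K δ k) H G.x₁ G.x₂ -
        linRegret₂ G D K δ k ν' μ ν := by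
  rw [G.value_eq_evalReward hμ hν', G.value_eq_evalReward hμ hν]
  have h1 := hc.model_le_value₂ hμ hν hν' G.x₁ G.x₂
  have h2 := hc.vEst_le_model₂ hk hμ hν hν'
  have h3 := hc.value_le_vEst hk hμ hν G.x₁ G.x₂
  have h4 := evalReward_bonusP₁_le (D := D) (G := G) (K := K) (δ := δ) hk hμ hν G.x₁ G.x₂
  linarith

end Hindsight

/-! ### Exponential weights -/

section ExpWeights

variable {C : Type*} [Fintype C]

/-- Hoeffding's lemma for a finite distribution. -/
theorem sum_mul_exp_le {w : C → ℝ} (hw : w ∈ stdSimplex ℝ C) {x : C → ℝ} {c M : ℝ}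
    (hx : ∀ a, x a ∈ Set.Icc c (c + M)) :
    ∑ a, w a * Real.exp (x a) ≤ Real.exp (∑ a, w a * x a + M ^ 2 / 8) := by
  let _ : MeasurableSpace C := ⊤
  have : MeasurableSingletonClass C := ⟨fun _ => trivial⟩
  let ρ : Measure C := ∑ a, ENNReal.ofReal (w a) • Measure.dirac a
  have hρ : IsProbabilityMeasure ρ := by
    constructor
    simp only [ρ, Measure.coe_finsetSum, Finset.sum_apply, Measure.smul_apply, measure_univ,
      smul_eq_mul, mul_one]
    rw [← ENNReal.ofReal_sum_of_nonneg fun a _ => hw.1 a, hw.2, ENNReal.ofReal_one]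
  have hint : ∀ f : C → ℝ, ∫ a, f a ∂ρ = ∑ a, w a * f a := by
    intro f
    have (a : C) : IsFiniteMeasure (ENNReal.ofReal (w a) • Measure.dirac a) :=
      Measure.smul_finite _ ENNReal.ofReal_ne_top
    rw [integral_finsetSum_measure fun a _ => Integrable.of_finite]
    simp [integral_smul_measure, hw.1]
  have hsub := ProbabilityTheory.hasSubgaussianMGF_of_mem_Icc (μ := ρ) (X := x)
    (measurable_from_top).aemeasurable (ae_of_all _ hx)
  have := hsub.mgf_le 1
  rw [ProbabilityTheory.mgf, hint] at this
  simp only [hint, one_mul, Real.exp_sub, add_sub_cancel_left] at this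
  rw [Real.exp_add]
  have h2 : ∑ a, w a * (Real.exp (x a) / Real.exp (∑ a, w a * x a)) =
      (∑ a, w a * Real.exp (x a)) / Real.exp (∑ a, w a * x a) := by
    rw [Finset.sum_div]
    exact Finset.sum_congr rfl fun a _ => by ring
  rw [h2, div_le_iff₀ (Real.exp_pos _), mul_comm] at this
  refine this.trans (le_of_eq ?_)
  congr 2
  push_cast
  rw [Real.norm_eq_abs, div_pow, sq_abs]
  ring

theorem klFin_sub_eq (p q : C → ℝ) (hp : p ∈ stdSimplex ℝ C) (hq : ∀ c, 0 < q c)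
    (hq1 : ∑ c, q c = 1) :
    klFin p q = ∑ c, q c * InformationTheory.klFun (p c / q c) := by
  have : ∀ c, q c * InformationTheory.klFun (p c / q c) =
      p c * Real.log (p c / q c) + (q c - p c) := by
    intro c
    rw [InformationTheory.klFun]
    field_simp [(hq c).ne']
    ring
  simp only [this, Finset.sum_add_distrib, Finset.sum_sub_distrib, hp.2, hq1, sub_self, add_zero,
    klFin]

/-- Gibbs' inequality with its equality case. -/
theorem eq_of_klFin_nonpos {p q : C → ℝ} (hp : p ∈ stdSimplex ℝ C) (hq : ∀ c, 0 < q c)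
    (hq1 : ∑ c, q c = 1) (h : klFin p q ≤ 0) : p = q := by
  rw [klFin_sub_eq p q hp hq hq1] at h
  have hnn : ∀ c, 0 ≤ q c * InformationTheory.klFun (p c / q c) := fun c =>
    mul_nonneg (hq c).le (InformationTheory.klFun_nonneg (div_nonneg (hp.1 c) (hq c).le))
  have h0 := (Finset.sum_eq_zero_iff_of_nonneg fun c _ => hnn c).1
    (le_antisymm h (Finset.sum_nonneg fun c _ => hnn c))
  funext c
  have := (mul_eq_zero.1 (h0 c (Finset.mem_univ c))).resolve_left (hq c).ne'
  rw [InformationTheory.klFun_eq_zero_iff (div_nonneg (hp.1 c) (hq c).le)] at this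
  exact (div_eq_one_iff_eq (hq c).ne').1 this

/-- The exponential-weights update of `w` in direction `g`. -/
def expWeights (η : ℝ) (w g : C → ℝ) (c : C) : ℝ :=
  w c * Real.exp (η * g c) / ∑ c', w c' * Real.exp (η * g c')

variable [Nonempty C]

theorem sum_mul_exp_pos {w : C → ℝ} (hw : ∀ c, 0 < w c) (x : C → ℝ) :
    0 < ∑ c, w c * Real.exp (x c) :=
  Finset.sum_pos (fun c _ => mul_pos (hw c) (Real.exp_pos _)) Finset.univ_nonempty

theorem expWeights_pos (η : ℝ) {w : C → ℝ} (hw : ∀ c, 0 < w c) (g : C → ℝ) (c : C) :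
    0 < expWeights η w g c :=
  div_pos (mul_pos (hw c) (Real.exp_pos _)) (sum_mul_exp_pos hw _)

theorem sum_expWeights (η : ℝ) {w : C → ℝ} (hw : ∀ c, 0 < w c) (g : C → ℝ) :
    ∑ c, expWeights η w g c = 1 := by
  simp only [expWeights, ← Finset.sum_div]
  exact div_self (sum_mul_exp_pos hw fun c => η * g c).ne'

theorem klFin_expWeights (η : ℝ) {w : C → ℝ} (hw : ∀ c, 0 < w c) (g : C → ℝ) {p : C → ℝ}
    (hp : p ∈ stdSimplex ℝ C) :
    klFin p (expWeights η w g) = klFin p w - η * ∑ c, p c * g c +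
      Real.log (∑ c, w c * Real.exp (η * g c)) := by
  have hZ := sum_mul_exp_pos hw fun c => η * g c
  have : ∀ c, p c * Real.log (p c / expWeights η w g c) = p c * Real.log (p c / w c) -
      η * (p c * g c) + p c * Real.log (∑ c, w c * Real.exp (η * g c)) := by
    intro c
    rcases (hp.1 c).eq_or_lt with h0 | h0
    · simp [← h0]
    · rw [Real.log_div h0.ne' (expWeights_pos η hw g c).ne', Real.log_div h0.ne' (hw c).ne',
        expWeights, Real.log_div (mul_pos (hw c) (Real.exp_pos _)).ne' hZ.ne',
        Real.log_mul (hw c).ne' (Real.exp_pos _).ne', Real.log_exp]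
      ring
  simp only [klFin, this, Finset.sum_add_distrib, Finset.sum_sub_distrib, ← Finset.mul_sum,
    ← Finset.sum_mul, hp.2, one_mul]

theorem eq_of_mem_stdSimplex_of_subsingleton [Subsingleton C] {p q : C → ℝ}
    (hp : p ∈ stdSimplex ℝ C) (hq : q ∈ stdSimplex ℝ C) : p = q := by
  have key : ∀ r ∈ stdSimplex ℝ C, ∀ c, r c = 1 := by
    intro r hr c
    rw [← hr.2, Fintype.sum_subsingleton r c]
  funext c
  rw [key p hp, key q hq]

/-- The Kullback–Leibler proximal step is the exponential-weights update. -/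
theorem eq_expWeights_of_isMaxOn {η : ℝ} (hη : 0 < η ∨ Subsingleton C) {w : C → ℝ}
    (hw : ∀ c, 0 < w c) (g : C → ℝ) {p : C → ℝ} (hp : p ∈ stdSimplex ℝ C)
    (hmax : IsMaxOn (fun p : C → ℝ => (∑ c, (p c - w c) * g c) - η⁻¹ * klFin p w)
      (stdSimplex ℝ C) p) : p = expWeights η w g := by
  have hq : expWeights η w g ∈ stdSimplex ℝ C :=
    ⟨fun c => (expWeights_pos η hw g c).le, sum_expWeights η hw g⟩
  rcases hη with hη | hη
  · have h := hmax hq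
    simp only [Set.mem_ofPred_eq, sub_mul, Finset.sum_sub_distrib] at h
    have e1 := klFin_expWeights η hw g hp
    have e2 := klFin_expWeights η hw g hq
    have e3 : klFin (expWeights η w g) (expWeights η w g) = 0 :=
      Finset.sum_eq_zero fun c _ => by
        rw [div_self (expWeights_pos η hw g c).ne', Real.log_one, mul_zero]
    refine eq_of_klFin_nonpos hp (expWeights_pos η hw g) (sum_expWeights η hw g) ?_
    have h' := mul_le_mul_of_nonneg_left h hη.le
    have hc : ∀ x, η * (η⁻¹ * x) = x := fun x => by
      rw [← mul_assoc, mul_inv_cancel₀ hη.ne', one_mul]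
    simp only [mul_sub, hc] at h'
    linarith
  · exact eq_of_mem_stdSimplex_of_subsingleton hp hq

/-- Regret of exponential weights with a fixed step size. -/
theorem expWeights_regret {η c M : ℝ} {K : ℕ} {w g : ℕ → C → ℝ}
    (h0 : ∀ a, w 0 a = 1 / (Fintype.card C : ℝ))
    (hstep : ∀ k < K, w (k + 1) = expWeights η (w k) (g k))
    (hg : ∀ k < K, ∀ a, η * g k a ∈ Set.Icc c (c + M)) {p : C → ℝ} (hp : p ∈ stdSimplex ℝ C) :
    η * ∑ k ∈ Finset.range K, ∑ a, (p a - w k a) * g k a ≤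
      Real.log (Fintype.card C) + K * (M ^ 2 / 8) := by
  have hcard : (0 : ℝ) < Fintype.card C := by exact_mod_cast Fintype.card_pos
  -- The weights after `k` steps are those of the cumulative direction.
  set Φ : ℕ → ℝ := fun k => ∑ a, Real.exp (η * ∑ j ∈ Finset.range k, g j a) with hΦ
  have hΦpos : ∀ k, 0 < Φ k := fun k =>
    Finset.sum_pos (fun _ _ => Real.exp_pos _) Finset.univ_nonempty
  have hw : ∀ k ≤ K, ∀ a, w k a = Real.exp (η * ∑ j ∈ Finset.range k, g j a) / Φ k := by
    intro k
    induction k with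
    | zero => intro _ a; simp [h0, hΦ]
    | succ k ih =>
      intro hk a
      have ih := ih (by omega)
      have hnum : ∀ a, w k a * Real.exp (η * g k a) =
          Real.exp (η * ∑ j ∈ Finset.range (k + 1), g j a) / Φ k := by
        intro a
        rw [ih, Finset.sum_range_succ, mul_add, Real.exp_add]
        ring
      rw [hstep k hk, expWeights]
      simp only [hnum, ← Finset.sum_div]
      rw [div_div_div_cancel_right₀ (hΦpos k).ne']
  have hmem : ∀ k ≤ K, w k ∈ stdSimplex ℝ C := fun k hk =>
    ⟨fun a => by rw [hw k hk]; exact (div_pos (Real.exp_pos _) (hΦpos k)).le, by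
      simp only [hw k hk, ← Finset.sum_div]; exact div_self (hΦpos k).ne'⟩
  have hgrow : ∀ k ≤ K, Φ k ≤ Fintype.card C *
      Real.exp (η * (∑ j ∈ Finset.range k, ∑ a, w j a * g j a) + k * (M ^ 2 / 8)) := by
    intro k
    induction k with
    | zero => intro _; simp [hΦ]
    | succ k ih =>
      intro hk
      have h1 := sum_mul_exp_le (hmem k (by omega)) (hg k hk)
      have h2 : Φ (k + 1) = Φ k * ∑ a, w k a * Real.exp (η * g k a) := by
        have hnum : ∀ a, w k a * Real.exp (η * g k a) =
            Real.exp (η * ∑ j ∈ Finset.range (k + 1), g j a) / Φ k := by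
          intro a
          rw [hw k (by omega), Finset.sum_range_succ, mul_add, Real.exp_add]
          ring
        simp only [hnum, ← Finset.sum_div]
        rw [mul_div_cancel₀ _ (hΦpos k).ne']
      rw [h2]
      refine (mul_le_mul (ih (by omega)) h1 (sum_mul_exp_pos (fun a => ?_) _).le
        (by positivity)).trans (le_of_eq ?_)
      · rw [hw k (by omega)]
        exact div_pos (Real.exp_pos _) (hΦpos k)
      · rw [mul_assoc, ← Real.exp_add, Finset.sum_range_succ]
        congr 2
        have : ∑ a, w k a * (η * g k a) = η * ∑ a, w k a * g k a := by
          rw [Finset.mul_sum]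
          exact Finset.sum_congr rfl fun a _ => by ring
        rw [this]
        push_cast
        ring
  have hvert : ∀ a, η * ∑ j ∈ Finset.range K, g j a ≤ Real.log (Fintype.card C) +
      (η * (∑ j ∈ Finset.range K, ∑ a, w j a * g j a) + K * (M ^ 2 / 8)) := by
    intro a
    have h1 : Real.exp (η * ∑ j ∈ Finset.range K, g j a) ≤ Φ K :=
      Finset.single_le_sum (f := fun a => Real.exp (η * ∑ j ∈ Finset.range K, g j a))
        (fun _ _ => (Real.exp_pos _).le) (Finset.mem_univ a)
    have h2 := Real.log_le_log (Real.exp_pos _) (h1.trans (hgrow K le_rfl))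
    rwa [Real.log_exp, Real.log_mul hcard.ne' (Real.exp_pos _).ne', Real.log_exp] at h2
  have havg := Finset.sum_le_sum fun a (_ : a ∈ Finset.univ) =>
    mul_le_mul_of_nonneg_left (hvert a) (hp.1 a)
  rw [← Finset.sum_mul, hp.2, one_mul] at havg
  have hswap : ∑ a, p a * (η * ∑ j ∈ Finset.range K, g j a) =
      η * ∑ j ∈ Finset.range K, ∑ a, p a * g j a := by
    simp only [Finset.mul_sum]
    rw [Finset.sum_comm]
    exact Finset.sum_congr rfl fun _ _ => Finset.sum_congr rfl fun _ _ => by ring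
  simp only [sub_mul, Finset.sum_sub_distrib, mul_sub]
  linarith

/-- Regret of exponential weights with the tuned step size `√(log |C| / (K H²))`. -/
theorem expWeights_regret_tuned {η c H : ℝ} {K : ℕ} (hK : 1 ≤ K) (hH : 0 < H)
    (hη : η = Real.sqrt (Real.log (Fintype.card C) / (K * H ^ 2))) {w g : ℕ → C → ℝ}
    (h0 : ∀ a, w 0 a = 1 / (Fintype.card C : ℝ))
    (hstep : ∀ k < K, w (k + 1) = expWeights η (w k) (g k))
    (hg : ∀ k < K, ∀ a, g k a ∈ Set.Icc c (c + H)) {p : C → ℝ} (hp : p ∈ stdSimplex ℝ C) :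
    ∑ k ∈ Finset.range K, ∑ a, (p a - w k a) * g k a ≤
      2 * H * Real.sqrt (K * Real.log (Fintype.card C)) := by
  have hKpos : (0 : ℝ) < K := by exact_mod_cast hK
  have hpos : ∀ k ≤ K, ∀ a, 0 < w k a := by
    intro k
    induction k with
    | zero =>
      intro _ a
      rw [h0]
      have : (0 : ℝ) < Fintype.card C := by exact_mod_cast Fintype.card_pos
      positivity
    | succ k ih =>
      intro hk a
      rw [hstep k hk]
      exact expWeights_pos η (ih (by omega)) _ a
  rcases subsingleton_or_nontrivial C with hC | hC
  · have : ∀ k ∈ Finset.range K, ∑ a, (p a - w k a) * g k a = 0 := by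
      intro k hk
      have hk : k < K := Finset.mem_range.1 hk
      have hwk : w k ∈ stdSimplex ℝ C := by
        refine ⟨fun a => (hpos k hk.le a).le, ?_⟩
        cases k with
        | zero =>
          have : (Fintype.card C : ℝ) ≠ 0 := by exact_mod_cast Fintype.card_ne_zero
          simp [h0, this]
        | succ k =>
          rw [hstep k (by omega)]
          exact sum_expWeights η (hpos k (by omega)) _
      rw [eq_of_mem_stdSimplex_of_subsingleton hp hwk]
      simp
    rw [Finset.sum_eq_zero this]
    positivity
  · have hlog : 0 < Real.log (Fintype.card C) :=
      Real.log_pos (by exact_mod_cast Fintype.one_lt_card)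
    have hηpos : 0 < η := by rw [hη]; positivity
    have hsq : η ^ 2 * (K * H ^ 2) = Real.log (Fintype.card C) := by
      rw [hη, Real.sq_sqrt (by positivity)]
      field_simp
    have hreg := expWeights_regret (c := η * c) (M := η * H) h0 hstep (fun k hk a => by
      rw [← mul_add]
      exact ⟨mul_le_mul_of_nonneg_left (hg k hk a).1 hηpos.le,
        mul_le_mul_of_nonneg_left (hg k hk a).2 hηpos.le⟩) hp
    have hval : Real.sqrt (K * Real.log (Fintype.card C)) = η * K * H := by
      rw [← hsq, show (K : ℝ) * (η ^ 2 * (K * H ^ 2)) = (η * K * H) ^ 2 by ring]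
      exact Real.sqrt_sq (by positivity)
    rw [hval]
    refine le_of_mul_le_mul_left (hreg.trans ?_) hηpos
    rw [← hsq]
    have : 0 ≤ η ^ 2 * (K * H ^ 2) := by positivity
    nlinarith

end ExpWeights

section SimultaneousUpdate

variable {C : Type*} [Fintype C] [Nonempty C]

/-- The proximal step taken simultaneously at all steps of the episode decouples. -/
theorem eq_expWeights_of_isMaxOn_sum {H : ℕ} {η : ℝ} (hη : 0 < η ∨ Subsingleton C)
    {w : ℕ → C → ℝ} (hw : ∀ h < H, ∀ c, 0 < w h c) (g : ℕ → C → ℝ) {p : ℕ → C → ℝ}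
    (hp : ∀ h < H, p h ∈ stdSimplex ℝ C)
    (hmax : IsMaxOn (fun p : ℕ → C → ℝ => ∑ h ∈ Finset.range H,
        ((∑ c, (p h c - w h c) * g h c) - η⁻¹ * klFin (p h) (w h)))
      {p | ∀ h < H, p h ∈ stdSimplex ℝ C} p) :
    ∀ h < H, p h = expWeights η (w h) (g h) := by
  intro h hh
  refine eq_expWeights_of_isMaxOn hη (hw h hh) (g h) (hp h hh) fun q hq => ?_
  have hmem : Function.update p h q ∈ {p : ℕ → C → ℝ | ∀ h < H, p h ∈ stdSimplex ℝ C} := by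
    intro i hi
    by_cases hih : i = h
    · subst hih
      rw [Function.update_self]
      exact hq
    · rw [Function.update_of_ne hih]
      exact hp i hi
  have := hmax hmem
  simp only [Set.mem_ofPred_eq] at this ⊢
  rw [← Finset.add_sum_erase _ _ (Finset.mem_range.2 hh),
    ← Finset.add_sum_erase (Finset.range H) _ (Finset.mem_range.2 hh)] at this
  have hrest : ∀ i ∈ (Finset.range H).erase h, Function.update p h q i = p i := fun i hi =>
    Function.update_of_ne (Finset.ne_of_mem_erase hi) _ _
  rw [Finset.sum_congr (s₁ := (Finset.range H).erase h) rfl fun i hi =>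
    congrArg (fun q : C → ℝ => (∑ c, (q c - w i c) * g i c) - η⁻¹ * klFin q (w i)) (hrest i hi),
    Function.update_self] at this
  exact le_of_add_le_add_right this

theorem abs_sum_sub_mul_le {p w g : C → ℝ} {c M : ℝ} (hp : p ∈ stdSimplex ℝ C)
    (hw : w ∈ stdSimplex ℝ C) (hg : ∀ a, g a ∈ Set.Icc c (c + M)) :
    |∑ a, (p a - w a) * g a| ≤ M := by
  have key : ∀ r ∈ stdSimplex ℝ C, ∑ a, r a * g a ∈ Set.Icc c (c + M) := by
    intro r hr
    constructor
    · calc c = ∑ a, r a * c := by rw [← Finset.sum_mul, hr.2, one_mul]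
        _ ≤ _ := Finset.sum_le_sum fun a _ => mul_le_mul_of_nonneg_left (hg a).1 (hr.1 a)
    · calc _ ≤ ∑ a, r a * (c + M) :=
            Finset.sum_le_sum fun a _ => mul_le_mul_of_nonneg_left (hg a).2 (hr.1 a)
        _ = c + M := by rw [← Finset.sum_mul, hr.2, one_mul]
  have h1 := key p hp
  have h2 := key w hw
  simp only [sub_mul, Finset.sum_sub_distrib]
  rw [abs_le]
  constructor <;> linarith [h1.1, h1.2, h2.1, h2.2]

/-- Regret over the rounds `1, …, K`. The updates control the rounds `0, …, K - 1`; the two rounds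
by which the ranges differ cost at most `H` each. -/
theorem expWeights_regret_Icc {η c H : ℝ} {K : ℕ} (hK : 1 ≤ K) (hH : 0 < H)
    (hη : η = Real.sqrt (Real.log (Fintype.card C) / (K * H ^ 2))) {w g : ℕ → C → ℝ}
    (h0 : ∀ a, w 0 a = 1 / (Fintype.card C : ℝ)) (hw : ∀ k ≤ K, w k ∈ stdSimplex ℝ C)
    (hstep : ∀ k < K, w (k + 1) = expWeights η (w k) (g k))
    (hg : ∀ k ≤ K, ∀ a, g k a ∈ Set.Icc c (c + H)) {p : C → ℝ} (hp : p ∈ stdSimplex ℝ C) :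
    ∑ k ∈ Finset.Icc 1 K, ∑ a, (p a - w k a) * g k a ≤
      2 * H * Real.sqrt (K * Real.log (Fintype.card C)) + 2 * H := by
  have h1 := expWeights_regret_tuned hK hH hη h0 hstep (fun k hk => hg k hk.le) hp
  have h2 := (abs_le.1 (abs_sum_sub_mul_le hp (hw 0 (Nat.zero_le _)) (hg 0 (Nat.zero_le _)))).1
  have h3 := (abs_le.1 (abs_sum_sub_mul_le hp (hw K le_rfl) (hg K le_rfl))).2
  have h4 := Finset.sum_range_succ (fun k => ∑ a, (p a - w k a) * g k a) K
  have h5 := Finset.sum_range_succ' (fun k => ∑ a, (p a - w k a) * g k a) K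
  have h6 : ∑ k ∈ Finset.Icc 1 K, ∑ a, (p a - w k a) * g k a =
      ∑ k ∈ Finset.range K, ∑ a, (p a - w (k + 1) a) * g (k + 1) a := by
    rw [Finset.range_eq_Ico, Finset.sum_Ico_add' (fun k => ∑ a, (p a - w k a) * g k a) 0 K 1]
    rfl
  linarith

end SimultaneousUpdate

/-! ### Policy optimization along a fixed sequence of observations -/

section Pathwise

variable {S₁ S₂ A B : Type*} [Fintype S₁] [Fintype S₂] [Fintype A] [Fintype B]
  [DecidableEq S₁] [DecidableEq S₂] [DecidableEq A] [DecidableEq B] [Nonempty A] [Nonempty B]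
  {H K : ℕ} {δ η γ : ℝ} {D : Record S₁ S₂ A B} {μ : ℕ → Policy S₁ A} {ν : ℕ → Policy S₂ B}

theorem uniform_mem_stdSimplex {C : Type*} [Fintype C] [Nonempty C] {p : C → ℝ}
    (h : ∀ c, p c = 1 / (Fintype.card C : ℝ)) : p ∈ stdSimplex ℝ C := by
  refine ⟨fun c => by rw [h]; positivity, ?_⟩
  have : (Fintype.card C : ℝ) ≠ 0 := by exact_mod_cast Fintype.card_ne_zero
  simp [h, this]

theorem IsAlgorithm₁.isPolicy' {x₂ : S₂} (hA : IsAlgorithm₁ H K δ η x₂ D μ ν) :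
    ∀ k ≤ K, IsPolicy H (μ k) := by
  intro k hk
  cases k with
  | zero => exact fun h hh s => uniform_mem_stdSimplex (hA.init h hh s)
  | succ k => exact hA.isPolicy k hk

theorem IsAlgorithm₂.isPolicy' {x₁ : S₁} (hA : IsAlgorithm₂ H K δ γ x₁ D μ ν) :
    ∀ k ≤ K, IsPolicy H (ν k) := by
  intro k hk
  cases k with
  | zero => exact fun h hh s => uniform_mem_stdSimplex (hA.init h hh s)
  | succ k => exact hA.isPolicy k hk

theorem stepSize_pos {C : Type*} [Fintype C] [Nonempty C] (hK : 1 ≤ K) (hH : 1 ≤ H)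
    (hη : η = Real.sqrt (Real.log (Fintype.card C) / (K * (H : ℝ) ^ 2))) :
    0 < η ∨ Subsingleton C := by
  rcases subsingleton_or_nontrivial C with hC | hC
  · exact Or.inr hC
  · left
    have hlog : 0 < Real.log (Fintype.card C) :=
      Real.log_pos (by exact_mod_cast Fintype.one_lt_card)
    rw [hη]
    have : (0 : ℝ) < K := by exact_mod_cast hK
    have : (0 : ℝ) < H := by exact_mod_cast hH
    positivity

/-- At every step and own state, Player 1 runs exponential weights along the gradients. -/
theorem IsAlgorithm₁.step_eq {x₂ : S₂} (hA : IsAlgorithm₁ H K δ η x₂ D μ ν)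
    (hη : 0 < η ∨ Subsingleton A) : ∀ k < K, ∀ h < H, ∀ s,
      μ (k + 1) h s = expWeights η (μ k h s) (D.grad₁ H K δ x₂ k (μ k) (ν k) h s) := by
  have hpos : ∀ k ≤ K, ∀ h < H, ∀ s a, 0 < μ k h s a := by
    intro k
    induction k with
    | zero =>
      intro _ h hh s a
      rw [hA.init h hh]
      have : (0 : ℝ) < Fintype.card A := by exact_mod_cast Fintype.card_pos
      positivity
    | succ k ih =>
      intro hk h hh s a
      rw [eq_expWeights_of_isMaxOn_sum hη (fun h hh => ih (by omega) h hh s)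
        (fun h => D.grad₁ H K δ x₂ k (μ k) (ν k) h s) (fun h hh => hA.isPolicy k hk h hh s)
        (hA.update k hk s) h hh]
      exact expWeights_pos η (ih (by omega) h hh s) _ a
  intro k hk h hh s
  exact eq_expWeights_of_isMaxOn_sum hη (fun h hh => hpos k hk.le h hh s)
    (fun h => D.grad₁ H K δ x₂ k (μ k) (ν k) h s) (fun h hh => hA.isPolicy k hk h hh s)
    (hA.update k hk s) h hh

theorem IsAlgorithm₂.step_eq {x₁ : S₁} (hA : IsAlgorithm₂ H K δ γ x₁ D μ ν)
    (hγ : 0 < γ ∨ Subsingleton B) : ∀ k < K, ∀ h < H, ∀ t,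
      ν (k + 1) h t =
        expWeights γ (ν k h t) (fun b => -D.grad₂ H K δ x₁ k (μ k) (ν k) h t b) := by
  have hmax : ∀ k < K, ∀ t : S₂, IsMaxOn (fun p : ℕ → B → ℝ => ∑ h ∈ Finset.range H,
        ((∑ b, (p h b - ν k h t b) * -D.grad₂ H K δ x₁ k (μ k) (ν k) h t b) -
          γ⁻¹ * klFin (p h) (ν k h t)))
      {p | ∀ h < H, p h ∈ stdSimplex ℝ B} (fun h => ν (k + 1) h t) := by
    intro k hk t p hp
    have h := hA.update k hk t hp
    simp only [Set.mem_ofPred_eq, mul_neg, Finset.sum_neg_distrib, neg_sub_left,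
      Finset.sum_neg_distrib] at h ⊢
    rw [neg_le_neg_iff]
    simpa only [add_comm] using h
  have hpos : ∀ k ≤ K, ∀ h < H, ∀ t b, 0 < ν k h t b := by
    intro k
    induction k with
    | zero =>
      intro _ h hh s a
      rw [hA.init h hh]
      have : (0 : ℝ) < Fintype.card B := by exact_mod_cast Fintype.card_pos
      positivity
    | succ k ih =>
      intro hk h hh t b
      rw [eq_expWeights_of_isMaxOn_sum hγ (fun h hh => ih (by omega) h hh t)
        (fun h b => -D.grad₂ H K δ x₁ k (μ k) (ν k) h t b) (fun h hh => hA.isPolicy k hk h hh t)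
        (hmax k hk t) h hh]
      exact expWeights_pos γ (ih (by omega) h hh t) _ b
  intro k hk h hh t
  exact eq_expWeights_of_isMaxOn_sum hγ (fun h hh => hpos k hk.le h hh t)
    (fun h b => -D.grad₂ H K δ x₁ k (μ k) (ν k) h t b) (fun h hh => hA.isPolicy k hk h hh t)
    (hmax k hk t) h hh

theorem Record.grad₁_mem (D : Record S₁ S₂ A B) (x₂ : S₂) (k : ℕ) {π : Policy S₁ A}
    {ρ : Policy S₂ B} (hρ : IsPolicy H ρ) {h : ℕ} (hh : h < H) (s : S₁) (a : A) :
    D.grad₁ H K δ x₂ k π ρ h s a ∈ Set.Icc (0 : ℝ) H := by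
  have hd := reach_nonneg (x := x₂) hρ (D.isSubKernel_PHat₂ H k) h hh.le
  have hd1 := sum_reach_le_one (x := x₂) hρ (D.isSubKernel_PHat₂ H k) h hh.le
  have hQ := fun t b => D.qEst_mem (k := k) (β := D.bonus H K δ k) (μ := π) (ν := ρ) hh s t a b
  refine ⟨Finset.sum_nonneg fun t _ => mul_nonneg (Finset.sum_nonneg fun b _ =>
    mul_nonneg (hQ t b).1 ((hρ h hh t).1 b)) (hd t), ?_⟩
  calc _ ≤ ∑ t, (H : ℝ) * reach x₂ ρ (D.PHat₂ k) h t := by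
        refine Finset.sum_le_sum fun t _ => mul_le_mul_of_nonneg_right ?_ (hd t)
        calc _ ≤ ∑ b, (H : ℝ) * ρ h t b := Finset.sum_le_sum fun b _ =>
              mul_le_mul_of_nonneg_right (hQ t b).2 ((hρ h hh t).1 b)
          _ = H := by rw [← Finset.mul_sum, (hρ h hh t).2, mul_one]
    _ ≤ H := by
        rw [← Finset.mul_sum]
        exact mul_le_of_le_one_right (by positivity) hd1

theorem Record.grad₂_mem (D : Record S₁ S₂ A B) (x₁ : S₁) (k : ℕ) {π : Policy S₁ A}
    {ρ : Policy S₂ B} (hπ : IsPolicy H π) {h : ℕ} (hh : h < H) (t : S₂) (b : B) :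
    D.grad₂ H K δ x₁ k π ρ h t b ∈ Set.Icc (0 : ℝ) H := by
  have hd := reach_nonneg (x := x₁) hπ (D.isSubKernel_PHat₁ H k) h hh.le
  have hd1 := sum_reach_le_one (x := x₁) hπ (D.isSubKernel_PHat₁ H k) h hh.le
  have hQ := fun s a => D.qEst_mem (k := k) (β := fun h s t a b => -D.bonus H K δ k h s t a b)
    (μ := π) (ν := ρ) hh s t a b
  refine ⟨Finset.sum_nonneg fun s _ => mul_nonneg (Finset.sum_nonneg fun a _ =>
    mul_nonneg (hQ s a).1 ((hπ h hh s).1 a)) (hd s), ?_⟩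
  calc _ ≤ ∑ s, (H : ℝ) * reach x₁ π (D.PHat₁ k) h s := by
        refine Finset.sum_le_sum fun s _ => mul_le_mul_of_nonneg_right ?_ (hd s)
        calc _ ≤ ∑ a, (H : ℝ) * π h s a := Finset.sum_le_sum fun a _ =>
              mul_le_mul_of_nonneg_right (hQ s a).2 ((hπ h hh s).1 a)
          _ = H := by rw [← Finset.mul_sum, (hπ h hh s).2, mul_one]
    _ ≤ H := by
        rw [← Finset.mul_sum]
        exact mul_le_of_le_one_right (by positivity) hd1

/-- A bound at each state transfers to the average over fixed reaching probabilities. -/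
theorem sum_reach_mul_le {S C : Type*} [Fintype S] [Fintype C] [DecidableEq S] {x : S}
    {π : Policy S C} {P : ℕ → S → C → S → ℝ} (hπ : IsPolicy H π) (hP : IsSubKernel H P)
    (J : Finset ℕ) (f : ℕ → ℕ → S → ℝ) {c : ℝ} (hc : 0 ≤ c)
    (hf : ∀ h < H, ∀ s, ∑ k ∈ J, f k h s ≤ c) :
    ∑ k ∈ J, ∑ h ∈ Finset.range H, ∑ s, reach x π P h s * f k h s ≤ H * c := by
  calc _ = ∑ h ∈ Finset.range H, ∑ s, reach x π P h s * ∑ k ∈ J, f k h s := by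
        rw [Finset.sum_comm]
        refine Finset.sum_congr rfl fun h _ => ?_
        rw [Finset.sum_comm]
        exact Finset.sum_congr rfl fun s _ => (Finset.mul_sum _ _ _).symm
    _ ≤ ∑ h ∈ Finset.range H, c := by
        refine Finset.sum_le_sum fun h hh => ?_
        have hh : h < H := Finset.mem_range.1 hh
        calc _ ≤ ∑ s, reach x π P h s * c := Finset.sum_le_sum fun s _ =>
              mul_le_mul_of_nonneg_left (hf h hh s) (reach_nonneg hπ hP h hh.le s)
          _ ≤ c := by
              rw [← Finset.sum_mul]
              exact mul_le_of_le_one_left hc (sum_reach_le_one hπ hP h hh.le)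
    _ = H * c := by simp

variable {G : Game S₁ S₂ A B H}

theorem IsAlgorithm₁.sum_linRegret_le (hK : 1 ≤ K) (hH : 1 ≤ H)
    (hη : η = Real.sqrt (Real.log (Fintype.card A) / (K * (H : ℝ) ^ 2)))
    (hA : IsAlgorithm₁ H K δ η G.x₂ D μ ν) (hν : ∀ k ≤ K, IsPolicy H (ν k))
    {μ' : Policy S₁ A} (hμ' : IsPolicy H μ') :
    ∑ k ∈ Finset.Icc 1 K, linRegret₁ G D K δ k μ' (μ k) (ν k) ≤
      H * (2 * H * Real.sqrt (K * Real.log (Fintype.card A)) + 2 * H) := by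
  have hHpos : (0 : ℝ) < H := by exact_mod_cast hH
  refine sum_reach_mul_le hμ' G.isSubKernel₁ _ (fun k h s =>
    ∑ a, (μ' h s a - μ k h s a) * D.grad₁ H K δ G.x₂ k (μ k) (ν k) h s a) (by positivity) ?_
  intro h hh s
  exact expWeights_regret_Icc (c := 0) hK hHpos hη (w := fun k => μ k h s)
    (hA.init h hh s) (fun k hk => hA.isPolicy' k hk h hh s)
    (fun k hk => hA.step_eq (stepSize_pos hK hH hη) k hk h hh s)
    (fun k hk a => by rw [zero_add]; exact D.grad₁_mem G.x₂ k (hν k hk) hh s a) (hμ' h hh s)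

theorem IsAlgorithm₂.sum_linRegret_le (hK : 1 ≤ K) (hH : 1 ≤ H)
    (hγ : γ = Real.sqrt (Real.log (Fintype.card B) / (K * (H : ℝ) ^ 2)))
    (hA : IsAlgorithm₂ H K δ γ G.x₁ D μ ν) (hμ : ∀ k ≤ K, IsPolicy H (μ k))
    {ν' : Policy S₂ B} (hν' : IsPolicy H ν') :
    ∑ k ∈ Finset.Icc 1 K, -linRegret₂ G D K δ k ν' (μ k) (ν k) ≤
      H * (2 * H * Real.sqrt (K * Real.log (Fintype.card B)) + 2 * H) := by
  have hHpos : (0 : ℝ) < H := by exact_mod_cast hH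
  have := sum_reach_mul_le (x := G.x₂) hν' G.isSubKernel₂ (Finset.Icc 1 K) (fun k h t =>
    ∑ b, (ν' h t b - ν k h t b) * -D.grad₂ H K δ G.x₁ k (μ k) (ν k) h t b)
    (c := 2 * H * Real.sqrt (K * Real.log (Fintype.card B)) + 2 * H) (by positivity) ?_
  · simpa only [linRegret₂, mul_neg, Finset.sum_neg_distrib] using this
  intro h hh t
  exact expWeights_regret_Icc (c := -H) hK hHpos hγ (w := fun k => ν k h t)
    (hA.init h hh t) (fun k hk => hA.isPolicy' k hk h hh t)
    (fun k hk => hA.step_eq (stepSize_pos hK hH hγ) k hk h hh t)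
    (fun k hk b => by
      have := D.grad₂_mem (K := K) (δ := δ) (ρ := ν k) G.x₁ k (hμ k hk) hh t b
      exact ⟨neg_le_neg this.2, by linarith [this.1]⟩) (hν' h hh t)

theorem exists_isPolicy (S C : Type*) [Fintype C] [Nonempty C] (H : ℕ) :
    ∃ π : Policy S C, IsPolicy H π :=
  ⟨fun _ _ _ => 1 / (Fintype.card C : ℝ), fun _ _ _ => uniform_mem_stdSimplex fun _ => rfl⟩

/-- On the event that all estimates are concentrated, the gap is governed by the expected bonuses
and the regret of exponential weights. -/
theorem gap_le_of_concentrated (hK : 1 ≤ K) (hH : 1 ≤ H)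
    (hη : η = Real.sqrt (Real.log (Fintype.card A) / (K * (H : ℝ) ^ 2)))
    (hγ : γ = Real.sqrt (Real.log (Fintype.card B) / (K * (H : ℝ) ^ 2)))
    (hA : IsAlgorithm₁ H K δ η G.x₂ D μ ν) (hB : IsAlgorithm₂ H K δ γ G.x₁ D μ ν)
    (hc : ∀ k ∈ Finset.Icc 1 K, Concentrated G K δ D k) :
    G.gap K μ ν ≤ 6 * ∑ k ∈ Finset.Icc 1 K,
        evalReward H G.P₁ G.P₂ (μ k) (ν k) (D.bonus H K δ k) H G.x₁ G.x₂ +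
      (H * (2 * H * Real.sqrt (K * Real.log (Fintype.card A)) + 2 * H) +
        H * (2 * H * Real.sqrt (K * Real.log (Fintype.card B)) + 2 * H)) := by
  have hμ := hA.isPolicy'
  have hν := hB.isPolicy'
  have hk0 : ∀ k ∈ Finset.Icc 1 K, k ≠ 0 ∧ k ≤ K := fun k hk => by
    have := Finset.mem_Icc.1 hk
    omega
  have h1 : G.regret₁ K μ ν ≤ 3 * ∑ k ∈ Finset.Icc 1 K,
        evalReward H G.P₁ G.P₂ (μ k) (ν k) (D.bonus H K δ k) H G.x₁ G.x₂ +
      H * (2 * H * Real.sqrt (K * Real.log (Fintype.card A)) + 2 * H) := by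
    obtain ⟨π, hπ⟩ := exists_isPolicy S₁ A H
    have : Nonempty {π : Policy S₁ A // IsPolicy H π} := ⟨⟨π, hπ⟩⟩
    rw [Game.regret₁, sub_le_iff_le_add]
    refine ciSup_le fun μ' => ?_
    rw [← sub_le_iff_le_add, ← Finset.sum_sub_distrib]
    refine (Finset.sum_le_sum fun k hk => (hc k hk).regret₁_le (hk0 k hk).1 (hμ k (hk0 k hk).2)
      (hν k (hk0 k hk).2) μ'.2).trans ?_
    rw [Finset.sum_add_distrib, ← Finset.mul_sum]
    exact add_le_add le_rfl (hA.sum_linRegret_le hK hH hη hν μ'.2)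
  have h2 : G.regret₂ K μ ν ≤ 3 * ∑ k ∈ Finset.Icc 1 K,
        evalReward H G.P₁ G.P₂ (μ k) (ν k) (D.bonus H K δ k) H G.x₁ G.x₂ +
      H * (2 * H * Real.sqrt (K * Real.log (Fintype.card B)) + 2 * H) := by
    obtain ⟨π, hπ⟩ := exists_isPolicy S₂ B H
    have : Nonempty {π : Policy S₂ B // IsPolicy H π} := ⟨⟨π, hπ⟩⟩
    rw [Game.regret₂, sub_le_comm]
    refine le_ciInf fun ν' => ?_
    rw [sub_le_comm, ← Finset.sum_sub_distrib]
    refine (Finset.sum_le_sum fun k hk => (hc k hk).regret₂_le (hk0 k hk).1 (hμ k (hk0 k hk).2)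
      (hν k (hk0 k hk).2) ν'.2).trans ?_
    simp only [sub_eq_add_neg, Finset.sum_add_distrib, ← Finset.mul_sum]
    exact add_le_add le_rfl (hB.sum_linRegret_le hK hH hγ hμ ν'.2)
  rw [Game.gap]
  linarith

/-- Without any choice of actions there is nothing to regret. -/
theorem gap_nonpos_of_subsingleton [Subsingleton A] [Subsingleton B]
    (hμ : ∀ k ≤ K, IsPolicy H (μ k)) (hν : ∀ k ≤ K, IsPolicy H (ν k)) : G.gap K μ ν ≤ 0 := by
  have e1 : ∀ π π' : Policy S₁ A, IsPolicy H π → IsPolicy H π' → ∀ ρ ρ' : Policy S₂ B,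
      IsPolicy H ρ → IsPolicy H ρ' → G.value π ρ 0 G.x₁ G.x₂ = G.value π' ρ' 0 G.x₁ G.x₂ := by
    intro π π' hπ hπ' ρ ρ' hρ hρ'
    have a1 : ∀ h < H, ∀ s, π h s = π' h s := fun h hh s =>
      eq_of_mem_stdSimplex_of_subsingleton (hπ h hh s) (hπ' h hh s)
    have a2 : ∀ h < H, ∀ t, ρ h t = ρ' h t := fun h hh t =>
      eq_of_mem_stdSimplex_of_subsingleton (hρ h hh t) (hρ' h hh t)
    simp only [Game.value, Game.trajProb]
    refine Finset.sum_congr rfl fun τ _ => ?_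
    congr 1
    refine Finset.prod_congr rfl fun i _ => ?_
    rw [a1 _ (by omega), a2 _ (by omega)]
  have hk0 : ∀ k ∈ Finset.Icc 1 K, k ≤ K := fun k hk => (Finset.mem_Icc.1 hk).2
  have h1 : G.regret₁ K μ ν ≤ 0 := by
    obtain ⟨π, hπ⟩ := exists_isPolicy S₁ A H
    have : Nonempty {π : Policy S₁ A // IsPolicy H π} := ⟨⟨π, hπ⟩⟩
    rw [Game.regret₁, sub_nonpos]
    exact ciSup_le fun μ' => le_of_eq <| Finset.sum_congr rfl fun k hk =>
      e1 _ _ μ'.2 (hμ k (hk0 k hk)) _ _ (hν k (hk0 k hk)) (hν k (hk0 k hk))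
  have h2 : G.regret₂ K μ ν ≤ 0 := by
    obtain ⟨π, hπ⟩ := exists_isPolicy S₂ B H
    have : Nonempty {π : Policy S₂ B // IsPolicy H π} := ⟨⟨π, hπ⟩⟩
    rw [Game.regret₂, sub_nonpos]
    exact le_ciInf fun ν' => le_of_eq <| Finset.sum_congr rfl fun k hk =>
      e1 _ _ (hμ k (hk0 k hk)) (hμ k (hk0 k hk)) _ _ (hν k (hk0 k hk)) ν'.2
  rw [Game.gap]
  linarith

end Pathwise

/-! ### Exponential supermartingales -/

section Supermartingale

variable {Ω : Type*} {mΩ : MeasurableSpace Ω} {ℙ : Measure Ω} [IsProbabilityMeasure ℙ]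

theorem integrable_of_ae_mem_Icc {f : Ω → ℝ} (hf : Measurable f) {C : ℝ}
    (h : ∀ᵐ ω ∂ℙ, f ω ∈ Set.Icc 0 C) : Integrable f ℙ :=
  Integrable.of_mem_Icc 0 C hf.aemeasurable h

/-- A product of nonnegative factors, each of conditional mean at most one given the previous
factors, has mean at most one. -/
theorem integral_prod_le_one {N : ℕ} {F : ℕ → MeasurableSpace Ω} {Z : ℕ → Ω → ℝ} {C : ℝ}
    (hF : ∀ j < N, F j ≤ mΩ) (hZF : ∀ j < N, ∀ i < j, Measurable[F j] (Z i))
    (hZ : ∀ j < N, Measurable (Z j)) (hZC : ∀ j < N, ∀ᵐ ω ∂ℙ, Z j ω ∈ Set.Icc 0 C)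
    (hmean : ∀ j < N, ℙ[Z j | F j] ≤ᵐ[ℙ] fun _ => 1) :
    Integrable (fun ω => ∏ j ∈ Finset.range N, Z j ω) ℙ ∧
      (∀ᵐ ω ∂ℙ, 0 ≤ ∏ j ∈ Finset.range N, Z j ω) ∧
      ∫ ω, ∏ j ∈ Finset.range N, Z j ω ∂ℙ ≤ 1 := by
  have hC : ∀ n ≤ N, Measurable (fun ω => ∏ j ∈ Finset.range n, Z j ω) := fun n hn =>
    Finset.measurable_fun_prod _ fun j hj => hZ j (by have := Finset.mem_range.1 hj; omega)
  have hbd : ∀ n ≤ N, ∀ᵐ ω ∂ℙ, ∏ j ∈ Finset.range n, Z j ω ∈ Set.Icc 0 (C ^ n) := by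
    intro n
    induction n with
    | zero => intro _; simp
    | succ n ih =>
      intro hn
      filter_upwards [ih (by omega), hZC n hn] with ω h1 h2
      rw [Finset.prod_range_succ, pow_succ]
      exact ⟨mul_nonneg h1.1 h2.1, mul_le_mul h1.2 h2.2 h2.1 (h1.1.trans h1.2)⟩
  have hint : ∀ n ≤ N, Integrable (fun ω => ∏ j ∈ Finset.range n, Z j ω) ℙ := fun n hn =>
    integrable_of_ae_mem_Icc (hC n hn) (hbd n hn)
  refine ⟨hint N le_rfl, (hbd N le_rfl).mono fun ω h => h.1, ?_⟩
  have main : ∀ n ≤ N, ∫ ω, ∏ j ∈ Finset.range n, Z j ω ∂ℙ ≤ 1 := by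
    intro n
    induction n with
    | zero => intro _; simp
    | succ n ih =>
      intro hn
      refine le_trans ?_ (ih (by omega))
      set P : Ω → ℝ := fun ω => ∏ j ∈ Finset.range n, Z j ω with hP
      have hPF : Measurable[F n] P :=
        Finset.measurable_fun_prod _ fun j hj => hZF n hn j (Finset.mem_range.1 hj)
      have hprod : (fun ω => ∏ j ∈ Finset.range (n + 1), Z j ω) = P * Z n := by
        funext ω
        rw [Finset.prod_range_succ]
        rfl
      have hPZ : Integrable (P * Z n) ℙ := hprod ▸ hint (n + 1) hn
      rw [hprod, ← integral_condExp (hF n hn)]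
      have hpull := condExp_mul_of_stronglyMeasurable_left (μ := ℙ) hPF.stronglyMeasurable hPZ
        (integrable_of_ae_mem_Icc (hZ n hn) (hZC n hn))
      refine integral_mono_ae integrable_condExp (hint n (by omega)) ?_
      filter_upwards [hpull, hmean n hn, hbd n (by omega)] with ω h1 h2 h3
      rw [h1, Pi.mul_apply]
      exact mul_le_of_le_one_right h3.1 h2
  exact main N le_rfl

/-- Markov's inequality for a product of conditionally normalized exponentials. -/
theorem measure_exp_sum_le {N : ℕ} {F : ℕ → MeasurableSpace Ω} {Y : ℕ → Ω → ℝ} {C : ℝ}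
    (hF : ∀ j < N, F j ≤ mΩ) (hYF : ∀ j < N, ∀ i < j, Measurable[F j] (Y i))
    (hY : ∀ j < N, Measurable (Y j)) (hYC : ∀ j < N, ∀ᵐ ω ∂ℙ, Y j ω ≤ C)
    (hmean : ∀ j < N, ℙ[fun ω => Real.exp (Y j ω) | F j] ≤ᵐ[ℙ] fun _ => 1) (x : ℝ) :
    ℙ {ω | x ≤ ∑ j ∈ Finset.range N, Y j ω} ≤ ENNReal.ofReal (Real.exp (-x)) := by
  obtain ⟨h1, h2, h3⟩ := integral_prod_le_one (ℙ := ℙ) (Z := fun j ω => Real.exp (Y j ω))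
    (C := Real.exp C) hF (fun j hj i hi => Real.measurable_exp.comp (hYF j hj i hi))
    (fun j hj => Real.measurable_exp.comp (hY j hj))
    (fun j hj => (hYC j hj).mono fun ω h => ⟨(Real.exp_pos _).le, Real.exp_le_exp.2 h⟩) hmean
  have hset : {ω | x ≤ ∑ j ∈ Finset.range N, Y j ω} =
      {ω | Real.exp x ≤ ∏ j ∈ Finset.range N, Real.exp (Y j ω)} := by
    ext ω
    simp only [Set.mem_ofPred_eq, ← Real.exp_sum, Real.exp_le_exp]
  have hM := mul_meas_ge_le_integral_of_nonneg h2 h1 (Real.exp x)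
  rw [hset, ← ENNReal.ofReal_toReal (measure_ne_top ℙ _)]
  refine ENNReal.ofReal_le_ofReal ?_
  rw [Real.exp_neg, ← one_div, le_div_iff₀ (Real.exp_pos _), mul_comm]
  exact hM.trans h3

/-- Conditional expectation of an affine function of `Y` with predictable coefficients. -/
theorem condExp_affine {m : MeasurableSpace Ω} (hm : m ≤ mΩ) {Y a b : Ω → ℝ} (hY : Integrable Y ℙ)
    (ha : Measurable[m] a) (hb : Measurable[m] b) {C : ℝ} (haC : ∀ ω, |a ω| ≤ C)
    (hbC : ∀ ω, |b ω| ≤ C) :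
    Integrable (fun ω => a ω + b ω * Y ω) ℙ ∧
      ℙ[fun ω => a ω + b ω * Y ω | m] =ᵐ[ℙ] fun ω => a ω + b ω * (ℙ[Y | m]) ω := by
  have hai : Integrable a ℙ := Integrable.of_bound (ha.mono hm le_rfl).aestronglyMeasurable C
    (ae_of_all _ haC)
  have hbY : Integrable (fun ω => b ω * Y ω) ℙ :=
    hY.bdd_mul (hb.mono hm le_rfl).aestronglyMeasurable (ae_of_all _ hbC)
  have h1 := condExp_add hai hbY m
  have h2 := condExp_mul_of_stronglyMeasurable_left (μ := ℙ) hb.stronglyMeasurable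
    (g := Y) hbY hY
  have h3 := condExp_of_stronglyMeasurable hm ha.stronglyMeasurable hai
  refine ⟨hai.add hbY, ?_⟩
  filter_upwards [h1, h2] with ω h1 h2
  calc _ = _ := h1
    _ = a ω + (ℙ[fun ω => b ω * Y ω | m]) ω := by rw [Pi.add_apply, h3]
    _ = _ := by rw [show (fun ω => b ω * Y ω) = b * Y from rfl, h2, Pi.mul_apply]

theorem bernoulli_mgf_le {q : ℝ} (hq : q ∈ Set.Icc (0 : ℝ) 1) (l : ℝ) :
    (1 - q) * Real.exp (l * (0 - q)) + q * Real.exp (l * (1 - q)) ≤ Real.exp (l ^ 2 / 8) := by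
  have h := sum_mul_exp_le (C := Bool) (w := fun b => if b then q else 1 - q)
    (x := fun b => l * ((if b then 1 else 0) - q)) (c := min (l * (0 - q)) (l * (1 - q)))
    (M := |l|) ⟨fun b => by cases b <;> simp [hq.1, hq.2], by simp⟩ (fun b => by
      rcases le_total 0 l with hl | hl
      · have e : min (l * (0 - q)) (l * (1 - q)) = l * (0 - q) := min_eq_left (by nlinarith)
        rw [e, abs_of_nonneg hl]
        cases b <;> constructor <;> simp <;> linarith
      · have e : min (l * (0 - q)) (l * (1 - q)) = l * (1 - q) := min_eq_right (by nlinarith)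
        rw [e, abs_of_nonpos hl]
        cases b <;> constructor <;> simp <;> linarith)
  simp only [Fintype.sum_bool, if_true, Bool.false_eq_true, if_false, sq_abs] at h
  rw [add_comm]
  refine h.trans (le_of_eq ?_)
  congr 1
  ring

theorem exp_mul_sub_le_chord {y : ℝ} (hy : y ∈ Set.Icc (0 : ℝ) 1) (l q : ℝ) :
    Real.exp (l * (y - q)) ≤
      (1 - y) * Real.exp (l * (0 - q)) + y * Real.exp (l * (1 - q)) := by
  have := convexOn_exp.2 (Set.mem_univ (l * (0 - q))) (Set.mem_univ (l * (1 - q)))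
    (sub_nonneg.2 hy.2) hy.1 (by ring)
  simp only [smul_eq_mul] at this
  refine le_trans (le_of_eq ?_) this
  congr 1
  ring

/-- Hoeffding's inequality for a mean estimated along the random rounds in which an event `v`
occurs, at the moment of the `n`-th occurrence. Stopping after `n` occurrences replaces a maximal
inequality by a bound at the fixed final time. -/
theorem measure_visits_le {N : ℕ} {F : ℕ → MeasurableSpace Ω} {v : ℕ → Ω → Prop}
    [∀ j ω, Decidable (v j ω)] {Y : ℕ → Ω → ℝ} {q : ℝ} (hq : q ∈ Set.Icc (0 : ℝ) 1)
    (hF : ∀ j < N, F j ≤ mΩ) (hv : ∀ j < N, ∀ i ≤ j, MeasurableSet[F j] {ω | v i ω})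
    (hYF : ∀ j < N, ∀ i < j, Measurable[F j] (Y i)) (hY : ∀ j < N, Measurable (Y j))
    (h01 : ∀ j < N, ∀ᵐ ω ∂ℙ, Y j ω ∈ Set.Icc (0 : ℝ) 1)
    (hmean : ∀ j < N, ∀ᵐ ω ∂ℙ, v j ω → (ℙ[Y j | F j]) ω = q) (n : ℕ) {x : ℝ} (hx : 0 ≤ x) :
    ℙ {ω | ∃ k ≤ N, ((Finset.range k).filter fun j => v j ω).card = n ∧
        n * x < ∑ j ∈ Finset.range k, if v j ω then Y j ω - q else 0} ≤
      ENNReal.ofReal (Real.exp (-(2 * n * x ^ 2))) := by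
  classical
  -- `l = 4 x` minimizes `n l ^ 2 / 8 - l n x`. The increments vanish after the `n`-th occurrence.
  set l : ℝ := 4 * x with hl
  let u : ℕ → Ω → Prop := fun j ω =>
    v j ω ∧ ((Finset.range j).filter fun i => v i ω).card < n
  set W : ℕ → Ω → ℝ := fun j ω => if u j ω then l * (Y j ω - q) - l ^ 2 / 8 else 0 with hW
  have hcount : ∀ j < N, ∀ i ≤ j,
      Measurable[F j] fun ω => ((Finset.range i).filter fun i => v i ω).card := by
    intro j hj i hi
    simp only [Finset.card_filter]
    refine Finset.measurable_fun_sum _ fun i' hi' => ?_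
    exact Measurable.ite (hv j hj i' (by have := Finset.mem_range.1 hi'; omega))
      measurable_const measurable_const
  have hu : ∀ j < N, ∀ i ≤ j, MeasurableSet[F j] {ω | u i ω} := fun j hj i hi =>
    MeasurableSet.inter (hv j hj i hi) (hcount j hj i hi (measurableSet_Iio (a := n)))
  have hWm : ∀ (m : MeasurableSpace Ω) (j : ℕ), MeasurableSet[m] {ω | u j ω} →
      Measurable[m] (Y j) → Measurable[m] (W j) := fun m j h1 h2 =>
    Measurable.ite h1 (((h2.sub_const q).const_mul l).sub_const _) measurable_const
  have hWl : ∀ j < N, ∀ᵐ ω ∂ℙ, W j ω ≤ l := fun j hj => by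
    filter_upwards [h01 j hj] with ω h
    have hl0 : 0 ≤ l := by positivity
    simp only [hW]
    split_ifs
    · nlinarith [h.2, hq.1, sq_nonneg l]
    · exact hl0
  have key := measure_exp_sum_le (ℙ := ℙ) (N := N) (F := F) (Y := W) (C := l) hF
    (fun j hj i hi => hWm _ i (hu j hj i hi.le) (hYF j hj i hi))
    (fun j hj => hWm _ j (hF j hj _ (hu j hj j le_rfl)) (hY j hj))
    hWl
    (fun j hj => by
      have huj := hu j hj j le_rfl
      have hYi : Integrable (Y j) ℙ := integrable_of_ae_mem_Icc (hY j hj) (h01 j hj)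
      set a : Ω → ℝ := fun ω => if u j ω then Real.exp (-(l ^ 2 / 8)) * Real.exp (l * (0 - q))
        else 1 with ha
      set b : Ω → ℝ := fun ω => if u j ω then Real.exp (-(l ^ 2 / 8)) *
        (Real.exp (l * (1 - q)) - Real.exp (l * (0 - q))) else 0 with hb
      have ham : Measurable[F j] a := Measurable.ite huj measurable_const measurable_const
      have hbm : Measurable[F j] b := Measurable.ite huj measurable_const measurable_const
      obtain ⟨hint, haff⟩ := condExp_affine (hF j hj) hYi ham hbm
        (C := |Real.exp (-(l ^ 2 / 8)) * Real.exp (l * (0 - q))| + 1 +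
          |Real.exp (-(l ^ 2 / 8)) * (Real.exp (l * (1 - q)) - Real.exp (l * (0 - q)))|)
        (fun ω => by
          simp only [ha]
          split_ifs
          · have := abs_nonneg (Real.exp (-(l ^ 2 / 8)) *
              (Real.exp (l * (1 - q)) - Real.exp (l * (0 - q))))
            linarith
          · rw [abs_one]
            have := abs_nonneg (Real.exp (-(l ^ 2 / 8)) * Real.exp (l * (0 - q)))
            have := abs_nonneg (Real.exp (-(l ^ 2 / 8)) *
              (Real.exp (l * (1 - q)) - Real.exp (l * (0 - q))))
            linarith)
        (fun ω => by
          simp only [hb]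
          split_ifs
          · have := abs_nonneg (Real.exp (-(l ^ 2 / 8)) * Real.exp (l * (0 - q)))
            linarith
          · rw [abs_zero]
            positivity)
      have hle : (fun ω => Real.exp (W j ω)) ≤ᵐ[ℙ] fun ω => a ω + b ω * Y j ω := by
        filter_upwards [h01 j hj] with ω h
        simp only [hW, ha, hb]
        split_ifs
        · rw [sub_eq_add_neg, add_comm, Real.exp_add]
          refine (mul_le_mul_of_nonneg_left (exp_mul_sub_le_chord h l q)
            (Real.exp_pos _).le).trans (le_of_eq ?_)
          ring
        · simp
      have hmono := condExp_mono (m := F j) (μ := ℙ) (f := fun ω => Real.exp (W j ω))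
        (integrable_of_ae_mem_Icc (Real.measurable_exp.comp (hWm _ j (hF j hj _ huj) (hY j hj)))
          ((hWl j hj).mono fun ω h => ⟨(Real.exp_pos _).le, Real.exp_le_exp.2 h⟩)) hint hle
      filter_upwards [hmono, haff, hmean j hj] with ω h1 h2 h3
      refine h1.trans ?_
      rw [h2]
      simp only [ha, hb]
      split_ifs with hc
      · rw [h3 hc.1]
        have := mul_le_mul_of_nonneg_left (bernoulli_mgf_le hq l) (Real.exp_pos (-(l ^ 2 / 8))).le
        rw [← Real.exp_add, neg_add_cancel, Real.exp_zero] at this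
        refine le_trans (le_of_eq ?_) this
        ring
      · simp)
    (2 * n * x ^ 2)
  refine (measure_mono ?_).trans key
  rintro ω ⟨k, hk, hcard, hlt⟩
  have hiff : ∀ j, u j ω ↔ v j ω ∧ j < k := by
    intro j
    constructor
    · rintro ⟨h1, h2⟩
      refine ⟨h1, ?_⟩
      by_contra hjk
      rw [← hcard] at h2
      exact absurd (Finset.card_le_card (Finset.filter_subset_filter _
        (Finset.range_mono (not_lt.1 hjk)))) (not_le.2 h2)
    · rintro ⟨h1, h2⟩
      refine ⟨h1, ?_⟩
      rw [← hcard]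
      refine Finset.card_lt_card (Finset.ssubset_iff_subset_ne.2
        ⟨Finset.filter_subset_filter _ (Finset.range_mono h2.le), fun he => ?_⟩)
      have : j ∈ (Finset.range j).filter fun i => v i ω := by
        rw [he]
        exact Finset.mem_filter.2 ⟨Finset.mem_range.2 h2, h1⟩
      exact absurd (Finset.mem_range.1 (Finset.mem_filter.1 this).1) (lt_irrefl j)
  have hsum : ∑ j ∈ Finset.range N, W j ω =
      l * (∑ j ∈ Finset.range k, if v j ω then Y j ω - q else 0) - n * (l ^ 2 / 8) := by
    have h1 : ∑ j ∈ Finset.range N, W j ω =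
        ∑ j ∈ Finset.range k, if v j ω then l * (Y j ω - q) - l ^ 2 / 8 else 0 := by
      rw [← Finset.sum_subset (Finset.range_mono hk)]
      · refine Finset.sum_congr rfl fun j hj => ?_
        simp only [hW, hiff, Finset.mem_range.1 hj, and_true]
      · intro j _ hj
        have : ¬ u j ω := fun h => hj (Finset.mem_range.2 ((hiff j).1 h).2)
        simp only [hW, this, if_false]
    rw [h1, ← Finset.sum_filter, ← Finset.sum_filter, Finset.sum_sub_distrib, Finset.sum_const,
      hcard, ← Finset.mul_sum, nsmul_eq_mul]
  rw [Set.mem_ofPred_eq, hsum]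
  have hn : (0 : ℝ) ≤ n := Nat.cast_nonneg n
  have := mul_le_mul_of_nonneg_left hlt.le (show 0 ≤ l by positivity)
  rw [hl] at this ⊢
  nlinarith

end Supermartingale

section Supermartingale

variable {Ω : Type*} {mΩ : MeasurableSpace Ω} {ℙ : Measure Ω} [IsProbabilityMeasure ℙ]

theorem exp_neg_le_one_sub_half {y : ℝ} (hy : y ∈ Set.Icc (0 : ℝ) 1) :
    Real.exp (-y) ≤ 1 - y / 2 := by
  have h1 := exp_mul_sub_le_chord hy (-1) 0
  have h2 : Real.exp (-1) ≤ 1 / 2 := by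
    rw [Real.exp_neg, ← one_div]
    exact one_div_le_one_div_of_le two_pos (by linarith [Real.add_one_le_exp (1 : ℝ)])
  simp only [sub_zero, mul_zero, Real.exp_zero, mul_one, neg_mul, one_mul] at h1
  nlinarith [hy.1, hy.2]

/-- Multiplicative Chernoff bound: the sum of the conditional means of bounded nonnegative variables
is at most twice their sum, up to an additive term proportional to their range. -/
theorem measure_sum_condExp_ge {N : ℕ} {F : ℕ → MeasurableSpace Ω} {X W : ℕ → Ω → ℝ} {M : ℝ}
    (hM : 0 < M) (hF : ∀ j < N, F j ≤ mΩ) (hXF : ∀ j < N, ∀ i < j, Measurable[F j] (X i))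
    (hX : ∀ j < N, Measurable (X j)) (hXM : ∀ j < N, ∀ ω, X j ω ∈ Set.Icc 0 M)
    (hW : ∀ j < N, ∀ i ≤ j, Measurable[F j] (W i)) (hWM : ∀ j < N, ∀ ω, W j ω ∈ Set.Icc 0 M)
    (hmean : ∀ j < N, ℙ[X j | F j] =ᵐ[ℙ] W j) (x : ℝ) :
    ℙ {ω | 2 * ∑ j ∈ Finset.range N, X j ω + 2 * M * x ≤ ∑ j ∈ Finset.range N, W j ω} ≤
      ENNReal.ofReal (Real.exp (-x)) := by
  -- `exp (-y) ≤ 1 - y / 2` on `[0, 1]` gives `E exp (-X / M) ≤ 1 - W / (2 M) ≤ exp (-W / (2 M))`,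
  -- conditionally on the past.
  have key := measure_exp_sum_le (ℙ := ℙ) (N := N) (F := F)
    (Y := fun j ω => W j ω / (2 * M) - X j ω / M) (C := 1) hF
    (fun j hj i hi => ((hW j hj i hi.le).div_const _).sub ((hXF j hj i hi).div_const _))
    (fun j hj => (((hW j hj j le_rfl).mono (hF j hj) le_rfl).div_const _).sub
      ((hX j hj).div_const _))
    (fun j hj => ae_of_all _ fun ω => by
      have h1 : 0 ≤ X j ω / M := div_nonneg (hXM j hj ω).1 hM.le
      have h2 : W j ω / (2 * M) ≤ 1 := by
        rw [div_le_one (by positivity)]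
        linarith [(hWM j hj ω).2]
      linarith)
    (fun j hj => by
      have hWj := hW j hj j le_rfl
      have hXi : Integrable (X j) ℙ :=
        integrable_of_ae_mem_Icc (hX j hj) (ae_of_all _ (hXM j hj))
      have hE : ∀ ω, Real.exp (W j ω / (2 * M)) ∈ Set.Icc 0 (Real.exp 1) := fun ω => by
        refine ⟨(Real.exp_pos _).le, Real.exp_le_exp.2 ?_⟩
        rw [div_le_one (by positivity)]
        linarith [(hWM j hj ω).2]
      have ham : Measurable[F j] fun ω => Real.exp (W j ω / (2 * M)) :=
        Real.measurable_exp.comp (hWj.div_const _)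
      obtain ⟨hint, haff⟩ := condExp_affine (hF j hj) hXi ham
        (b := fun ω => -(1 / (2 * M)) * Real.exp (W j ω / (2 * M))) (ham.const_mul _)
        (C := Real.exp 1 + 1 / (2 * M) * Real.exp 1)
        (fun ω => by
          rw [abs_of_nonneg (hE ω).1]
          exact (hE ω).2.trans (le_add_of_nonneg_right (by positivity)))
        (fun ω => by
          rw [abs_mul, abs_of_nonneg (hE ω).1, abs_neg, abs_of_pos (by positivity)]
          refine (mul_le_mul_of_nonneg_left (hE ω).2 (by positivity)).trans
            (le_add_of_nonneg_left (Real.exp_pos _).le))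
      have hle : (fun ω => Real.exp (W j ω / (2 * M) - X j ω / M)) ≤ᵐ[ℙ] fun ω =>
          Real.exp (W j ω / (2 * M)) +
            -(1 / (2 * M)) * Real.exp (W j ω / (2 * M)) * X j ω := by
        refine ae_of_all _ fun ω => ?_
        have := exp_neg_le_one_sub_half (y := X j ω / M) ⟨div_nonneg (hXM j hj ω).1 hM.le,
          (div_le_one hM).2 (hXM j hj ω).2⟩
        simp only [sub_eq_add_neg, Real.exp_add]
        refine (mul_le_mul_of_nonneg_left this (Real.exp_pos _).le).trans (le_of_eq ?_)
        field_simp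
        ring
      have hmono := condExp_mono (m := F j) (μ := ℙ)
        (f := fun ω => Real.exp (W j ω / (2 * M) - X j ω / M))
        (integrable_of_ae_mem_Icc (C := Real.exp 1) (Real.measurable_exp.comp
          (((hWj.mono (hF j hj) le_rfl).div_const _).sub ((hX j hj).div_const _)))
          (ae_of_all _ fun ω => ⟨(Real.exp_pos _).le, by
            refine (Real.exp_le_exp.2 ?_).trans (hE ω).2
            linarith [div_nonneg (hXM j hj ω).1 hM.le]⟩)) hint hle
      filter_upwards [hmono, haff, hmean j hj] with ω h1 h2 h3
      refine h1.trans ?_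
      rw [h2, h3]
      have h4 := Real.add_one_le_exp (-(W j ω / (2 * M)))
      have h5 := mul_le_mul_of_nonneg_left h4 (hE ω).1
      rw [← Real.exp_add, add_neg_cancel, Real.exp_zero] at h5
      refine le_trans (le_of_eq ?_) h5
      field_simp
      ring)
    x
  refine (measure_mono fun ω hω => ?_).trans key
  rw [Set.mem_ofPred_eq] at hω ⊢
  rw [Finset.sum_sub_distrib, ← Finset.sum_div, ← Finset.sum_div, div_sub_div _ _ (by positivity)
    hM.ne', le_div_iff₀ (by positivity)]
  nlinarith

/-- Conditional expectation of a predictable function evaluated at a random element of a finite type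
with known conditional law. -/
theorem condExp_select {X : Type*} [Fintype X] {m : MeasurableSpace Ω} (hm : m ≤ mΩ) {ξ : Ω → X}
    (hξ : ∀ x, MeasurableSet[mΩ] {ω | ξ ω = x}) {p : X → Ω → ℝ}
    (hp : ∀ x, ℙ[Set.indicator {ω | ξ ω = x} (fun _ => (1 : ℝ)) | m] =ᵐ[ℙ] p x)
    {f : X → Ω → ℝ} (hf : ∀ x, Measurable[m] (f x)) {C : ℝ} (hC : ∀ x ω, |f x ω| ≤ C) :
    ℙ[fun ω => f (ξ ω) ω | m] =ᵐ[ℙ] fun ω => ∑ x, p x ω * f x ω := by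
  classical
  have hind : ∀ x, Integrable (Set.indicator {ω | ξ ω = x} fun _ => (1 : ℝ)) ℙ := fun x =>
    (integrable_const 1).indicator (hξ x)
  have hprod : ∀ x, Integrable (f x * Set.indicator {ω | ξ ω = x} fun _ => (1 : ℝ)) ℙ := fun x =>
    (hind x).bdd_mul ((hf x).mono hm le_rfl).aestronglyMeasurable (ae_of_all _ (hC x))
  have hdecomp : (fun ω => f (ξ ω) ω) =
      ∑ x, f x * Set.indicator {ω | ξ ω = x} fun _ => (1 : ℝ) := by
    funext ω
    rw [Finset.sum_apply, Finset.sum_eq_single (ξ ω)]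
    · simp
    · intro x _ hx
      simp [hx.symm]
    · simp
  have h1 := condExp_finsetSum (μ := ℙ) (s := Finset.univ)
    (f := fun x => f x * Set.indicator {ω | ξ ω = x} fun _ => (1 : ℝ)) (fun x _ => hprod x) m
  have h2 : ∀ᵐ ω ∂ℙ, ∀ x, (ℙ[f x * Set.indicator {ω | ξ ω = x} (fun _ => (1 : ℝ)) | m]) ω =
      p x ω * f x ω := by
    rw [ae_all_iff]
    intro x
    filter_upwards [condExp_mul_of_stronglyMeasurable_left (μ := ℙ) (hf x).stronglyMeasurable
      (hprod x) (hind x), hp x] with ω e1 e2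
    rw [e1, Pi.mul_apply, e2, mul_comm]
  rw [hdecomp]
  filter_upwards [h1, h2] with ω e1 e2
  rw [e1, Finset.sum_apply]
  exact Finset.sum_congr rfl fun x _ => e2 x

end Supermartingale

/-! ### Measurability of the estimates and the policies -/

section Measurability

variable {S₁ S₂ A B Ω : Type*}

/-- The σ-algebra `m` contains everything observed in the episodes `1, …, n`. -/
structure Observed (m : MeasurableSpace Ω) (H : ℕ) (D : Ω → Record S₁ S₂ A B) (n : ℕ) : Prop where
  state : ∀ j ∈ Finset.Icc 1 n, ∀ i ≤ H, sigmaState D j i ≤ m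
  act : ∀ j ∈ Finset.Icc 1 n, ∀ i < H, sigmaAct D j i ≤ m
  rew : ∀ j ∈ Finset.Icc 1 n, ∀ i < H, sigmaRew D j i ≤ m

theorem Observed.mono {m : MeasurableSpace Ω} {H : ℕ} {D : Ω → Record S₁ S₂ A B} {n n' : ℕ}
    (h : Observed m H D n) (hn : n' ≤ n) : Observed m H D n' :=
  have hsub := Finset.Icc_subset_Icc_right (a := 1) hn
  ⟨fun j hj => h.state j (hsub hj), fun j hj => h.act j (hsub hj), fun j hj => h.rew j (hsub hj)⟩

theorem measurableSet_of_sigmaState {m : MeasurableSpace Ω} {D : Ω → Record S₁ S₂ A B} {j i : ℕ}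
    (h : sigmaState D j i ≤ m) (p : S₁ → S₂ → Prop) :
    MeasurableSet[m] {ω | p ((D ω).s₁ j i) ((D ω).s₂ j i)} :=
  h _ ⟨{x | p x.1 x.2}, trivial, rfl⟩

theorem measurableSet_of_sigmaAct {m : MeasurableSpace Ω} {D : Ω → Record S₁ S₂ A B} {j i : ℕ}
    (h : sigmaAct D j i ≤ m) (p : A → B → Prop) :
    MeasurableSet[m] {ω | p ((D ω).a j i) ((D ω).b j i)} :=
  h _ ⟨{x | p x.1 x.2}, trivial, rfl⟩

theorem measurable_of_sigmaRew {m : MeasurableSpace Ω} {D : Ω → Record S₁ S₂ A B} {j i : ℕ}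
    (h : sigmaRew D j i ≤ m) : Measurable[m] fun ω => (D ω).rew j i :=
  measurable_iff_comap_le.2 h

theorem measurable_select {X : Type*} [Finite X] {m : MeasurableSpace Ω} {ξ : Ω → X}
    (hξ : ∀ x, MeasurableSet[m] {ω | ξ ω = x}) {f : X → Ω → ℝ} (hf : ∀ x, Measurable[m] (f x)) :
    Measurable[m] fun ω => f (ξ ω) ω := by
  classical
  have := Fintype.ofFinite X
  have hdecomp : (fun ω => f (ξ ω) ω) = fun ω => ∑ x, if ξ ω = x then f x ω else 0 := by
    funext ω
    simp
  rw [hdecomp]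
  exact Finset.measurable_fun_sum _ fun x _ => Measurable.ite (hξ x) (hf x) measurable_const

theorem measurable_pairAvg {m : MeasurableSpace Ω} {X Y : Type*} [Fintype X] [Fintype Y]
    {p : Ω → X → ℝ} {q : Ω → Y → ℝ}
    {f : Ω → X → Y → ℝ} (hp : ∀ x, Measurable[m] fun ω => p ω x)
    (hq : ∀ y, Measurable[m] fun ω => q ω y) (hf : ∀ x y, Measurable[m] fun ω => f ω x y) :
    Measurable[m] fun ω => pairAvg (p ω) (q ω) (f ω) :=
  Finset.measurable_fun_sum _ fun x _ => Finset.measurable_fun_sum _ fun y _ =>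
    ((hp x).mul (hf x y)).mul (hq y)

theorem measurable_evalReward [Fintype S₁] [Fintype S₂] [Fintype A] [Fintype B]
    {m : MeasurableSpace Ω} {H : ℕ} {π : Ω → Policy S₁ A} {ρ : Ω → Policy S₂ B}
    {β : Ω → ℕ → S₁ → S₂ → A → B → ℝ} (P₁ : ℕ → S₁ → A → S₁ → ℝ) (P₂ : ℕ → S₂ → B → S₂ → ℝ)
    (hπ : ∀ h < H, ∀ s a, Measurable[m] fun ω => π ω h s a)
    (hρ : ∀ h < H, ∀ t b, Measurable[m] fun ω => ρ ω h t b)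
    (hβ : ∀ h < H, ∀ s t a b, Measurable[m] fun ω => β ω h s t a b) : ∀ n ≤ H, ∀ s t,
      Measurable[m] fun ω => evalReward H P₁ P₂ (π ω) (ρ ω) (β ω) n s t := by
  intro n
  induction n with
  | zero => intro _ s t; exact measurable_const
  | succ n ih =>
    intro hn s t
    exact measurable_pairAvg (hπ _ (by omega) s) (hρ _ (by omega) t) fun a b =>
      (hβ _ (by omega) s t a b).add (measurable_pairAvg (fun _ => measurable_const)
        (fun _ => measurable_const) (ih (by omega)))

theorem measurable_card_filter {m : MeasurableSpace Ω} (J : Finset ℕ) {v : Ω → ℕ → Prop}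
    [∀ ω, DecidablePred (v ω)] (hv : ∀ j ∈ J, MeasurableSet[m] {ω | v ω j}) :
    Measurable[m] fun ω => ((J.filter (v ω)).card : ℝ) := by
  simp only [Finset.card_filter, Nat.cast_sum]
  refine Finset.measurable_fun_sum _ fun j hj => ?_
  simp only [Nat.cast_ite]
  exact Measurable.ite (hv j hj) measurable_const measurable_const

variable [DecidableEq S₁] [DecidableEq S₂] [DecidableEq A] [DecidableEq B]
  {m : MeasurableSpace Ω} {H k h : ℕ} {D : Ω → Record S₁ S₂ A B}

theorem Observed.measurableSet_visit (hO : Observed m H D k) (hh : h < H) {j : ℕ}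
    (hj : j ∈ Finset.Icc 1 k) (s : S₁) (t : S₂) (a : A) (b : B) :
    MeasurableSet[m] {ω | (D ω).s₁ j h = s ∧ (D ω).s₂ j h = t ∧ (D ω).a j h = a ∧
      (D ω).b j h = b} := by
  have h1 := measurableSet_of_sigmaState (hO.state j hj h hh.le) fun x y => x = s ∧ y = t
  have h2 := measurableSet_of_sigmaAct (hO.act j hj h hh) fun x y => x = a ∧ y = b
  convert h1.inter h2 using 1
  ext ω
  simp [and_assoc]

theorem Observed.measurableSet_visit₁ (hO : Observed m H D k) (hh : h < H) {j : ℕ}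
    (hj : j ∈ Finset.Icc 1 k) (s : S₁) (a : A) :
    MeasurableSet[m] {ω | (D ω).s₁ j h = s ∧ (D ω).a j h = a} :=
  (measurableSet_of_sigmaState (hO.state j hj h hh.le) fun x _ => x = s).inter
    (measurableSet_of_sigmaAct (hO.act j hj h hh) fun x _ => x = a)

theorem Observed.measurableSet_visit₂ (hO : Observed m H D k) (hh : h < H) {j : ℕ}
    (hj : j ∈ Finset.Icc 1 k) (t : S₂) (b : B) :
    MeasurableSet[m] {ω | (D ω).s₂ j h = t ∧ (D ω).b j h = b} :=
  (measurableSet_of_sigmaState (hO.state j hj h hh.le) fun _ y => y = t).inter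
    (measurableSet_of_sigmaAct (hO.act j hj h hh) fun _ y => y = b)

theorem Observed.measurable_count (hO : Observed m H D k) (hh : h < H) (s : S₁) (t : S₂) (a : A)
    (b : B) : Measurable[m] fun ω => ((D ω).count k h s t a b : ℝ) :=
  measurable_card_filter _ fun _ hj => hO.measurableSet_visit hh hj s t a b

theorem Observed.measurable_count₁ (hO : Observed m H D k) (hh : h < H) (s : S₁) (a : A) :
    Measurable[m] fun ω => ((D ω).count₁ k h s a : ℝ) :=
  measurable_card_filter _ fun _ hj => hO.measurableSet_visit₁ hh hj s a

theorem Observed.measurable_count₂ (hO : Observed m H D k) (hh : h < H) (t : S₂) (b : B) :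
    Measurable[m] fun ω => ((D ω).count₂ k h t b : ℝ) :=
  measurable_card_filter _ fun _ hj => hO.measurableSet_visit₂ hh hj t b

theorem Observed.measurable_rHat (hO : Observed m H D k) (hh : h < H) (s : S₁) (t : S₂) (a : A)
    (b : B) : Measurable[m] fun ω => (D ω).rHat k h s t a b :=
  (Finset.measurable_fun_sum _ fun j hj => Measurable.ite (hO.measurableSet_visit hh hj s t a b)
    (measurable_of_sigmaRew (hO.rew j hj h hh)) measurable_const).div
    ((hO.measurable_count hh s t a b).max measurable_const)

variable [Fintype S₁] [Fintype S₂] [Fintype A] [Fintype B]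

theorem Observed.measurable_PHat₁ (hO : Observed m H D k) (hh : h < H) (s : S₁) (a : A) (s' : S₁) :
    Measurable[m] fun ω => (D ω).PHat₁ k h s a s' := by
  by_cases hk : k = 0
  · simp only [Record.PHat₁, hk, if_true]
    exact measurable_const
  · simp only [Record.PHat₁, hk, if_false]
    refine (measurable_card_filter _ fun j hj => ?_).div
      ((hO.measurable_count₁ hh s a).max measurable_const)
    have h1 := hO.measurableSet_visit₁ hh hj s a
    have h2 := measurableSet_of_sigmaState (hO.state j hj (h + 1) hh) fun x _ => x = s'
    convert h1.inter h2 using 1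
    ext ω
    simp [and_assoc]

theorem Observed.measurable_PHat₂ (hO : Observed m H D k) (hh : h < H) (t : S₂) (b : B) (t' : S₂) :
    Measurable[m] fun ω => (D ω).PHat₂ k h t b t' := by
  by_cases hk : k = 0
  · simp only [Record.PHat₂, hk, if_true]
    exact measurable_const
  · simp only [Record.PHat₂, hk, if_false]
    refine (measurable_card_filter _ fun j hj => ?_).div
      ((hO.measurable_count₂ hh t b).max measurable_const)
    have h1 := hO.measurableSet_visit₂ hh hj t b
    have h2 := measurableSet_of_sigmaState (hO.state j hj (h + 1) hh) fun _ y => y = t'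
    convert h1.inter h2 using 1
    ext ω
    simp [and_assoc]

variable {K : ℕ} {δ : ℝ}

theorem Observed.measurable_bonusR (hO : Observed m H D k) (hh : h < H) (s : S₁) (t : S₂) (a : A)
    (b : B) : Measurable[m] fun ω => (D ω).bonusR H K δ k h s t a b :=
  ((hO.measurable_count hh s t a b).max measurable_const).const_div _ |>.sqrt

theorem Observed.measurable_bonusP₁ (hO : Observed m H D k) (hh : h < H) (s : S₁) (a : A) :
    Measurable[m] fun ω => (D ω).bonusP₁ H K δ k h s a :=
  ((hO.measurable_count₁ hh s a).max measurable_const).const_div _ |>.sqrt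

theorem Observed.measurable_bonusP₂ (hO : Observed m H D k) (hh : h < H) (t : S₂) (b : B) :
    Measurable[m] fun ω => (D ω).bonusP₂ H K δ k h t b :=
  ((hO.measurable_count₂ hh t b).max measurable_const).const_div _ |>.sqrt

theorem Observed.measurable_bonus (hO : Observed m H D k) (hh : h < H) (s : S₁) (t : S₂) (a : A)
    (b : B) : Measurable[m] fun ω => (D ω).bonus H K δ k h s t a b := by
  by_cases hk : k = 0
  · simp only [Record.bonus, hk, if_true]
    exact measurable_const
  · simp only [Record.bonus_eq _ H K δ hk]
    exact (hO.measurable_bonusR hh s t a b).add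
      ((hO.measurable_bonusP₁ hh s a).add (hO.measurable_bonusP₂ hh t b))

variable {π : Ω → Policy S₁ A} {ρ : Ω → Policy S₂ B} {β : Ω → ℕ → S₁ → S₂ → A → B → ℝ}

theorem Observed.measurable_backup (hO : Observed m H D k)
    (hβ : ∀ h < H, ∀ s t a b, Measurable[m] fun ω => β ω h s t a b) {V : Ω → S₁ → S₂ → ℝ}
    (hV : ∀ s t, Measurable[m] fun ω => V ω s t) (hh : h < H) (s : S₁) (t : S₂) (a : A) (b : B) :
    Measurable[m] fun ω => (D ω).backup H k (β ω) (V ω) h s t a b := by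
  simp only [Record.backup_eq]
  exact ((((hO.measurable_rHat hh s t a b).add (measurable_pairAvg (hO.measurable_PHat₁ hh s a)
    (hO.measurable_PHat₂ hh t b) hV)).add (hβ h hh s t a b)).min measurable_const).max
    measurable_const

theorem Observed.measurable_vEst (hO : Observed m H D k)
    (hβ : ∀ h < H, ∀ s t a b, Measurable[m] fun ω => β ω h s t a b)
    (hπ : ∀ h < H, ∀ s a, Measurable[m] fun ω => π ω h s a)
    (hρ : ∀ h < H, ∀ t b, Measurable[m] fun ω => ρ ω h t b) : ∀ n ≤ H, ∀ s t,
      Measurable[m] fun ω => (D ω).vEst H k (β ω) (π ω) (ρ ω) n s t := by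
  intro n
  induction n with
  | zero => intro _ s t; exact measurable_const
  | succ n ih =>
    intro hn s t
    exact measurable_pairAvg (hπ _ (by omega) s) (hρ _ (by omega) t) fun a b =>
      hO.measurable_backup hβ (ih (by omega)) (by omega) s t a b

theorem measurable_reach {S C : Type*} [Fintype S] [Fintype C] [DecidableEq S] {x : S}
    {π : Ω → Policy S C} {P : Ω → ℕ → S → C → S → ℝ}
    (hπ : ∀ h < H, ∀ s c, Measurable[m] fun ω => π ω h s c)
    (hP : ∀ h < H, ∀ s c s', Measurable[m] fun ω => P ω h s c s') : ∀ h ≤ H, ∀ s,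
      Measurable[m] fun ω => reach x (π ω) (P ω) h s := by
  intro h
  induction h with
  | zero => intro _ s; exact measurable_const
  | succ h ih =>
    intro hh s
    exact Finset.measurable_fun_sum _ fun s' _ => Finset.measurable_fun_sum _ fun c _ =>
      ((ih (by omega) s').mul (hπ h hh s' c)).mul (hP h hh s' c s)

theorem Observed.measurable_grad₁ (hO : Observed m H D k) (x₂ : S₂)
    (hπ : ∀ h < H, ∀ s a, Measurable[m] fun ω => π ω h s a)
    (hρ : ∀ h < H, ∀ t b, Measurable[m] fun ω => ρ ω h t b) (hh : h < H) (s : S₁) (a : A) :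
    Measurable[m] fun ω => (D ω).grad₁ H K δ x₂ k (π ω) (ρ ω) h s a :=
  have hβ : ∀ h < H, ∀ s t a b, Measurable[m] fun ω => (D ω).bonus H K δ k h s t a b :=
    fun _ hh => hO.measurable_bonus hh
  Finset.measurable_fun_sum _ fun t _ => (Finset.measurable_fun_sum _ fun b _ =>
    (hO.measurable_backup hβ (hO.measurable_vEst hβ hπ hρ _ (Nat.sub_le _ _)) hh s t a b).mul
      (hρ h hh t b)).mul (measurable_reach hρ (fun _ hh => hO.measurable_PHat₂ hh) h hh.le t)

theorem Observed.measurable_grad₂ (hO : Observed m H D k) (x₁ : S₁)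
    (hπ : ∀ h < H, ∀ s a, Measurable[m] fun ω => π ω h s a)
    (hρ : ∀ h < H, ∀ t b, Measurable[m] fun ω => ρ ω h t b) (hh : h < H) (t : S₂) (b : B) :
    Measurable[m] fun ω => (D ω).grad₂ H K δ x₁ k (π ω) (ρ ω) h t b :=
  have hβ : ∀ h < H, ∀ s t a b, Measurable[m] fun ω => -(D ω).bonus H K δ k h s t a b :=
    fun _ hh s t a b => (hO.measurable_bonus hh s t a b).neg
  Finset.measurable_fun_sum _ fun s _ => (Finset.measurable_fun_sum _ fun a _ =>
    (hO.measurable_backup hβ (hO.measurable_vEst hβ hπ hρ _ (Nat.sub_le _ _)) hh s t a b).mul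
      (hπ h hh s a)).mul (measurable_reach hπ (fun _ hh => hO.measurable_PHat₁ hh) h hh.le s)

theorem measurable_expWeights {C : Type*} [Fintype C] (η : ℝ) {w g : Ω → C → ℝ}
    (hw : ∀ c, Measurable[m] fun ω => w ω c) (hg : ∀ c, Measurable[m] fun ω => g ω c) (c : C) :
    Measurable[m] fun ω => expWeights η (w ω) (g ω) c :=
  ((hw c).mul ((hg c).const_mul η).exp).div (Finset.measurable_fun_sum _ fun c' _ =>
    (hw c').mul ((hg c').const_mul η).exp)

/-- The policies of episode `k` are functions of the observations of the earlier episodes. -/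
theorem measurable_policies [Nonempty A] [Nonempty B] {η γ : ℝ} {x₁ : S₁} {x₂ : S₂}
    {μ : Ω → ℕ → Policy S₁ A} {ν : Ω → ℕ → Policy S₂ B}
    (hA : ∀ ω, IsAlgorithm₁ H K δ η x₂ (D ω) (μ ω) (ν ω))
    (hB : ∀ ω, IsAlgorithm₂ H K δ γ x₁ (D ω) (μ ω) (ν ω))
    (hη : 0 < η ∨ Subsingleton A) (hγ : 0 < γ ∨ Subsingleton B) :
    ∀ k ≤ K, Observed m H D (k - 1) →
      (∀ h < H, ∀ s a, Measurable[m] fun ω => μ ω k h s a) ∧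
        ∀ h < H, ∀ t b, Measurable[m] fun ω => ν ω k h t b := by
  intro k
  induction k with
  | zero =>
    intro _ _
    refine ⟨fun h hh s a => ?_, fun h hh t b => ?_⟩
    · simp only [(hA _).init h hh]
      exact measurable_const
    · simp only [(hB _).init h hh]
      exact measurable_const
  | succ k ih =>
    intro hk hO
    rw [Nat.add_sub_cancel] at hO
    obtain ⟨ih₁, ih₂⟩ := ih (by omega) (hO.mono (Nat.sub_le _ _))
    refine ⟨fun h hh s a => ?_, fun h hh t b => ?_⟩
    · simp only [(hA _).step_eq hη k hk h hh s]
      exact measurable_expWeights η (ih₁ h hh s) (hO.measurable_grad₁ x₂ ih₁ ih₂ hh s) a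
    · simp only [(hB _).step_eq hγ k hk h hh t]
      exact measurable_expWeights γ (ih₂ h hh t)
        (fun b => (hO.measurable_grad₂ x₁ ih₁ ih₂ hh t b).neg) b

end Measurability

/-! ### Histories and on-policy expectations -/

section Histories

variable {S₁ S₂ A B Ω : Type*} {H : ℕ} {D : Ω → Record S₁ S₂ A B}

theorem sigmaState_le_history {k h j i : ℕ} (hj : 1 ≤ j) (hi : i ≤ H)
    (hji : j < k ∨ j = k ∧ i ≤ h) : sigmaState D j i ≤ history H D k h :=
  le_sup_of_le_left (le_iSup_of_le j (le_iSup_of_le i (le_iSup_of_le ⟨hj, hi, hji⟩ le_rfl)))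

theorem sigmaAct_sup_sigmaRew_le_history {k h j i : ℕ} (hj : 1 ≤ j) (hi : i < H)
    (hji : j < k ∨ j = k ∧ i < h) : sigmaAct D j i ⊔ sigmaRew D j i ≤ history H D k h :=
  le_sup_of_le_right (le_iSup_of_le j (le_iSup_of_le i (le_iSup_of_le ⟨hj, hi, hji⟩ le_rfl)))

theorem history_le_iff {k h : ℕ} {m : MeasurableSpace Ω} : history H D k h ≤ m ↔
    (∀ j i, 1 ≤ j → i ≤ H → (j < k ∨ j = k ∧ i ≤ h) → sigmaState D j i ≤ m) ∧
      ∀ j i, 1 ≤ j → i < H → (j < k ∨ j = k ∧ i < h) →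
        sigmaAct D j i ≤ m ∧ sigmaRew D j i ≤ m := by
  simp only [history, sup_le_iff, iSup_le_iff, and_imp]

theorem history_mono {k h h' : ℕ} (hh : h ≤ h') : history H D k h ≤ history H D k h' :=
  history_le_iff.2 ⟨fun j i h1 h2 h3 => sigmaState_le_history h1 h2 (by omega),
    fun j i h1 h2 h3 => sup_le_iff.1 (sigmaAct_sup_sigmaRew_le_history h1 h2 (by omega))⟩

theorem historyAct_le_history_succ {k h : ℕ} (hk : 1 ≤ k) (hh : h < H) :
    historyAct H D k h ≤ history H D k (h + 1) :=
  sup_le (history_mono (Nat.le_succ h))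
    (sup_le_iff.1 (sigmaAct_sup_sigmaRew_le_history hk hh (Or.inr ⟨rfl, Nat.lt_succ_self h⟩))).1

theorem observed_of_history_le {m : MeasurableSpace Ω} {k h : ℕ} (hm : history H D (k + 1) h ≤ m) :
    Observed m H D k := by
  have hlt : ∀ j ∈ Finset.Icc 1 k, 1 ≤ j ∧ j < k + 1 := fun j hj => by
    have := Finset.mem_Icc.1 hj
    omega
  exact ⟨fun j hj i hi => (sigmaState_le_history (hlt j hj).1 hi (Or.inl (hlt j hj).2)).trans hm,
    fun j hj i hi => (sup_le_iff.1 (sigmaAct_sup_sigmaRew_le_history (hlt j hj).1 hi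
      (Or.inl (hlt j hj).2))).1.trans hm,
    fun j hj i hi => (sup_le_iff.1 (sigmaAct_sup_sigmaRew_le_history (hlt j hj).1 hi
      (Or.inl (hlt j hj).2))).2.trans hm⟩

variable [Fintype S₁] [Fintype S₂] {mΩ : MeasurableSpace Ω} {ℙ : Measure Ω}
  {G : Game S₁ S₂ A B H} {K : ℕ} {μ : Ω → ℕ → Policy S₁ A} {ν : Ω → ℕ → Policy S₂ B}

theorem IsPlay.history_le (hp : IsPlay ℙ G K D μ ν) {k : ℕ} (hk : k ∈ Finset.Icc 1 K) (h : ℕ) :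
    history H D k h ≤ mΩ := by
  have hk' := Finset.mem_Icc.1 hk
  exact history_le_iff.2
    ⟨fun j i h1 h2 h3 => hp.measurable_state j (Finset.mem_Icc.2 (by omega)) i h2,
    fun j i h1 h2 h3 => ⟨hp.measurable_act j (Finset.mem_Icc.2 (by omega)) i h2,
      hp.measurable_rew j (Finset.mem_Icc.2 (by omega)) i h2⟩⟩

theorem IsPlay.historyAct_le (hp : IsPlay ℙ G K D μ ν) {k : ℕ} (hk : k ∈ Finset.Icc 1 K) {h : ℕ}
    (hh : h < H) : historyAct H D k h ≤ mΩ :=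
  sup_le (hp.history_le hk h) (hp.measurable_act k hk h hh)

variable [Fintype A] [Fintype B]

theorem measurable_at_visit {k h : ℕ} (hk : 1 ≤ k) (hh : h < H) {f : Ω → S₁ → S₂ → A → B → ℝ}
    (hf : ∀ s t a b, Measurable[historyAct H D k h] fun ω => f ω s t a b) :
    Measurable[historyAct H D k h] fun ω =>
      f ω ((D ω).s₁ k h) ((D ω).s₂ k h) ((D ω).a k h) ((D ω).b k h) := by
  refine measurable_select (X := S₁ × S₂ × A × B) (f := fun x ω => f ω x.1 x.2.1 x.2.2.1 x.2.2.2)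
    (ξ := fun ω => ((D ω).s₁ k h, (D ω).s₂ k h, (D ω).a k h, (D ω).b k h)) ?_
    fun x => hf x.1 x.2.1 x.2.2.1 x.2.2.2
  intro x
  have h1 := measurableSet_of_sigmaState (m := historyAct H D k h) (D := D) (j := k) (i := h)
    (le_sup_of_le_left (sigmaState_le_history hk hh.le (Or.inr ⟨rfl, le_rfl⟩)))
    fun s t => s = x.1 ∧ t = x.2.1
  have h2 := measurableSet_of_sigmaAct (m := historyAct H D k h) (D := D) (j := k) (i := h)
    le_sup_right fun a b => a = x.2.2.1 ∧ b = x.2.2.2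
  convert h1.inter h2 using 1
  ext ω
  simp [Prod.ext_iff, and_assoc]

theorem measurable_at_state {k h : ℕ} (hk : 1 ≤ k) (hh : h ≤ H) {f : Ω → S₁ → S₂ → ℝ}
    (hf : ∀ s t, Measurable[history H D k h] fun ω => f ω s t) :
    Measurable[history H D k h] fun ω => f ω ((D ω).s₁ k h) ((D ω).s₂ k h) := by
  refine measurable_select (X := S₁ × S₂) (f := fun x ω => f ω x.1 x.2)
    (ξ := fun ω => ((D ω).s₁ k h, (D ω).s₂ k h)) ?_ fun x => hf x.1 x.2
  intro x
  have h1 := measurableSet_of_sigmaState (m := history H D k h) (D := D) (j := k) (i := h)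
    (sigmaState_le_history hk hh (Or.inr ⟨rfl, le_rfl⟩)) fun s t => s = x.1 ∧ t = x.2
  convert h1 using 1
  ext ω
  simp [Prod.ext_iff]

variable [IsProbabilityMeasure ℙ] {k : ℕ} {g : Ω → ℕ → S₁ → S₂ → A → B → ℝ} {M : ℝ}

/-- Realized total of `g` over the last `n` steps of episode `k`. -/
def realized (H : ℕ) (D : Ω → Record S₁ S₂ A B) (k : ℕ) (g : Ω → ℕ → S₁ → S₂ → A → B → ℝ) (n : ℕ)
    (ω : Ω) : ℝ :=
  ∑ i ∈ Finset.range n, g ω (H - (i + 1)) ((D ω).s₁ k (H - (i + 1))) ((D ω).s₂ k (H - (i + 1)))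
    ((D ω).a k (H - (i + 1))) ((D ω).b k (H - (i + 1)))

theorem realized_mem (hgM : ∀ ω, ∀ h < H, ∀ s t a b, g ω h s t a b ∈ Set.Icc 0 M) {n : ℕ}
    (hn : n ≤ H) (ω : Ω) : realized H D k g n ω ∈ Set.Icc 0 (n * M) := by
  have hlt : ∀ i ∈ Finset.range n, H - (i + 1) < H := fun i hi => by
    have := Finset.mem_range.1 hi
    omega
  refine ⟨Finset.sum_nonneg fun i hi => (hgM ω _ (hlt i hi) _ _ _ _).1, ?_⟩
  refine (Finset.sum_le_sum fun i hi => (hgM ω _ (hlt i hi) _ _ _ _).2).trans (le_of_eq ?_)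
  simp

theorem measurable_realized {m : MeasurableSpace Ω} (hk : 1 ≤ k)
    (hm : ∀ h < H, historyAct H D k h ≤ m)
    (hg : ∀ h < H, ∀ s t a b, Measurable[history H D k 0] fun ω => g ω h s t a b) {n : ℕ}
    (hn : n ≤ H) : Measurable[m] (realized H D k g n) := by
  refine Finset.measurable_fun_sum _ fun i hi => ?_
  have hi := Finset.mem_range.1 hi
  exact (measurable_at_visit hk (by omega) fun s t a b => (hg _ (by omega) s t a b).mono
    ((history_mono (Nat.zero_le _)).trans le_sup_left) le_rfl).mono (hm _ (by omega)) le_rfl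

/-- Conditionally on the history, the remaining total of `g` in an episode has mean equal to the
value of `g` under the policies of that episode. -/
theorem IsPlay.condExp_realized (hp : IsPlay ℙ G K D μ ν) (hk : k ∈ Finset.Icc 1 K)
    (hμ : ∀ ω, IsPolicy H (μ ω k)) (hν : ∀ ω, IsPolicy H (ν ω k))
    (hμm : ∀ h < H, ∀ s a, Measurable[history H D k 0] fun ω => μ ω k h s a)
    (hνm : ∀ h < H, ∀ t b, Measurable[history H D k 0] fun ω => ν ω k h t b)
    (hg : ∀ h < H, ∀ s t a b, Measurable[history H D k 0] fun ω => g ω h s t a b) (hM : 0 ≤ M)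
    (hgM : ∀ ω, ∀ h < H, ∀ s t a b, g ω h s t a b ∈ Set.Icc 0 M) :
    ∀ n ≤ H, ℙ[realized H D k g n | history H D k (H - n)] =ᵐ[ℙ] fun ω =>
      evalReward H G.P₁ G.P₂ (μ ω k) (ν ω k) (g ω) n
        ((D ω).s₁ k (H - n)) ((D ω).s₂ k (H - n)) := by
  have hk1 : 1 ≤ k := (Finset.mem_Icc.1 hk).1
  have hRm : ∀ n ≤ H, Measurable (realized H D k g n) := fun n hn =>
    measurable_realized hk1 (fun h hh => hp.historyAct_le hk hh) hg hn
  have hRi : ∀ n ≤ H, Integrable (realized H D k g n) ℙ := fun n hn =>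
    integrable_of_ae_mem_Icc (hRm n hn) (ae_of_all _ (realized_mem hgM hn))
  intro n
  induction n with
  | zero =>
    intro _
    have : realized H D k g 0 = fun _ => 0 := by
      funext ω
      simp [realized]
    rw [this, condExp_const (hp.history_le hk _)]
    exact Filter.EventuallyEq.rfl
  | succ n ih =>
    intro hn
    have ih := ih (by omega)
    have hlt : H - (n + 1) < H := by omega
    have hsucc : H - n = H - (n + 1) + 1 := by omega
    rw [hsucc] at ih
    set h := H - (n + 1) with hh
    have hle1 : history H D k h ≤ historyAct H D k h := le_sup_left
    have hle2 : historyAct H D k h ≤ history H D k (h + 1) := historyAct_le_history_succ hk1 hlt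
    have hA := hp.historyAct_le hk hlt
    have h0 : history H D k 0 ≤ history H D k h := history_mono (Nat.zero_le _)
    set V : Ω → S₁ → S₂ → ℝ := fun ω =>
      evalReward H G.P₁ G.P₂ (μ ω k) (ν ω k) (g ω) n with hV
    have hVm : ∀ s t, Measurable[history H D k 0] fun ω => V ω s t :=
      measurable_evalReward G.P₁ G.P₂ hμm hνm hg n (by omega)
    have hV0 : ∀ ω s t, 0 ≤ V ω s t := fun ω =>
      evalReward_nonneg (hμ ω) (hν ω) G.isSubKernel₁ G.isSubKernel₂
        (fun h hh s t a b => (hgM ω h hh s t a b).1) n (by omega)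
    have hVM : ∀ ω s t, V ω s t ≤ n * M := fun ω =>
      evalReward_le (hμ ω) (hν ω) G.isSubKernel₁ G.isSubKernel₂ hM
        (fun h hh s t a b => (hgM ω h hh s t a b).2) n (by omega)
    have hVabs : ∀ ω s t, |V ω s t| ≤ n * M := fun ω s t => by
      rw [abs_of_nonneg (hV0 ω s t)]
      exact hVM ω s t
    -- The next state: average over the true transitions.
    have hnext : ℙ[fun ω => V ω ((D ω).s₁ k (h + 1)) ((D ω).s₂ k (h + 1)) | historyAct H D k h]
        =ᵐ[ℙ] fun ω => pairAvg (G.P₁ h ((D ω).s₁ k h) ((D ω).a k h))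
          (G.P₂ h ((D ω).s₂ k h) ((D ω).b k h)) (V ω) := by
      have := condExp_select (ℙ := ℙ) (X := S₁ × S₂) hA
        (ξ := fun ω => ((D ω).s₁ k (h + 1), (D ω).s₂ k (h + 1)))
        (p := fun x ω => G.P₁ h ((D ω).s₁ k h) ((D ω).a k h) x.1 *
          G.P₂ h ((D ω).s₂ k h) ((D ω).b k h) x.2)
        (fun x => by
          have := measurableSet_of_sigmaState (hp.measurable_state k hk (h + 1) hlt)
            fun s t => (s, t) = x
          exact this)
        (fun x => by
          have := hp.next k hk h hlt x.1 x.2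
          simpa only [Prod.ext_iff] using this)
        (f := fun x ω => V ω x.1 x.2) (fun x => (hVm x.1 x.2).mono (h0.trans hle1) le_rfl)
        (fun x ω => hVabs ω x.1 x.2)
      refine this.trans (ae_of_all _ fun ω => ?_)
      simp only [pairAvg, Fintype.sum_prod_type]
      exact Finset.sum_congr rfl fun s _ => Finset.sum_congr rfl fun t _ => by ring
    have hrest : ℙ[realized H D k g n | historyAct H D k h] =ᵐ[ℙ] fun ω =>
        pairAvg (G.P₁ h ((D ω).s₁ k h) ((D ω).a k h))
          (G.P₂ h ((D ω).s₂ k h) ((D ω).b k h)) (V ω) :=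
      ((condExp_condExp_of_le hle2 (hp.history_le hk (h + 1))).symm.trans
        (condExp_congr_ae ih)).trans hnext
    -- The current step.
    set cur : Ω → ℝ := fun ω =>
      g ω h ((D ω).s₁ k h) ((D ω).s₂ k h) ((D ω).a k h) ((D ω).b k h) with hcur
    have hcurm : Measurable[historyAct H D k h] cur :=
      measurable_at_visit hk1 hlt fun s t a b => (hg h hlt s t a b).mono (h0.trans hle1) le_rfl
    have hcuri : Integrable cur ℙ := integrable_of_ae_mem_Icc (hcurm.mono hA le_rfl)
      (ae_of_all _ fun ω => hgM ω h hlt _ _ _ _)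
    have hRsucc : realized H D k g (n + 1) = realized H D k g n + cur := by
      funext ω
      simp only [realized, Finset.sum_range_succ]
      rfl
    have hact : ℙ[realized H D k g (n + 1) | historyAct H D k h] =ᵐ[ℙ] fun ω =>
        g ω h ((D ω).s₁ k h) ((D ω).s₂ k h) ((D ω).a k h) ((D ω).b k h) +
          pairAvg (G.P₁ h ((D ω).s₁ k h) ((D ω).a k h))
            (G.P₂ h ((D ω).s₂ k h) ((D ω).b k h)) (V ω) := by
      rw [hRsucc]
      filter_upwards [condExp_add (hRi n (by omega)) hcuri (historyAct H D k h), hrest]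
        with ω e1 e2
      rw [e1, Pi.add_apply, e2,
        condExp_of_stronglyMeasurable hA hcurm.stronglyMeasurable hcuri, add_comm]
    refine ((condExp_condExp_of_le hle1 hA).symm.trans (condExp_congr_ae hact)).trans ?_
    -- The actions: average over the policies.
    have := condExp_select (ℙ := ℙ) (X := A × B) (hp.history_le hk h)
      (ξ := fun ω => ((D ω).a k h, (D ω).b k h))
      (p := fun x ω => μ ω k h ((D ω).s₁ k h) x.1 * ν ω k h ((D ω).s₂ k h) x.2)
      (fun x => by
        have := measurableSet_of_sigmaAct (hp.measurable_act k hk h hlt) fun a b => (a, b) = x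
        exact this)
      (fun x => by
        have := hp.act k hk h hlt x.1 x.2
        simpa only [Prod.ext_iff] using this)
      (f := fun x ω => g ω h ((D ω).s₁ k h) ((D ω).s₂ k h) x.1 x.2 +
        pairAvg (G.P₁ h ((D ω).s₁ k h) x.1) (G.P₂ h ((D ω).s₂ k h) x.2) (V ω))
      (fun x => measurable_at_state hk1 hlt.le (f := fun ω s t => g ω h s t x.1 x.2 +
          pairAvg (G.P₁ h s x.1) (G.P₂ h t x.2) (V ω)) fun s t =>
        ((hg h hlt s t x.1 x.2).mono h0 le_rfl).add (measurable_pairAvg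
          (fun _ => measurable_const) (fun _ => measurable_const)
          fun s' t' => (hVm s' t').mono h0 le_rfl))
      (C := M + n * M)
      (fun x ω => by
        have h1 := hgM ω h hlt ((D ω).s₁ k h) ((D ω).s₂ k h) x.1 x.2
        have hP₁ := G.isSubKernel₁ h hlt ((D ω).s₁ k h) x.1
        have hP₂ := G.isSubKernel₂ h hlt ((D ω).s₂ k h) x.2
        have h2 := pairAvg_nonneg hP₁.1 hP₂.1 (hV0 ω)
        have h3 := pairAvg_le hP₁.1 hP₂.1 hP₁.2 hP₂.2 (by positivity) (hVM ω)
        rw [abs_of_nonneg (add_nonneg h1.1 h2)]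
        exact add_le_add h1.2 h3)
    refine this.trans (ae_of_all _ fun ω => ?_)
    simp only [Fintype.sum_prod_type]
    rw [evalReward_succ, ← hh, pairAvg]
    exact Finset.sum_congr rfl fun a _ => Finset.sum_congr rfl fun b _ => by ring

end Histories

/-! ### Concentration of the estimates -/

section Concentration

variable {Ω : Type*} {mΩ : MeasurableSpace Ω} {ℙ : Measure Ω}

theorem measure_iUnion_le_of_card {ι : Type*} [Fintype ι] {E : ι → Set Ω} {ε c : ℝ}
    (hE : ∀ i, ℙ (E i) ≤ ENNReal.ofReal ε) (hc : (Fintype.card ι : ℝ) * ε ≤ c) :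
    ℙ (⋃ i, E i) ≤ ENNReal.ofReal c := by
  refine (measure_iUnion_fintype_le ℙ E).trans ((Finset.sum_le_sum fun i _ => hE i).trans ?_)
  rw [Finset.sum_const, Finset.card_univ, nsmul_eq_mul, ← ENNReal.ofReal_natCast,
    ← ENNReal.ofReal_mul (Nat.cast_nonneg _)]
  exact ENNReal.ofReal_le_ofReal hc

theorem sum_Icc_one_eq_sum_range (f : ℕ → ℝ) (k : ℕ) :
    ∑ j ∈ Finset.Icc 1 k, f j = ∑ j ∈ Finset.range k, f (j + 1) := by
  rw [Finset.range_eq_Ico, Finset.sum_Ico_add' f 0 k 1]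
  rfl

theorem card_filter_Icc_one (p : ℕ → Prop) [DecidablePred p] (k : ℕ) :
    ((Finset.Icc 1 k).filter p).card = ((Finset.range k).filter fun j => p (j + 1)).card := by
  have h := sum_Icc_one_eq_sum_range (fun j => if p j then 1 else 0) k
  simp only [← Finset.sum_filter, Finset.sum_const, nsmul_eq_mul, mul_one] at h
  exact_mod_cast h

/-- Half of the `ℓ¹` distance of two vectors of equal mass is attained on a subset. -/
theorem sum_abs_sub_le_of_subsets {S : Type*} [Fintype S] {p q : S → ℝ}
    (h : ∑ s, p s = ∑ s, q s) {x : ℝ} (hE : ∀ E : Finset S, ∑ s ∈ E, (p s - q s) ≤ x) :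
    ∑ s, |p s - q s| ≤ 2 * x := by
  classical
  set E := Finset.univ.filter fun s => q s ≤ p s with hEdef
  have h1 := Finset.sum_filter_add_sum_filter_not Finset.univ (fun s => q s ≤ p s)
    fun s => |p s - q s|
  have h2 := Finset.sum_filter_add_sum_filter_not Finset.univ (fun s => q s ≤ p s)
    fun s => p s - q s
  have h3 : ∑ s with q s ≤ p s, |p s - q s| = ∑ s with q s ≤ p s, (p s - q s) :=
    Finset.sum_congr rfl fun s hs => abs_of_nonneg (sub_nonneg.2 (Finset.mem_filter.1 hs).2)
  have h4 : ∑ s with ¬ q s ≤ p s, |p s - q s| = -∑ s with ¬ q s ≤ p s, (p s - q s) := by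
    rw [← Finset.sum_neg_distrib]
    exact Finset.sum_congr rfl fun s hs =>
      abs_of_nonpos (sub_nonpos.2 (not_le.1 (Finset.mem_filter.1 hs).2).le)
  rw [show ∑ s, (p s - q s) = 0 by rw [Finset.sum_sub_distrib, h, sub_self]] at h2
  have := hE E
  linarith

/-- Simultaneous `ℓ¹` confidence bounds for empirical transition probabilities, from one-sided
bounds for the frequencies of all sets of successor states. -/
theorem exists_l1_confidence {S C : Type*} [Fintype S] [Fintype C] [DecidableEq S]
    [DecidableEq C] {H K : ℕ} {δ : ℝ} (hδ : 0 < δ) (hδ1 : δ < 1) (hH : 1 ≤ H) (hK : 1 ≤ K)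
    [Nonempty S] [Nonempty C] (x : Ω → ℕ → ℕ → S) (c : Ω → ℕ → ℕ → C) {P : ℕ → S → C → S → ℝ}
    (hP : ∀ h < H, ∀ s a, P h s a ∈ stdSimplex ℝ S)
    (hvis : ∀ h < H, ∀ s a (E : Finset S) (n : ℕ) (y : ℝ), 0 ≤ y →
      ℙ {ω | ∃ k ∈ Finset.Icc 1 K,
        ((Finset.Icc 1 k).filter fun j => x ω j h = s ∧ c ω j h = a).card = n ∧
        n * y < ∑ j ∈ Finset.Icc 1 k, if x ω j h = s ∧ c ω j h = a then
          (if x ω j (h + 1) ∈ E then 1 else 0) - ∑ s' ∈ E, P h s a s' else 0} ≤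
      ENNReal.ofReal (Real.exp (-(2 * n * y ^ 2)))) :
    ∃ bad : Set Ω, ℙ bad ≤ ENNReal.ofReal δ ∧ ∀ ω ∉ bad, ∀ k ∈ Finset.Icc 1 K, ∀ h < H, ∀ s a,
      ∑ s', |(((Finset.Icc 1 k).filter fun j =>
          x ω j h = s ∧ c ω j h = a ∧ x ω j (h + 1) = s').card : ℝ) /
        max (((Finset.Icc 1 k).filter fun j => x ω j h = s ∧ c ω j h = a).card : ℝ) 1 -
          P h s a s'| ≤
      Real.sqrt (2 * Fintype.card S *
        Real.log (2 * (Fintype.card S : ℝ) * Fintype.card C * H * K / δ) /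
        max (((Finset.Icc 1 k).filter fun j => x ω j h = s ∧ c ω j h = a).card : ℝ) 1) := by
  set L := Real.log (2 * (Fintype.card S : ℝ) * Fintype.card C * H * K / δ) with hL
  have hS1 : (1 : ℝ) ≤ Fintype.card S := by exact_mod_cast Fintype.card_pos
  have hC1 : (1 : ℝ) ≤ Fintype.card C := by exact_mod_cast Fintype.card_pos
  have hH1 : (1 : ℝ) ≤ H := by exact_mod_cast hH
  have hK1 : (1 : ℝ) ≤ K := by exact_mod_cast hK
  set Z : ℝ := Fintype.card S * Fintype.card C * H * K with hZ
  have hZ1 : 1 ≤ Z := by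
    have := one_le_mul_of_one_le_of_one_le hS1 hC1
    have := one_le_mul_of_one_le_of_one_le this hH1
    exact one_le_mul_of_one_le_of_one_le this hK1
  have hZpos : 0 < Z := by linarith
  have hLeq : L = Real.log (2 * Z / δ) := by
    rw [hL, hZ]
    congr 2
    ring
  have hexpL : Real.exp L = 2 * Z / δ := by
    rw [hLeq, Real.exp_log (by positivity)]
  have hL2 : Real.log 2 ≤ L := by
    rw [hLeq]
    refine Real.log_le_log two_pos ?_
    rw [le_div_iff₀ hδ]
    nlinarith
  have hLhalf : 1 / 2 ≤ L := by linarith [Real.log_two_gt_d9]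
  -- The deviation allowed at the `n`-th visit.
  let y : ℕ → ℝ := fun n => Real.sqrt (2 * Fintype.card S * L / n) / 2
  have hy : ∀ n : ℕ, 1 ≤ n → 2 * n * y n ^ 2 = Fintype.card S * L := by
    intro n hn
    have hn : (1 : ℝ) ≤ n := by exact_mod_cast hn
    have : (0 : ℝ) < n := by linarith
    simp only [y]
    rw [div_pow, Real.sq_sqrt (by positivity)]
    field_simp
  let bad : Fin H × S × C × Finset S × Fin K → Set Ω := fun i =>
    {ω | ∃ k ∈ Finset.Icc 1 K,
        ((Finset.Icc 1 k).filter fun j => x ω j i.1 = i.2.1 ∧ c ω j i.1 = i.2.2.1).card =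
          (i.2.2.2.2 : ℕ) + 1 ∧
        (((i.2.2.2.2 : ℕ) + 1 : ℕ) : ℝ) * y ((i.2.2.2.2 : ℕ) + 1) < ∑ j ∈ Finset.Icc 1 k,
          if x ω j i.1 = i.2.1 ∧ c ω j i.1 = i.2.2.1 then
          (if x ω j (i.1 + 1) ∈ i.2.2.2.1 then 1 else 0) -
            ∑ s' ∈ i.2.2.2.1, P i.1 i.2.1 i.2.2.1 s' else 0}
  refine ⟨⋃ i, bad i, measure_iUnion_le_of_card (ε := Real.exp (-(Fintype.card S * L)))
    (fun i => ?_) ?_, ?_⟩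
  · have := hvis i.1 i.1.2 i.2.1 i.2.2.1 i.2.2.2.1 ((i.2.2.2.2 : ℕ) + 1)
      (y ((i.2.2.2.2 : ℕ) + 1)) (by positivity)
    rwa [hy _ (Nat.le_add_left 1 _)] at this
  · have hexp : Real.exp (-(Fintype.card S * L)) = (δ / (2 * Z)) ^ Fintype.card S := by
      rw [← mul_neg, Real.exp_nat_mul, Real.exp_neg, hexpL, inv_div]
    rw [hexp]
    simp only [Fintype.card_prod, Fintype.card_fin, Fintype.card_finset]
    push_cast
    have hpow : (2 : ℝ) ^ Fintype.card S * (δ / (2 * Z)) ^ Fintype.card S ≤ δ / Z := by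
      rw [← mul_pow, show 2 * (δ / (2 * Z)) = δ / Z by field_simp]
      exact pow_le_of_le_one (by positivity) (by rw [div_le_one hZpos]; linarith)
        Fintype.card_ne_zero
    calc _ = Z * ((2 : ℝ) ^ Fintype.card S * (δ / (2 * Z)) ^ Fintype.card S) := by
          rw [hZ]
          ring
      _ ≤ Z * (δ / Z) := mul_le_mul_of_nonneg_left hpow hZpos.le
      _ = δ := by field_simp
  · intro ω hω k hk h hh s a
    set n := ((Finset.Icc 1 k).filter fun j => x ω j h = s ∧ c ω j h = a).card with hn
    have hnK : n ≤ K := by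
      refine (Finset.card_filter_le _ _).trans ?_
      rw [Nat.card_Icc]
      have := (Finset.mem_Icc.1 hk).2
      omega
    have hPs := hP h hh s a
    rcases Nat.eq_zero_or_pos n with h0 | hpos
    · -- Without visits the empirical vector vanishes and the distance is `1`.
      have hz : ∀ s', ((Finset.Icc 1 k).filter fun j =>
          x ω j h = s ∧ c ω j h = a ∧ x ω j (h + 1) = s').card = 0 := by
        intro s'
        have hsub : ((Finset.Icc 1 k).filter fun j =>
            x ω j h = s ∧ c ω j h = a ∧ x ω j (h + 1) = s') ⊆
            (Finset.Icc 1 k).filter fun j => x ω j h = s ∧ c ω j h = a :=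
          Finset.monotone_filter_right _ fun j _ hj => ⟨hj.1, hj.2.1⟩
        exact Nat.le_zero.1 ((Finset.card_le_card hsub).trans (hn.symm.trans h0).le)
      simp only [hz, Nat.cast_zero, zero_div, zero_sub, abs_neg, h0]
      rw [Finset.sum_congr rfl fun s' _ => abs_of_nonneg (hPs.1 s'), hPs.2]
      rw [show max (0 : ℝ) 1 = 1 from max_eq_right zero_le_one, div_one]
      exact Real.one_le_sqrt.2 (by nlinarith)
    · have hnpos : (0 : ℝ) < n := by exact_mod_cast hpos
      have hmax : max (n : ℝ) 1 = n := max_eq_left (by exact_mod_cast hpos)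
      rw [hmax]
      have h2 : Real.sqrt (2 * Fintype.card S * L / n) = 2 * y n := by
        simp only [y]
        ring
      rw [h2]
      refine sum_abs_sub_le_of_subsets ?_ fun E => ?_
      · have hsum := sum_card_filter_fiber (Finset.Icc 1 k)
          (fun j => x ω j h = s ∧ c ω j h = a) (fun j => x ω j (h + 1))
          (fun j s' => x ω j h = s ∧ c ω j h = a ∧ x ω j (h + 1) = s') fun j s' => and_assoc.symm
        rw [hPs.2, ← Finset.sum_div, hsum]
        exact div_self hnpos.ne'
      · have hnot : ω ∉ bad (⟨h, hh⟩, s, a, E, ⟨n - 1, by omega⟩) := fun hb =>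
          hω (Set.mem_iUnion.2 ⟨_, hb⟩)
        have hn1 : n - 1 + 1 = n := by omega
        simp only [bad, hn1] at hnot
        have hle := not_lt.1 fun hlt => hnot ⟨k, hk, hn.symm, hlt⟩
        rw [← Finset.sum_filter, Finset.sum_sub_distrib, Finset.sum_const, ← hn, nsmul_eq_mul]
          at hle
        have hcnt : ∑ j ∈ (Finset.Icc 1 k).filter (fun j => x ω j h = s ∧ c ω j h = a),
            (if x ω j (h + 1) ∈ E then (1 : ℝ) else 0) =
            ∑ s' ∈ E, (((Finset.Icc 1 k).filter fun j =>
              x ω j h = s ∧ c ω j h = a ∧ x ω j (h + 1) = s').card : ℝ) := by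
          have hcard : ∀ s', (((Finset.Icc 1 k).filter fun j =>
              x ω j h = s ∧ c ω j h = a ∧ x ω j (h + 1) = s').card : ℝ) =
              ∑ j ∈ (Finset.Icc 1 k).filter (fun j => x ω j h = s ∧ c ω j h = a),
                if x ω j (h + 1) = s' then (1 : ℝ) else 0 := by
            intro s'
            rw [Finset.sum_boole, Finset.filter_filter]
            simp only [and_assoc]
          simp only [hcard]
          rw [Finset.sum_comm]
          refine Finset.sum_congr rfl fun j _ => ?_
          simp
        rw [hcnt] at hle
        rw [Finset.sum_sub_distrib, ← Finset.sum_div, sub_le_iff_le_add, div_le_iff₀ hnpos]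
        linarith

end Concentration

section Play

variable {S₁ S₂ A B Ω : Type*} [Fintype S₁] [Fintype S₂] {H : ℕ} {D : Ω → Record S₁ S₂ A B}
  {mΩ : MeasurableSpace Ω} {ℙ : Measure Ω} [IsProbabilityMeasure ℙ] {G : Game S₁ S₂ A B H} {K : ℕ}
  {μ : Ω → ℕ → Policy S₁ A} {ν : Ω → ℕ → Policy S₂ B}

theorem IsPlay.observed (hp : IsPlay ℙ G K D μ ν) : Observed mΩ H D K :=
  ⟨hp.measurable_state, hp.measurable_act, hp.measurable_rew⟩

/-- Hoeffding's inequality for an outcome `Y` whose conditional mean is `q` whenever the state and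
the actions at step `h` satisfy `p`. -/
theorem IsPlay.measure_visits_le (hp : IsPlay ℙ G K D μ ν) {h : ℕ} (hh : h < H)
    (p : S₁ → S₂ → A → B → Prop) [∀ s t a b, Decidable (p s t a b)]
    (hpm : ∀ (m : MeasurableSpace Ω) (j : ℕ), sigmaState D j h ≤ m → sigmaAct D j h ≤ m →
      MeasurableSet[m] {ω | p ((D ω).s₁ j h) ((D ω).s₂ j h) ((D ω).a j h) ((D ω).b j h)})
    (Y : ℕ → Ω → ℝ) {q : ℝ} (hq : q ∈ Set.Icc (0 : ℝ) 1)
    (hY : ∀ k ∈ Finset.Icc 1 K, ∀ m : MeasurableSpace Ω, Observed m H D k → Measurable[m] (Y k))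
    (h01 : ∀ k ∈ Finset.Icc 1 K, ∀ᵐ ω ∂ℙ, Y k ω ∈ Set.Icc (0 : ℝ) 1)
    (hmean : ∀ k ∈ Finset.Icc 1 K, ∀ᵐ ω ∂ℙ,
      p ((D ω).s₁ k h) ((D ω).s₂ k h) ((D ω).a k h) ((D ω).b k h) →
        (ℙ[Y k | historyAct H D k h]) ω = q) (n : ℕ) {x : ℝ} (hx : 0 ≤ x) :
    ℙ {ω | ∃ k ∈ Finset.Icc 1 K, ((Finset.Icc 1 k).filter fun j =>
          p ((D ω).s₁ j h) ((D ω).s₂ j h) ((D ω).a j h) ((D ω).b j h)).card = n ∧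
        n * x < ∑ j ∈ Finset.Icc 1 k,
          if p ((D ω).s₁ j h) ((D ω).s₂ j h) ((D ω).a j h) ((D ω).b j h) then Y j ω - q else 0} ≤
      ENNReal.ofReal (Real.exp (-(2 * n * x ^ 2))) := by
  have hmem : ∀ j < K, j + 1 ∈ Finset.Icc 1 K := fun j hj => Finset.mem_Icc.2 (by omega)
  have key := FactoredMG.measure_visits_le (ℙ := ℙ) (N := K)
    (F := fun j => historyAct H D (j + 1) h)
    (v := fun j ω => p ((D ω).s₁ (j + 1) h) ((D ω).s₂ (j + 1) h) ((D ω).a (j + 1) h)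
      ((D ω).b (j + 1) h))
    (Y := fun j => Y (j + 1)) hq (fun j hj => hp.historyAct_le (hmem j hj) hh)
    (fun j hj i hij => hpm _ (i + 1)
      (le_sup_of_le_left (sigmaState_le_history (by omega) hh.le (by omega)))
      (by
        rcases hij.eq_or_lt with rfl | hlt
        · exact le_sup_right
        · exact le_sup_of_le_left (sup_le_iff.1
            (sigmaAct_sup_sigmaRew_le_history (by omega) hh (Or.inl (by omega)))).1))
    (fun j hj i hij => hY (i + 1) (hmem i (by omega)) _
      ((observed_of_history_le (k := j) (h := h) le_sup_left).mono (by omega)))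
    (fun j hj => hY (j + 1) (hmem j hj) _ (hp.observed.mono (by omega)))
    (fun j hj => h01 (j + 1) (hmem j hj)) (fun j hj => hmean (j + 1) (hmem j hj)) n hx
  refine (measure_mono ?_).trans key
  rintro ω ⟨k, hk, hcard, hlt⟩
  refine ⟨k, (Finset.mem_Icc.1 hk).2, ?_, ?_⟩
  · rw [← hcard, card_filter_Icc_one]
  · rwa [sum_Icc_one_eq_sum_range] at hlt

variable [DecidableEq S₁] [DecidableEq S₂] [DecidableEq A] [DecidableEq B]

/-- The conditional probability that the next state of the two players lies in a given set. -/
theorem IsPlay.condExp_next (hp : IsPlay ℙ G K D μ ν) {h k : ℕ} (hh : h < H)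
    (hk : k ∈ Finset.Icc 1 K) (p : S₁ → S₂ → Prop) [∀ s t, Decidable (p s t)] :
    ℙ[fun ω => if p ((D ω).s₁ k (h + 1)) ((D ω).s₂ k (h + 1)) then (1 : ℝ) else 0 |
      historyAct H D k h] =ᵐ[ℙ] fun ω => pairAvg (G.P₁ h ((D ω).s₁ k h) ((D ω).a k h))
        (G.P₂ h ((D ω).s₂ k h) ((D ω).b k h)) fun s t => if p s t then 1 else 0 := by
  have := condExp_select (ℙ := ℙ) (X := S₁ × S₂) (hp.historyAct_le hk hh)
    (ξ := fun ω => ((D ω).s₁ k (h + 1), (D ω).s₂ k (h + 1)))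
    (p := fun x ω => G.P₁ h ((D ω).s₁ k h) ((D ω).a k h) x.1 *
      G.P₂ h ((D ω).s₂ k h) ((D ω).b k h) x.2)
    (fun x => by
      have := measurableSet_of_sigmaState (hp.measurable_state k hk (h + 1) hh)
        fun s t => (s, t) = x
      exact this)
    (fun x => by
      have := hp.next k hk h hh x.1 x.2
      simpa only [Prod.ext_iff] using this)
    (f := fun x _ => if p x.1 x.2 then 1 else 0) (fun x => measurable_const) (C := 1)
    (fun x ω => by split_ifs <;> simp)
  refine this.trans (ae_of_all _ fun ω => ?_)
  simp only [pairAvg, Fintype.sum_prod_type]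
  exact Finset.sum_congr rfl fun s _ => Finset.sum_congr rfl fun t _ => by ring

variable [Fintype A] [Fintype B] [Nonempty A] [Nonempty B] {δ : ℝ}

theorem mul_sqrt_eq_transBonus (m : ℕ) (L : ℝ) (n : ℕ) :
    Real.sqrt (2 * m * L / max (n : ℝ) 1) * H = transBonus H m L n := by
  have hH : (0 : ℝ) ≤ H := Nat.cast_nonneg H
  rw [transBonus, show 2 * (H : ℝ) ^ 2 * m * L / max (n : ℝ) 1 =
    2 * m * L / max (n : ℝ) 1 * (H : ℝ) ^ 2 by ring, Real.sqrt_mul' _ (by positivity),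
    Real.sqrt_sq hH]

theorem IsPlay.exists_trans_confidence₁ (hp : IsPlay ℙ G K D μ ν) (hδ : 0 < δ) (hδ1 : δ < 1)
    (hH : 1 ≤ H) (hK : 1 ≤ K) : ∃ bad : Set Ω, ℙ bad ≤ ENNReal.ofReal δ ∧ ∀ ω ∉ bad,
      ∀ k ∈ Finset.Icc 1 K, ∀ h < H, ∀ s a,
        (∑ s', |(D ω).PHat₁ k h s a s' - G.P₁ h s a s'|) * H ≤ (D ω).bonusP₁ H K δ k h s a := by
  have : Nonempty S₁ := ⟨G.x₁⟩
  obtain ⟨bad, hbad, hgood⟩ := exists_l1_confidence (ℙ := ℙ) (S := S₁) (C := A) hδ hδ1 hH hK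
    (fun ω => (D ω).s₁) (fun ω => (D ω).a) G.P₁_mem (fun h hh s a E n y hy => by
      have hE0 : 0 ≤ ∑ s' ∈ E, G.P₁ h s a s' :=
        Finset.sum_nonneg fun s' _ => (G.P₁_mem h hh s a).1 s'
      have hE1 : ∑ s' ∈ E, G.P₁ h s a s' ≤ 1 := by
        rw [← (G.P₁_mem h hh s a).2]
        exact Finset.sum_le_sum_of_subset_of_nonneg (Finset.subset_univ E)
          fun s' _ _ => (G.P₁_mem h hh s a).1 s'
      exact hp.measure_visits_le hh (fun s' _ a' _ => s' = s ∧ a' = a)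
        (fun m j h1 h2 => (measurableSet_of_sigmaState h1 fun s' _ => s' = s).inter
          (measurableSet_of_sigmaAct h2 fun a' _ => a' = a))
        (fun j ω => if (D ω).s₁ j (h + 1) ∈ E then 1 else 0) ⟨hE0, hE1⟩
        (fun k hk m hO => Measurable.ite (measurableSet_of_sigmaState (hO.state k (Finset.mem_Icc.2
            ⟨(Finset.mem_Icc.1 hk).1, le_rfl⟩) (h + 1) hh) fun s' _ => s' ∈ E)
          measurable_const measurable_const)
        (fun k hk => ae_of_all _ fun ω => by
          split_ifs <;> simp)
        (fun k hk => by
          filter_upwards [hp.condExp_next hh hk fun s' _ => s' ∈ E] with ω h1 h2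
          rw [h1, h2.1, h2.2, pairAvg_eq_left]
          simp only [← Finset.mul_sum, (G.P₂_mem h hh _ _).2, mul_one]
          simp) n hy)
  refine ⟨bad, hbad, fun ω hω k hk h hh s a => ?_⟩
  have hk0 : k ≠ 0 := by
    have := (Finset.mem_Icc.1 hk).1
    omega
  have := mul_le_mul_of_nonneg_right (hgood ω hω k hk h hh s a) (Nat.cast_nonneg (α := ℝ) H)
  rw [mul_sqrt_eq_transBonus] at this
  simp only [Record.PHat₁, hk0, if_false]
  exact this

theorem IsPlay.exists_trans_confidence₂ (hp : IsPlay ℙ G K D μ ν) (hδ : 0 < δ) (hδ1 : δ < 1)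
    (hH : 1 ≤ H) (hK : 1 ≤ K) : ∃ bad : Set Ω, ℙ bad ≤ ENNReal.ofReal δ ∧ ∀ ω ∉ bad,
      ∀ k ∈ Finset.Icc 1 K, ∀ h < H, ∀ t b,
        (∑ t', |(D ω).PHat₂ k h t b t' - G.P₂ h t b t'|) * H ≤ (D ω).bonusP₂ H K δ k h t b := by
  have : Nonempty S₂ := ⟨G.x₂⟩
  obtain ⟨bad, hbad, hgood⟩ := exists_l1_confidence (ℙ := ℙ) (S := S₂) (C := B) hδ hδ1 hH hK
    (fun ω => (D ω).s₂) (fun ω => (D ω).b) G.P₂_mem (fun h hh t b E n y hy => by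
      have hE0 : 0 ≤ ∑ t' ∈ E, G.P₂ h t b t' :=
        Finset.sum_nonneg fun t' _ => (G.P₂_mem h hh t b).1 t'
      have hE1 : ∑ t' ∈ E, G.P₂ h t b t' ≤ 1 := by
        rw [← (G.P₂_mem h hh t b).2]
        exact Finset.sum_le_sum_of_subset_of_nonneg (Finset.subset_univ E)
          fun t' _ _ => (G.P₂_mem h hh t b).1 t'
      exact hp.measure_visits_le hh (fun _ t' _ b' => t' = t ∧ b' = b)
        (fun m j h1 h2 => (measurableSet_of_sigmaState h1 fun _ t' => t' = t).inter
          (measurableSet_of_sigmaAct h2 fun _ b' => b' = b))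
        (fun j ω => if (D ω).s₂ j (h + 1) ∈ E then 1 else 0) ⟨hE0, hE1⟩
        (fun k hk m hO => Measurable.ite (measurableSet_of_sigmaState (hO.state k (Finset.mem_Icc.2
            ⟨(Finset.mem_Icc.1 hk).1, le_rfl⟩) (h + 1) hh) fun _ t' => t' ∈ E)
          measurable_const measurable_const)
        (fun k hk => ae_of_all _ fun ω => by
          split_ifs <;> simp)
        (fun k hk => by
          filter_upwards [hp.condExp_next hh hk fun _ t' => t' ∈ E] with ω h1 h2
          rw [h1, h2.1, h2.2, pairAvg_eq_right]
          simp only [← Finset.sum_mul, (G.P₁_mem h hh _ _).2, one_mul]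
          simp) n hy)
  refine ⟨bad, hbad, fun ω hω k hk h hh t b => ?_⟩
  have hk0 : k ≠ 0 := by
    have := (Finset.mem_Icc.1 hk).1
    omega
  have := mul_le_mul_of_nonneg_right (hgood ω hω k hk h hh t b) (Nat.cast_nonneg (α := ℝ) H)
  rw [mul_sqrt_eq_transBonus] at this
  simp only [Record.PHat₂, hk0, if_false]
  exact this

theorem IsPlay.exists_reward_confidence (hp : IsPlay ℙ G K D μ ν) (hδ : 0 < δ)
    (hL : 1 / 2 ≤ Real.log ((Fintype.card S₁ : ℝ) * Fintype.card S₂ * Fintype.card A *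
      Fintype.card B * H * K / δ)) (hH : 1 ≤ H) (hK : 1 ≤ K) :
    ∃ bad : Set Ω, ℙ bad ≤ ENNReal.ofReal (2 * δ) ∧ ∀ ω ∉ bad,
      ∀ k ∈ Finset.Icc 1 K, ∀ h < H, ∀ s t a b,
        |(D ω).rHat k h s t a b - G.r h s t a b| ≤ (D ω).bonusR H K δ k h s t a b := by
  set L := Real.log ((Fintype.card S₁ : ℝ) * Fintype.card S₂ * Fintype.card A *
      Fintype.card B * H * K / δ) with hLdef
  have : Nonempty S₁ := ⟨G.x₁⟩
  have : Nonempty S₂ := ⟨G.x₂⟩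
  set X : ℝ := (Fintype.card S₁ : ℝ) * Fintype.card S₂ * Fintype.card A *
      Fintype.card B * H * K with hX
  have hXpos : 0 < X := by
    have h1 : (0 : ℝ) < Fintype.card S₁ := by exact_mod_cast Fintype.card_pos
    have h2 : (0 : ℝ) < Fintype.card S₂ := by exact_mod_cast Fintype.card_pos
    have h3 : (0 : ℝ) < Fintype.card A := by exact_mod_cast Fintype.card_pos
    have h4 : (0 : ℝ) < Fintype.card B := by exact_mod_cast Fintype.card_pos
    have h5 : (0 : ℝ) < H := by exact_mod_cast hH
    have h6 : (0 : ℝ) < K := by exact_mod_cast hK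
    positivity
  let y : ℕ → ℝ := fun n => Real.sqrt (4 * L / n)
  have hy : ∀ n : ℕ, 1 ≤ n → 2 * n * y n ^ 2 = 8 * L := by
    intro n hn
    have hn : (0 : ℝ) < n := by exact_mod_cast hn
    simp only [y]
    rw [Real.sq_sqrt (by positivity)]
    field_simp
    ring
  -- The Boolean selects the side of the deviation.
  let Y : Bool → ℕ → ℕ → Ω → ℝ := fun σ h j ω =>
    if σ then (D ω).rew j h else 1 - (D ω).rew j h
  let q : Bool → ℕ → S₁ → S₂ → A → B → ℝ := fun σ h s t a b =>
    if σ then G.r h s t a b else 1 - G.r h s t a b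
  let bad : Bool × Fin H × S₁ × S₂ × A × B × Fin K → Set Ω := fun ⟨σ, h, s, t, a, b, n⟩ =>
    {ω | ∃ k ∈ Finset.Icc 1 K, (D ω).count k h s t a b = (n : ℕ) + 1 ∧
        (((n : ℕ) + 1 : ℕ) : ℝ) * y ((n : ℕ) + 1) < ∑ j ∈ Finset.Icc 1 k,
          if (D ω).s₁ j h = s ∧ (D ω).s₂ j h = t ∧ (D ω).a j h = a ∧ (D ω).b j h = b then
            Y σ h j ω - q σ h s t a b else 0}
  refine ⟨⋃ i, bad i, measure_iUnion_le_of_card (ε := Real.exp (-(8 * L))) ?_ ?_, ?_⟩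
  · rintro ⟨σ, ⟨h, hh⟩, s, t, a, b, n⟩
    have hr := G.r_mem h hh s t a b
    have := hp.measure_visits_le hh
      (fun s' t' a' b' => s' = s ∧ t' = t ∧ a' = a ∧ b' = b)
      (fun m j h1 h2 => by
        have e1 := measurableSet_of_sigmaState h1 fun s' t' => s' = s ∧ t' = t
        have e2 := measurableSet_of_sigmaAct h2 fun a' b' => a' = a ∧ b' = b
        convert e1.inter e2 using 1
        ext ω
        simp [and_assoc])
      (Y σ h) (q := q σ h s t a b)
      (by
        cases σ
        · exact ⟨sub_nonneg.2 hr.2, sub_le_self _ hr.1⟩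
        · exact hr)
      (fun k hk m hO => by
        have := measurable_of_sigmaRew (hO.rew k (Finset.mem_Icc.2
            ⟨(Finset.mem_Icc.1 hk).1, le_rfl⟩) h hh)
        cases σ
        · exact measurable_const.sub this
        · exact this)
      (fun k hk => by
        filter_upwards [hp.rew_mem k hk h hh] with ω hω
        cases σ
        · exact ⟨sub_nonneg.2 hω.2, sub_le_self _ hω.1⟩
        · exact hω)
      (fun k hk => by
        cases σ
        · have hint : Integrable (fun ω => (D ω).rew k h) ℙ :=
            integrable_of_ae_mem_Icc (measurable_of_sigmaRew (hp.measurable_rew k hk h hh))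
              (hp.rew_mem k hk h hh)
          have haff := (condExp_affine (hp.historyAct_le hk hh) hint
            (a := fun _ => 1) (b := fun _ => -1) measurable_const measurable_const (C := 1)
            (fun _ => by simp) (fun _ => by simp)).2
          filter_upwards [haff, hp.rew_mean k hk h hh] with ω e1 e2 e3
          have : (Y false h k) = fun ω => 1 + -1 * (D ω).rew k h := by
            funext ω
            simp only [Y]
            simp
            ring
          rw [this, e1, e2, e3.1, e3.2.1, e3.2.2.1, e3.2.2.2]
          simp only [q]
          simp
          ring
        · filter_upwards [hp.rew_mean k hk h hh] with ω e2 e3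
          have : (Y true h k) = fun ω => (D ω).rew k h := by
            funext ω
            simp only [Y, if_true]
          rw [this, e2, e3.1, e3.2.1, e3.2.2.1, e3.2.2.2]
          simp only [q, if_true])
      ((n : ℕ) + 1) (x := y ((n : ℕ) + 1)) (Real.sqrt_nonneg _)
    rw [hy _ (Nat.le_add_left 1 _)] at this
    exact this
  · have hexp : Real.exp (-(8 * L)) ≤ δ / X := by
      calc Real.exp (-(8 * L)) ≤ Real.exp (-L) := Real.exp_le_exp.2 (by linarith)
        _ = δ / X := by rw [Real.exp_neg, hLdef, Real.exp_log (by positivity), inv_div]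
    simp only [Fintype.card_prod, Fintype.card_fin, Fintype.card_bool]
    push_cast
    calc _ = 2 * X * Real.exp (-(8 * L)) := by
          rw [hX]
          ring
      _ ≤ 2 * X * (δ / X) := mul_le_mul_of_nonneg_left hexp (by positivity)
      _ = 2 * δ := by field_simp
  · intro ω hω k hk h hh s t a b
    have hr := G.r_mem h hh s t a b
    have hbonus : (D ω).bonusR H K δ k h s t a b =
      Real.sqrt (4 * L / max ((D ω).count k h s t a b : ℝ) 1) := rfl
    rw [hbonus, Record.rHat]
    set n := (D ω).count k h s t a b with hn
    have hnK : n ≤ K := by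
      refine (Finset.card_filter_le _ _).trans ?_
      rw [Nat.card_Icc]
      have := (Finset.mem_Icc.1 hk).2
      omega
    rcases Nat.eq_zero_or_pos n with h0 | hpos
    · have hempty : ∀ j ∈ Finset.Icc 1 k, ¬ ((D ω).s₁ j h = s ∧ (D ω).s₂ j h = t ∧
          (D ω).a j h = a ∧ (D ω).b j h = b) :=
        Finset.filter_eq_empty_iff.1 (Finset.card_eq_zero.1 (hn.symm.trans h0))
      rw [Finset.sum_eq_zero fun j hj => if_neg (hempty j hj), h0, Nat.cast_zero, zero_div,
        zero_sub, abs_neg, abs_of_nonneg hr.1, max_eq_right zero_le_one, div_one]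
      exact hr.2.trans (Real.one_le_sqrt.2 (by linarith))
    · have hnpos : (0 : ℝ) < n := by exact_mod_cast hpos
      rw [max_eq_left (show (1 : ℝ) ≤ n by exact_mod_cast hpos)]
      have hside : ∀ σ : Bool, (∑ j ∈ Finset.Icc 1 k,
          if (D ω).s₁ j h = s ∧ (D ω).s₂ j h = t ∧ (D ω).a j h = a ∧ (D ω).b j h = b then
            Y σ h j ω - q σ h s t a b else 0) ≤ n * y n := by
        intro σ
        have hnot : ω ∉ bad (σ, ⟨h, hh⟩, s, t, a, b, ⟨n - 1, by omega⟩) := fun hb =>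
          hω (Set.mem_iUnion.2 ⟨(σ, ⟨h, hh⟩, s, t, a, b, ⟨n - 1, by omega⟩), hb⟩)
        have hn1 : n - 1 + 1 = n := by omega
        simp only [bad, hn1] at hnot
        exact not_lt.1 fun hlt => hnot ⟨k, hk, hn.symm, hlt⟩
      have h1 := hside true
      have h2 := hside false
      simp only [Y, q, if_true, Bool.false_eq_true, if_false, ← Finset.sum_filter,
        Finset.sum_sub_distrib, Finset.sum_const, nsmul_eq_mul] at h1 h2 ⊢
      have hcard : (((Finset.Icc 1 k).filter fun j => (D ω).s₁ j h = s ∧ (D ω).s₂ j h = t ∧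
          (D ω).a j h = a ∧ (D ω).b j h = b).card : ℝ) = n := rfl
      rw [hcard] at h1 h2
      rw [abs_le, le_sub_iff_add_le, le_div_iff₀ hnpos, sub_le_iff_le_add, div_le_iff₀ hnpos]
      simp only [y] at h1 h2
      constructor <;> linarith

/-- All estimates are concentrated, in all episodes at once, with probability at least `1 - 4 δ`:
`2 δ` for the two sides of the reward deviations, `δ` for the transitions of each player. -/
theorem IsPlay.exists_concentrated (hp : IsPlay ℙ G K D μ ν) (hδ : 0 < δ) (hδ1 : δ < 1)
    (hL : 1 / 2 ≤ Real.log ((Fintype.card S₁ : ℝ) * Fintype.card S₂ * Fintype.card A *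
      Fintype.card B * H * K / δ)) (hH : 1 ≤ H) (hK : 1 ≤ K) :
    ∃ bad : Set Ω, ℙ bad ≤ ENNReal.ofReal (4 * δ) ∧ ∀ ω ∉ bad,
      ∀ k ∈ Finset.Icc 1 K, Concentrated G K δ (D ω) k := by
  obtain ⟨b₁, hb₁, hg₁⟩ := hp.exists_reward_confidence hδ hL hH hK
  obtain ⟨b₂, hb₂, hg₂⟩ := hp.exists_trans_confidence₁ hδ hδ1 hH hK
  obtain ⟨b₃, hb₃, hg₃⟩ := hp.exists_trans_confidence₂ hδ hδ1 hH hK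
  have hrew : ∀ᵐ ω ∂ℙ, ∀ k ∈ Finset.Icc 1 K, ∀ h ∈ Finset.range H, 0 ≤ (D ω).rew k h := by
    rw [Filter.eventually_all_finset]
    intro k hk
    rw [Filter.eventually_all_finset]
    intro h hh
    exact (hp.rew_mem k hk h (Finset.mem_range.1 hh)).mono fun ω hω => hω.1
  set b₄ := {ω | ¬ ∀ k ∈ Finset.Icc 1 K, ∀ h ∈ Finset.range H, 0 ≤ (D ω).rew k h} with hb₄
  have hb₄0 : ℙ b₄ = 0 := hrew
  refine ⟨b₁ ∪ b₂ ∪ b₃ ∪ b₄, ?_, fun ω hω k hk => ?_⟩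
  · refine (measure_union_le _ _).trans ?_
    rw [hb₄0, add_zero]
    refine (measure_union_le _ _).trans ((add_le_add ((measure_union_le _ _).trans
      (add_le_add hb₁ hb₂)) hb₃).trans (le_of_eq ?_))
    rw [← ENNReal.ofReal_add (by positivity) (by positivity),
      ← ENNReal.ofReal_add (by positivity) (by positivity)]
    congr 1
    ring
  · simp only [Set.mem_union, not_or] at hω
    refine ⟨fun h hh s t a b => ?_, hg₁ ω hω.1.1.1 k hk, hg₂ ω hω.1.1.2 k hk, hg₃ ω hω.1.2 k hk⟩
    have hall := not_not.1 hω.2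
    refine div_nonneg (Finset.sum_nonneg fun j hj => ?_) (by positivity)
    split_ifs
    · refine hall j (Finset.mem_Icc.2 ?_) h (Finset.mem_range.2 hh)
      have h1 := Finset.mem_Icc.1 hj
      have h2 := Finset.mem_Icc.1 hk
      omega
    · exact le_rfl

end Play

/-! ### The sum of the bonuses -/

section Pigeonhole

/-- The constant is governed by `n = 1`, where the increment of the square root is `√2 - 1`. -/
theorem one_div_sqrt_max_le (n : ℕ) :
    1 / Real.sqrt (max (n : ℝ) 1) ≤ 3 * (Real.sqrt ((n + 1 : ℕ) : ℝ) - Real.sqrt n) := by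
  rcases Nat.eq_zero_or_pos n with rfl | hn
  · norm_num
  · have hn1 : (1 : ℝ) ≤ n := by exact_mod_cast hn
    rw [max_eq_left hn1]
    set u := Real.sqrt n with hu
    set v := Real.sqrt ((n + 1 : ℕ) : ℝ) with hv
    have hu0 : 0 < u := Real.sqrt_pos.2 (by linarith)
    have hu2 : u ^ 2 = n := Real.sq_sqrt (by linarith)
    have hv2 : v ^ 2 = n + 1 := by
      rw [hv, Real.sq_sqrt (by positivity)]
      push_cast
      ring
    have hv0 : 0 ≤ v := Real.sqrt_nonneg _
    have hvu : v ≤ 2 * u := by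
      refine Real.sqrt_le_iff.2 ⟨by positivity, ?_⟩
      push_cast
      nlinarith
    have huv : u ≤ v := Real.sqrt_le_sqrt (by push_cast; linarith)
    rw [div_le_iff₀ hu0]
    have h1 : (v - u) * (v + u) = 1 := by nlinarith
    nlinarith [mul_nonneg (sub_nonneg.2 huv) (sub_nonneg.2 hvu)]

variable {X : Type*} [Fintype X] [DecidableEq X]

/-- The widths `1 / √n` at the successively visited points of a finite set sum up to the order of
the square root of the number of rounds. -/
theorem sum_one_div_sqrt_visits_le (x : ℕ → X) (K : ℕ) :
    ∑ k ∈ Finset.Icc 1 K,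
        1 / Real.sqrt (max (((Finset.Icc 1 (k - 1)).filter fun j => x j = x k).card : ℝ) 1) ≤
      3 * Real.sqrt (Fintype.card X * K) := by
  set N : ℕ → X → ℕ := fun k y => ((Finset.Icc 1 k).filter fun j => x j = y).card with hN
  have hNsucc : ∀ k y, N (k + 1) y = N k y + if x (k + 1) = y then 1 else 0 := by
    intro k y
    simp only [hN, Finset.card_filter]
    exact Finset.sum_Icc_succ_top (by omega) _
  have hpot : ∀ k, ∑ i ∈ Finset.Icc 1 k, 1 / Real.sqrt (max (N (i - 1) (x i) : ℝ) 1) ≤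
      3 * ∑ y, Real.sqrt (N k y) := by
    intro k
    induction k with
    | zero => simp [hN]
    | succ k ih =>
      rw [Finset.sum_Icc_succ_top (by omega), Nat.add_sub_cancel]
      have hdiff : ∑ y, Real.sqrt (N (k + 1) y) = ∑ y, Real.sqrt (N k y) +
          (Real.sqrt ((N k (x (k + 1)) + 1 : ℕ) : ℝ) - Real.sqrt (N k (x (k + 1)))) := by
        rw [← sub_eq_iff_eq_add', ← Finset.sum_sub_distrib,
          Finset.sum_eq_single (x (k + 1))]
        · simp only [hNsucc, if_true]
        · intro y _ hy
          simp [hNsucc, hy.symm]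
        · simp
      rw [hdiff, mul_add]
      exact add_le_add ih (one_div_sqrt_max_le _)
  refine (hpot K).trans (mul_le_mul_of_nonneg_left ?_ (by norm_num))
  refine Real.le_sqrt_of_sq_le ?_
  have hcs := sq_sum_le_card_mul_sum_sq (s := (Finset.univ : Finset X))
    (f := fun y => Real.sqrt (N K y))
  refine hcs.trans (le_of_eq ?_)
  rw [Finset.card_univ]
  congr 1
  have hsq : ∀ y, Real.sqrt (N K y) ^ 2 = N K y := fun y => Real.sq_sqrt (Nat.cast_nonneg _)
  simp only [hsq]
  rw [← Nat.cast_sum, ← Finset.card_eq_sum_card_fiberwise fun _ _ =>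
    Finset.mem_coe.2 (Finset.mem_univ _)]
  simp

theorem sum_sqrt_div_visits_le (x : ℕ → X) (K : ℕ) {c : ℝ} (hc : 0 ≤ c) :
    ∑ k ∈ Finset.Icc 1 K,
        Real.sqrt (c / max (((Finset.Icc 1 (k - 1)).filter fun j => x j = x k).card : ℝ) 1) ≤
      Real.sqrt c * (3 * Real.sqrt (Fintype.card X * K)) := by
  refine le_trans (le_of_eq ?_)
    (mul_le_mul_of_nonneg_left (sum_one_div_sqrt_visits_le x K) (Real.sqrt_nonneg c))
  rw [Finset.mul_sum]
  refine Finset.sum_congr rfl fun k _ => ?_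
  rw [Real.sqrt_div hc, mul_one_div]

end Pigeonhole

section PriorBonus

variable {S₁ S₂ A B : Type*} [Fintype S₁] [Fintype S₂] [Fintype A] [Fintype B]
  [DecidableEq S₁] [DecidableEq S₂] [DecidableEq A] [DecidableEq B]

/-- The bonus formula evaluated on the first `k` episodes, without the convention at `k = 0`. With
`k - 1` in place of `k` it is known before episode `k` and dominates the bonus after episode `k`. -/
def Record.priorBonus (D : Record S₁ S₂ A B) (H K : ℕ) (δ : ℝ) (k h : ℕ)
    (s : S₁) (t : S₂) (a : A) (b : B) : ℝ :=
  D.bonusR H K δ k h s t a b + (D.bonusP₁ H K δ k h s a + D.bonusP₂ H K δ k h t b)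

theorem sqrt_div_max_anti {c : ℝ} (hc : 0 ≤ c) {n n' : ℕ} (hn : n ≤ n') :
    Real.sqrt (c / max (n' : ℝ) 1) ≤ Real.sqrt (c / max (n : ℝ) 1) := by
  refine Real.sqrt_le_sqrt (div_le_div_of_nonneg_left hc (by positivity) (max_le_max ?_ le_rfl))
  exact_mod_cast hn

theorem card_filter_Icc_mono {k k' : ℕ} (hk : k ≤ k') (p : ℕ → Prop) [DecidablePred p] :
    ((Finset.Icc 1 k).filter p).card ≤ ((Finset.Icc 1 k').filter p).card :=
  Finset.card_le_card (Finset.filter_subset_filter _ (Finset.Icc_subset_Icc_right hk))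

variable {H K : ℕ} {δ : ℝ} (D : Record S₁ S₂ A B)
  (hL : 0 ≤ Real.log ((Fintype.card S₁ : ℝ) * Fintype.card S₂ * Fintype.card A *
    Fintype.card B * H * K / δ))
  (hL₁ : 0 ≤ Real.log (2 * (Fintype.card S₁ : ℝ) * Fintype.card A * H * K / δ))
  (hL₂ : 0 ≤ Real.log (2 * (Fintype.card S₂ : ℝ) * Fintype.card B * H * K / δ))

include hL hL₁ hL₂ in
theorem Record.bonus_le_priorBonus {k : ℕ} (hk : 1 ≤ k) (h : ℕ) (s : S₁) (t : S₂) (a : A) (b : B) :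
    D.bonus H K δ k h s t a b ≤ D.priorBonus H K δ (k - 1) h s t a b := by
  rw [D.bonus_eq H K δ (by omega)]
  exact add_le_add (sqrt_div_max_anti (by positivity) (card_filter_Icc_mono (Nat.sub_le _ _) _))
    (add_le_add (sqrt_div_max_anti (by positivity) (card_filter_Icc_mono (Nat.sub_le _ _) _))
      (sqrt_div_max_anti (by positivity) (card_filter_Icc_mono (Nat.sub_le _ _) _)))

/-- Upper bound for the bonus: its value when nothing has been visited more than once. -/
def maxBonus (S₁ S₂ A B : Type*) [Fintype S₁] [Fintype S₂] [Fintype A] [Fintype B] (H K : ℕ)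
    (δ : ℝ) : ℝ :=
  Real.sqrt (4 * Real.log ((Fintype.card S₁ : ℝ) * Fintype.card S₂ * Fintype.card A *
    Fintype.card B * H * K / δ)) +
  (Real.sqrt (2 * (H : ℝ) ^ 2 * Fintype.card S₁ *
    Real.log (2 * (Fintype.card S₁ : ℝ) * Fintype.card A * H * K / δ)) +
  Real.sqrt (2 * (H : ℝ) ^ 2 * Fintype.card S₂ *
    Real.log (2 * (Fintype.card S₂ : ℝ) * Fintype.card B * H * K / δ)))

include hL hL₁ hL₂ in
theorem Record.priorBonus_mem (k h : ℕ) (s : S₁) (t : S₂) (a : A) (b : B) :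
    D.priorBonus H K δ k h s t a b ∈ Set.Icc 0 (maxBonus S₁ S₂ A B H K δ) := by
  have key : ∀ {c : ℝ}, 0 ≤ c → ∀ n : ℕ, Real.sqrt (c / max (n : ℝ) 1) ≤ Real.sqrt c :=
    fun hc n => Real.sqrt_le_sqrt (div_le_self hc (le_max_right _ _))
  exact ⟨add_nonneg (D.bonusR_nonneg H K δ k h s t a b)
      (add_nonneg (D.bonusP₁_nonneg H K δ k h s a) (D.bonusP₂_nonneg H K δ k h t b)),
    add_le_add (key (by positivity) _)
      (add_le_add (key (by positivity) _) (key (by positivity) _))⟩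

include hL hL₁ hL₂ in
/-- Pigeonhole bound for the bonuses met along the realized trajectories at step `h`. -/
theorem Record.sum_priorBonus_le (h : ℕ) :
    ∑ k ∈ Finset.Icc 1 K, D.priorBonus H K δ (k - 1) h (D.s₁ k h) (D.s₂ k h) (D.a k h) (D.b k h) ≤
      Real.sqrt (4 * Real.log ((Fintype.card S₁ : ℝ) * Fintype.card S₂ * Fintype.card A *
        Fintype.card B * H * K / δ)) *
        (3 * Real.sqrt ((Fintype.card S₁ * (Fintype.card S₂ * (Fintype.card A * Fintype.card B)) :
          ℕ) * K)) +
      (Real.sqrt (2 * (H : ℝ) ^ 2 * Fintype.card S₁ *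
        Real.log (2 * (Fintype.card S₁ : ℝ) * Fintype.card A * H * K / δ)) *
        (3 * Real.sqrt ((Fintype.card S₁ * Fintype.card A : ℕ) * K)) +
      Real.sqrt (2 * (H : ℝ) ^ 2 * Fintype.card S₂ *
        Real.log (2 * (Fintype.card S₂ : ℝ) * Fintype.card B * H * K / δ)) *
        (3 * Real.sqrt ((Fintype.card S₂ * Fintype.card B : ℕ) * K))) := by
  simp only [priorBonus, Finset.sum_add_distrib]
  refine add_le_add ?_ (add_le_add ?_ ?_)
  · have := sum_sqrt_div_visits_le (fun j => (D.s₁ j h, D.s₂ j h, D.a j h, D.b j h)) K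
      (mul_nonneg (by norm_num : (0 : ℝ) ≤ 4) hL)
    simp only [Prod.mk.injEq, Fintype.card_prod] at this
    exact this
  · have := sum_sqrt_div_visits_le (fun j => (D.s₁ j h, D.a j h)) K
      (c := 2 * (H : ℝ) ^ 2 * Fintype.card S₁ *
        Real.log (2 * (Fintype.card S₁ : ℝ) * Fintype.card A * H * K / δ)) (by positivity)
    simp only [Prod.mk.injEq, Fintype.card_prod] at this
    exact this
  · have := sum_sqrt_div_visits_le (fun j => (D.s₂ j h, D.b j h)) K
      (c := 2 * (H : ℝ) ^ 2 * Fintype.card S₂ *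
        Real.log (2 * (Fintype.card S₂ : ℝ) * Fintype.card B * H * K / δ)) (by positivity)
    simp only [Prod.mk.injEq, Fintype.card_prod] at this
    exact this

end PriorBonus

section OnPolicy

variable {S₁ S₂ A B Ω : Type*} [Fintype S₁] [Fintype S₂] [Fintype A] [Fintype B]
  [DecidableEq S₁] [DecidableEq S₂] [DecidableEq A] [DecidableEq B] [Nonempty A] [Nonempty B]
  {mΩ : MeasurableSpace Ω} {ℙ : Measure Ω} [IsProbabilityMeasure ℙ] {H K : ℕ}
  {G : Game S₁ S₂ A B H} {D : Ω → Record S₁ S₂ A B} {δ η γ : ℝ}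
  {μ : Ω → ℕ → Policy S₁ A} {ν : Ω → ℕ → Policy S₂ B}

theorem historyAct_le_history_of_lt {k k' h h' : ℕ} (hk : 1 ≤ k) (hh : h < H) (hkk : k < k') :
    historyAct H D k h ≤ history H D k' h' :=
  (historyAct_le_history_succ hk hh).trans (history_le_iff.2
    ⟨fun j i h1 h2 h3 => sigmaState_le_history h1 h2 (by omega),
    fun j i h1 h2 h3 => sup_le_iff.1 (sigmaAct_sup_sigmaRew_le_history h1 h2 (by omega))⟩)

/-- The expected bonuses are at most twice the realized ones, up to the range of the total bonus in
an episode. -/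
theorem IsPlay.measure_expected_bonus_ge (hp : IsPlay ℙ G K D μ ν)
    (hA : ∀ ω, IsAlgorithm₁ H K δ η G.x₂ (D ω) (μ ω) (ν ω))
    (hB : ∀ ω, IsAlgorithm₂ H K δ γ G.x₁ (D ω) (μ ω) (ν ω))
    (hη : 0 < η ∨ Subsingleton A) (hγ : 0 < γ ∨ Subsingleton B) (hH : 1 ≤ H)
    (hL : 0 < Real.log ((Fintype.card S₁ : ℝ) * Fintype.card S₂ * Fintype.card A *
      Fintype.card B * H * K / δ))
    (hL₁ : 0 ≤ Real.log (2 * (Fintype.card S₁ : ℝ) * Fintype.card A * H * K / δ))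
    (hL₂ : 0 ≤ Real.log (2 * (Fintype.card S₂ : ℝ) * Fintype.card B * H * K / δ)) (x : ℝ) :
    ℙ {ω | 2 * ∑ k ∈ Finset.Icc 1 K,
          realized H D k (fun ω => (D ω).priorBonus H K δ (k - 1)) H ω +
        2 * (H * maxBonus S₁ S₂ A B H K δ) * x ≤
      ∑ k ∈ Finset.Icc 1 K, evalReward H G.P₁ G.P₂ (μ ω k) (ν ω k)
        ((D ω).priorBonus H K δ (k - 1)) H G.x₁ G.x₂} ≤ ENNReal.ofReal (Real.exp (-x)) := by
  have hmem : ∀ j < K, j + 1 ∈ Finset.Icc 1 K := fun j hj => Finset.mem_Icc.2 (by omega)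
  have hHpos : (0 : ℝ) < H := by exact_mod_cast hH
  have hMpos : 0 < maxBonus S₁ S₂ A B H K δ :=
    add_pos_of_pos_of_nonneg (Real.sqrt_pos.2 (by positivity)) (by positivity)
  have hgM := fun (k : ℕ) (ω : Ω) (h : ℕ) (_ : h < H) (s : S₁) (t : S₂) (a : A) (b : B) =>
    (D ω).priorBonus_mem hL.le hL₁ hL₂ k h s t a b
  have hgm : ∀ (m : MeasurableSpace Ω) (k : ℕ), Observed m H D k → ∀ h < H, ∀ s t a b,
      Measurable[m] fun ω => (D ω).priorBonus H K δ k h s t a b := fun m k hO h hh s t a b =>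
    (hO.measurable_bonusR hh s t a b).add
      ((hO.measurable_bonusP₁ hh s a).add (hO.measurable_bonusP₂ hh t b))
  have hpol : ∀ i j, i ≤ j → j < K → Observed (history H D (j + 1) 0) H D i := fun i j hij _ =>
    (observed_of_history_le le_rfl).mono hij
  have hcond : ∀ j < K, ℙ[realized H D (j + 1) (fun ω => (D ω).priorBonus H K δ j) H |
      history H D (j + 1) 0] =ᵐ[ℙ] fun ω => evalReward H G.P₁ G.P₂ (μ ω (j + 1)) (ν ω (j + 1))
        ((D ω).priorBonus H K δ j) H G.x₁ G.x₂ := by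
    intro j hj
    obtain ⟨h1, h2⟩ := measurable_policies hA hB hη hγ (j + 1) hj (hpol j j le_rfl hj)
    have := hp.condExp_realized (hmem j hj) (fun ω => (hA ω).isPolicy' _ hj)
      (fun ω => (hB ω).isPolicy' _ hj) h1 h2 (hgm _ j (hpol j j le_rfl hj)) hMpos.le
      (hgM j) H le_rfl
    rw [Nat.sub_self] at this
    filter_upwards [this, hp.start (j + 1) (hmem j hj)] with ω e1 e2
    rw [e1, e2.1, e2.2]
  have key := measure_sum_condExp_ge (ℙ := ℙ) (N := K) (F := fun j => history H D (j + 1) 0)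
    (X := fun j => realized H D (j + 1) (fun ω => (D ω).priorBonus H K δ j) H)
    (W := fun j ω => evalReward H G.P₁ G.P₂ (μ ω (j + 1)) (ν ω (j + 1))
        ((D ω).priorBonus H K δ j) H G.x₁ G.x₂)
    (M := H * maxBonus S₁ S₂ A B H K δ) (by positivity)
    (fun j hj => hp.history_le (hmem j hj) 0)
    (fun j hj i hij => measurable_realized (Nat.le_add_left 1 i)
      (fun h hh => historyAct_le_history_of_lt (by omega) hh (by omega))
      (hgm _ i (hpol i i le_rfl (by omega))) le_rfl)
    (fun j hj => measurable_realized (Nat.le_add_left 1 j)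
      (fun h hh => hp.historyAct_le (hmem j hj) hh) (hgm _ j (hpol j j le_rfl hj)) le_rfl)
    (fun j hj ω => realized_mem (hgM j) le_rfl ω)
    (fun j hj i hij => by
      obtain ⟨h1, h2⟩ := measurable_policies hA hB hη hγ (i + 1) (by omega) (hpol i j hij hj)
      exact measurable_evalReward G.P₁ G.P₂ h1 h2 (hgm _ i (hpol i j hij hj)) H le_rfl _ _)
    (fun j hj ω => ⟨evalReward_nonneg ((hA ω).isPolicy' _ hj) ((hB ω).isPolicy' _ hj)
        G.isSubKernel₁ G.isSubKernel₂ (fun h hh s t a b => (hgM j ω h hh s t a b).1) H le_rfl _ _,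
      evalReward_le ((hA ω).isPolicy' _ hj) ((hB ω).isPolicy' _ hj)
        G.isSubKernel₁ G.isSubKernel₂ hMpos.le (fun h hh s t a b => (hgM j ω h hh s t a b).2) H
        le_rfl _ _⟩)
    hcond x
  simpa only [sum_Icc_one_eq_sum_range, Nat.add_sub_cancel] using key

end OnPolicy

/-! ### Collecting the terms of the regret bound -/

set_option maxHeartbeats 1000000 in
/-- Final arithmetic: `6` times the bound on the expected bonuses, plus the regrets of exponential
weights, against the claimed rate. Here `s₁, s₂, a, b` are the cardinalities, `L` is the logarithm
in the statement, and `ℓ₁, ℓ₂, ℓ, ℓa, ℓb` are the other logarithms that occur. -/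
theorem regret_terms_le {s₁ s₂ a b H K L ℓ₁ ℓ₂ ℓ ℓa ℓb : ℝ} (hs₁ : 1 ≤ s₁) (hs₂ : 1 ≤ s₂)
    (ha : 1 ≤ a) (hb : 1 ≤ b) (hH : 1 ≤ H) (hK : 1 ≤ K) (hL : 1 / 2 ≤ L) (h₁ : ℓ₁ ≤ 2 * L)
    (h₂ : ℓ₂ ≤ 2 * L) (h : ℓ ≤ L) (hla : ℓa ≤ L) (hlb : ℓb ≤ L) :
    6 * (2 * (H * (Real.sqrt (4 * L) * (3 * Real.sqrt (s₁ * (s₂ * (a * b)) * K)) +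
        (Real.sqrt (2 * H ^ 2 * s₁ * ℓ₁) * (3 * Real.sqrt (s₁ * a * K)) +
          Real.sqrt (2 * H ^ 2 * s₂ * ℓ₂) * (3 * Real.sqrt (s₂ * b * K))))) +
      2 * (H * (Real.sqrt (4 * L) + (Real.sqrt (2 * H ^ 2 * s₁ * ℓ₁) +
        Real.sqrt (2 * H ^ 2 * s₂ * ℓ₂)))) * ℓ) +
      (H * (2 * H * Real.sqrt (K * ℓa) + 2 * H) + H * (2 * H * Real.sqrt (K * ℓb) + 2 * H)) ≤
    2000 * (Real.sqrt ((s₁ ^ 2 * a + s₂ ^ 2 * b) * H ^ 3) + Real.sqrt (s₁ * s₂ * a * b * H)) *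
      Real.sqrt (K * H) * L ^ 2 := by
  set q := Real.sqrt L with hq
  set R := (Real.sqrt ((s₁ ^ 2 * a + s₂ ^ 2 * b) * H ^ 3) + Real.sqrt (s₁ * s₂ * a * b * H)) *
      Real.sqrt (K * H) with hR
  have hq0 : 0 ≤ q := Real.sqrt_nonneg _
  have hqq : q * q = L := Real.mul_self_sqrt (by linarith)
  have hroot : ∀ {x y : ℝ}, 0 ≤ y → x ^ 2 = y → 0 ≤ x → Real.sqrt y = x := fun _ h hx => by
    rw [← h, Real.sqrt_sq hx]
  -- The two square roots that make up `R`.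
  have hR1 : H ^ 2 * Real.sqrt ((s₁ ^ 2 * a + s₂ ^ 2 * b) * K) + H * Real.sqrt
      (s₁ * (s₂ * (a * b)) * K) = R := by
    rw [hR, add_mul (Real.sqrt _) (Real.sqrt _), ← Real.sqrt_mul (by positivity),
      ← Real.sqrt_mul (by positivity)]
    congr 1
    · symm
      refine hroot (by positivity) ?_ (by positivity)
      rw [mul_pow, Real.sq_sqrt (by positivity)]
      ring
    · symm
      refine hroot (by positivity) ?_ (by positivity)
      rw [mul_pow, Real.sq_sqrt (by positivity)]
      ring
  set α := Real.sqrt (s₁ * (s₂ * (a * b)) * K) with hα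
  have hα0 : 0 ≤ α := Real.sqrt_nonneg _
  have hαR : H * α ≤ R := by
    rw [← hR1]
    have : 0 ≤ H ^ 2 * Real.sqrt ((s₁ ^ 2 * a + s₂ ^ 2 * b) * K) := by positivity
    linarith
  have hβ : ∀ u v : ℝ, 1 ≤ u → 1 ≤ v → u ^ 2 * v ≤ s₁ ^ 2 * a + s₂ ^ 2 * b →
      H ^ 2 * (Real.sqrt u * Real.sqrt (u * v * K)) ≤ R := by
    intro u v hu hv huv
    rw [← hR1, ← Real.sqrt_mul (by positivity)]
    have h1 : Real.sqrt (u * (u * v * K)) ≤ Real.sqrt ((s₁ ^ 2 * a + s₂ ^ 2 * b) * K) :=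
      Real.sqrt_le_sqrt (by nlinarith)
    have h2 : 0 ≤ H * α := by positivity
    have h3 := mul_le_mul_of_nonneg_left h1 (by positivity : 0 ≤ H ^ 2)
    linarith
  have hβ₁ := hβ s₁ a hs₁ ha (le_add_of_nonneg_right (by positivity))
  have hβ₂ := hβ s₂ b hs₂ hb (le_add_of_nonneg_left (by positivity))
  set β₁ := Real.sqrt (s₁ * a * K)
  set β₂ := Real.sqrt (s₂ * b * K)
  have hsqrt1 : ∀ {x : ℝ}, 1 ≤ x → 1 ≤ Real.sqrt x := fun hx => Real.one_le_sqrt.2 hx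
  have hα1 : 1 ≤ α := hsqrt1 (one_le_mul_of_one_le_of_one_le (one_le_mul_of_one_le_of_one_le hs₁
    (one_le_mul_of_one_le_of_one_le hs₂ (one_le_mul_of_one_le_of_one_le ha hb))) hK)
  have hβK : ∀ {u v : ℝ}, 1 ≤ u → 1 ≤ v → Real.sqrt K ≤ Real.sqrt (u * v * K) := fun hu hv =>
    Real.sqrt_le_sqrt (le_mul_of_one_le_left (by positivity)
      (one_le_mul_of_one_le_of_one_le hu hv))
  have hβ₁K : Real.sqrt K ≤ β₁ := hβK hs₁ ha
  have hβ₂K : Real.sqrt K ≤ β₂ := hβK hs₂ hb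
  have hK1 := hsqrt1 hK
  have hbonus : ∀ {u l : ℝ}, 1 ≤ u → l ≤ 2 * L →
      Real.sqrt (2 * H ^ 2 * u * l) ≤ 2 * H * Real.sqrt u * q := by
    intro u l hu hl
    refine Real.sqrt_le_iff.2 ⟨by positivity, ?_⟩
    have e : (2 * H * Real.sqrt u * q) ^ 2 = 2 * H ^ 2 * u * (2 * L) := by
      rw [mul_pow, mul_pow, Real.sq_sqrt (by linarith), ← hqq]
      ring
    rw [e]
    exact mul_le_mul_of_nonneg_left hl (by positivity)
  have e4 : Real.sqrt (4 * L) = 2 * q := by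
    refine hroot (by linarith) ?_ (by positivity)
    rw [← hqq]
    ring
  have g₁ := hbonus hs₁ h₁
  have g₂ := hbonus hs₂ h₂
  have hmd : ∀ {l : ℝ}, l ≤ L → Real.sqrt (K * l) ≤ Real.sqrt K * q := fun hl => by
    rw [hq, ← Real.sqrt_mul (by linarith)]
    exact Real.sqrt_le_sqrt (mul_le_mul_of_nonneg_left hl (by linarith))
  have ma := hmd hla
  have mb := hmd hlb
  rw [e4]
  set B₁ := Real.sqrt (2 * H ^ 2 * s₁ * ℓ₁)
  set B₂ := Real.sqrt (2 * H ^ 2 * s₂ * ℓ₂)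
  set r₁ := Real.sqrt s₁
  set r₂ := Real.sqrt s₂
  have hr₁ : 1 ≤ r₁ := hsqrt1 hs₁
  have hr₂ : 1 ≤ r₂ := hsqrt1 hs₂
  have hR0 : 0 ≤ R := le_trans (by positivity) hαR
  -- Each group of terms is a multiple of `R`.
  have t₀ : H * (2 * q * (3 * α)) ≤ 6 * (q * R) := by
    have := mul_le_mul_of_nonneg_left hαR hq0
    linarith
  have tβ : ∀ {B r β : ℝ}, B ≤ 2 * H * r * q → 1 ≤ β → H ^ 2 * (r * β) ≤ R →
      H * (B * (3 * β)) ≤ 6 * (q * R) := fun {B r β} hB hβ hR' => by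
    have e1 := mul_le_mul_of_nonneg_right hB (by positivity : 0 ≤ H * (3 * β))
    have e2 := mul_le_mul_of_nonneg_left hR' hq0
    linarith
  have t₁ := tβ g₁ (hK1.trans hβ₁K) hβ₁
  have t₂ := tβ g₂ (hK1.trans hβ₂K) hβ₂
  have tr : ∀ {B r β : ℝ}, B ≤ 2 * H * r * q → 1 ≤ r → 1 ≤ β → H ^ 2 * (r * β) ≤ R →
      H * B ≤ 2 * (q * R) := fun {B r β} hB hr hβ hR' => by
    have e1 := mul_le_mul_of_nonneg_left hB (by positivity : 0 ≤ H)
    have e3 : H ^ 2 * r ≤ R := le_trans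
      (mul_le_mul_of_nonneg_left (le_mul_of_one_le_right (by positivity) hβ) (by positivity)) hR'
    have e2 := mul_le_mul_of_nonneg_left e3 hq0
    linarith
  have u₁ := tr g₁ hr₁ (hK1.trans hβ₁K) hβ₁
  have u₂ := tr g₂ hr₂ (hK1.trans hβ₂K) hβ₂
  have u₀ : H * (2 * q) ≤ 2 * (q * R) := by
    have e1 : H ≤ R := (le_mul_of_one_le_right (by positivity) hα1).trans hαR
    have := mul_le_mul_of_nonneg_left e1 hq0
    linarith
  have hu : 2 * (H * (2 * q + (B₁ + B₂))) * ℓ ≤ 12 * (q * R) * L := by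
    have hB : 0 ≤ H * (2 * q + (B₁ + B₂)) := by positivity
    have e1 := mul_le_mul_of_nonneg_left h (by linarith : 0 ≤ 2 * (H * (2 * q + (B₁ + B₂))))
    have e2 : 2 * (H * (2 * q + (B₁ + B₂))) * L ≤ 12 * (q * R) * L :=
      mul_le_mul_of_nonneg_right (by linarith) (by linarith)
    exact e1.trans e2
  have hHK : H ^ 2 * Real.sqrt K ≤ R := by
    refine le_trans (mul_le_mul_of_nonneg_left ?_ (by positivity)) hβ₁
    exact hβ₁K.trans (le_mul_of_one_le_left (by positivity) hr₁)
  have tmd : ∀ {x : ℝ}, x ≤ Real.sqrt K * q → H * (2 * H * x + 2 * H) ≤ 2 * (q * R) + 2 * R :=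
    fun {x} hx => by
      have e1 := mul_le_mul_of_nonneg_left hx (by positivity : 0 ≤ 2 * H ^ 2)
      have e2 := mul_le_mul_of_nonneg_left hHK hq0
      have e3 : H ^ 2 ≤ R := (le_mul_of_one_le_right (by positivity) hK1).trans hHK
      linarith
  have va := tmd ma
  have vb := tmd mb
  have hq2 : q ≤ 2 * L := by nlinarith
  have hLL : L ≤ 2 * L ^ 2 := by nlinarith
  have w1 : q * R ≤ 4 * L ^ 2 * R := mul_le_mul_of_nonneg_right (by linarith) hR0
  have w2 : q * R * L ≤ 2 * L ^ 2 * R := by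
    have := mul_le_mul_of_nonneg_right hq2 (mul_nonneg hR0 (by linarith : 0 ≤ L))
    linarith
  have w3 : R ≤ 4 * L ^ 2 * R := le_mul_of_one_le_left hR0 (by linarith)
  have w0 : 0 ≤ L ^ 2 * R := by positivity
  have hgoal : 2000 * (Real.sqrt ((s₁ ^ 2 * a + s₂ ^ 2 * b) * H ^ 3) +
      Real.sqrt (s₁ * s₂ * a * b * H)) * Real.sqrt (K * H) * L ^ 2 = 2000 * (L ^ 2 * R) := by
    rw [hR]
    ring
  rw [hgoal]
  linarith

section Sizes

variable (S₁ S₂ A B : Type*) [Fintype S₁] [Fintype S₂] [Fintype A] [Fintype B]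
  [Nonempty S₁] [Nonempty S₂] [Nonempty A] [Nonempty B] {H K : ℕ} {δ : ℝ}

theorem one_le_card_cast (X : Type*) [Fintype X] [Nonempty X] : (1 : ℝ) ≤ Fintype.card X := by
  exact_mod_cast Fintype.card_pos

/-- If one of the players has at least two actions, then the logarithm `L` in the statement is
bounded away from zero and dominates all the others. -/
theorem log_bounds (hH : 1 ≤ H) (hK : 1 ≤ K) (hδ : 0 < δ) (hδ1 : δ < 1)
    (hAB : ¬ (Subsingleton A ∧ Subsingleton B)) :
    let L := Real.log ((Fintype.card S₁ : ℝ) * Fintype.card S₂ * Fintype.card A *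
      Fintype.card B * H * K / δ)
    let L₁ := Real.log (2 * (Fintype.card S₁ : ℝ) * Fintype.card A * H * K / δ)
    let L₂ := Real.log (2 * (Fintype.card S₂ : ℝ) * Fintype.card B * H * K / δ)
    1 / 2 ≤ L ∧ (0 ≤ L₁ ∧ L₁ ≤ 2 * L) ∧ (0 ≤ L₂ ∧ L₂ ≤ 2 * L) ∧ Real.log (1 / δ) ≤ L ∧
      Real.log (Fintype.card A) ≤ L ∧ Real.log (Fintype.card B) ≤ L := by
  intro L L₁ L₂
  have s₁ := one_le_card_cast S₁
  have s₂ := one_le_card_cast S₂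
  have a := one_le_card_cast A
  have b := one_le_card_cast B
  have hab : (2 : ℝ) ≤ Fintype.card A * Fintype.card B := by
    rcases not_and_or.1 hAB with h | h
    · have : (2 : ℝ) ≤ Fintype.card A := by
        exact_mod_cast @Fintype.one_lt_card A _ (not_subsingleton_iff_nontrivial.1 h)
      nlinarith
    · have : (2 : ℝ) ≤ Fintype.card B := by
        exact_mod_cast @Fintype.one_lt_card B _ (not_subsingleton_iff_nontrivial.1 h)
      nlinarith
  have h : (1 : ℝ) ≤ H := by exact_mod_cast hH
  have k : (1 : ℝ) ≤ K := by exact_mod_cast hK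
  have d : 1 ≤ 1 / δ := (one_le_div hδ).2 hδ1.le
  simp only [L, L₁, L₂]
  generalize (Fintype.card S₁ : ℝ) = x₁ at *
  generalize (Fintype.card S₂ : ℝ) = x₂ at *
  generalize (Fintype.card A : ℝ) = y₁ at *
  generalize (Fintype.card B : ℝ) = y₂ at *
  generalize (H : ℝ) = h' at *
  generalize (K : ℝ) = k' at *
  rw [div_eq_mul_one_div (x₁ * x₂ * y₁ * y₂ * h' * k'), div_eq_mul_one_div (2 * x₁ * y₁ * h' * k'),
    div_eq_mul_one_div (2 * x₂ * y₂ * h' * k')]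
  generalize 1 / δ = e at *
  have mul1 : ∀ {u v : ℝ}, 1 ≤ u → 1 ≤ v → 1 ≤ u * v := one_le_mul_of_one_le_of_one_le
  have hX2 : 2 ≤ x₁ * x₂ * y₁ * y₂ * h' * k' * e := by
    have h1 := mul1 (mul1 (mul1 (mul1 s₁ s₂) h) k) d
    calc (2 : ℝ) ≤ y₁ * y₂ := hab
      _ ≤ (y₁ * y₂) * (x₁ * x₂ * h' * k' * e) := le_mul_of_one_le_right (by positivity) h1
      _ = _ := by ring
  set X := x₁ * x₂ * y₁ * y₂ * h' * k' * e with hX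
  have hle : ∀ {u v : ℝ}, 0 < u → 1 ≤ v → u * v = X → Real.log u ≤ Real.log X :=
    fun hu hv huv => Real.log_le_log hu (huv ▸ le_mul_of_one_le_right hu.le hv)
  -- `2 u ≤ X ^ 2` for every factor `u` of `X` with cofactor at least `1`, because `2 ≤ X`.
  have hle2 : ∀ {u v : ℝ}, 1 ≤ u → 1 ≤ v → u * v = X → 0 ≤ Real.log (2 * u) ∧
      Real.log (2 * u) ≤ 2 * Real.log X := fun {u v} hu hv huv => by
    refine ⟨Real.log_nonneg (by linarith), ?_⟩
    have e2 : 2 * Real.log X = Real.log (X ^ 2) := by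
      rw [Real.log_pow]
      norm_num
    rw [e2]
    refine Real.log_le_log (by linarith) ?_
    have : u ≤ X := huv ▸ le_mul_of_one_le_right (by linarith) hv
    nlinarith
  have e1 : 2 * x₁ * y₁ * h' * k' * e = 2 * (x₁ * y₁ * h' * k' * e) := by ring
  have e2 : 2 * x₂ * y₂ * h' * k' * e = 2 * (x₂ * y₂ * h' * k' * e) := by ring
  rw [e1, e2]
  refine ⟨?_, hle2 (mul1 (mul1 (mul1 (mul1 s₁ a) h) k) d) (mul1 s₂ b) (by rw [hX]; ring),
    hle2 (mul1 (mul1 (mul1 (mul1 s₂ b) h) k) d) (mul1 s₁ a) (by rw [hX]; ring),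
    hle (by linarith) (mul1 (mul1 (mul1 (mul1 (mul1 s₁ s₂) a) b) h) k) (by rw [hX]; ring),
    hle (by linarith) (mul1 (mul1 (mul1 (mul1 (mul1 s₁ s₂) b) h) k) d) (by rw [hX]; ring),
    hle (by linarith) (mul1 (mul1 (mul1 (mul1 (mul1 s₁ s₂) a) h) k) d) (by rw [hX]; ring)⟩
  have h1 := Real.log_le_log (by norm_num) hX2
  linarith [Real.log_two_gt_d9]

end Sizes

section Main

variable {S₁ S₂ A B Ω : Type*} [Fintype S₁] [Fintype S₂] [Fintype A] [Fintype B]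
  [DecidableEq S₁] [DecidableEq S₂] [DecidableEq A] [DecidableEq B]

theorem sum_realized_le {D : Ω → Record S₁ S₂ A B} {H K : ℕ} {δ Z : ℝ} {ω : Ω}
    (hZ : ∀ h, ∑ k ∈ Finset.Icc 1 K, (D ω).priorBonus H K δ (k - 1) h ((D ω).s₁ k h)
      ((D ω).s₂ k h) ((D ω).a k h) ((D ω).b k h) ≤ Z) :
    ∑ k ∈ Finset.Icc 1 K, realized H D k (fun ω => (D ω).priorBonus H K δ (k - 1)) H ω ≤
      H * Z := by
  simp only [realized]
  rw [Finset.sum_comm]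
  refine (Finset.sum_le_sum fun i _ => hZ (H - (i + 1))).trans (le_of_eq ?_)
  simp

end Main

end FactoredMG

end

theorem corollary1 :
    ∃ (c : ℝ) (p : ℕ), 0 < c ∧
      ∀ (S₁ S₂ A B : Type*) [Fintype S₁] [Fintype S₂] [Fintype A] [Fintype B]
        [DecidableEq S₁] [DecidableEq S₂] [DecidableEq A] [DecidableEq B]
        [Nonempty A] [Nonempty B]
        (H K : ℕ) (_ : 1 ≤ H) (_ : 1 ≤ K) (δ : ℝ) (_ : 0 < δ) (_ : δ < 1)
        (G : FactoredMG.Game S₁ S₂ A B H)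
        (η γ : ℝ)
        (_ : η = Real.sqrt (Real.log (Fintype.card A) / (K * (H : ℝ) ^ 2)))
        (_ : γ = Real.sqrt (Real.log (Fintype.card B) / (K * (H : ℝ) ^ 2)))
        (Ω : Type*) [MeasurableSpace Ω] (ℙ : MeasureTheory.Measure Ω)
        [MeasureTheory.IsProbabilityMeasure ℙ]
        (D : Ω → FactoredMG.Record S₁ S₂ A B)
        (μ : Ω → ℕ → FactoredMG.Policy S₁ A) (ν : Ω → ℕ → FactoredMG.Policy S₂ B)
        (_ : ∀ ω, FactoredMG.IsAlgorithm₁ H K δ η G.x₂ (D ω) (μ ω) (ν ω))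
        (_ : ∀ ω, FactoredMG.IsAlgorithm₂ H K δ γ G.x₁ (D ω) (μ ω) (ν ω))
        (_ : FactoredMG.IsPlay ℙ G K D μ ν)
        (T : ℝ) (_ : T = K * H)
        (C : ℝ) (_ : C =
          Real.sqrt (((Fintype.card S₁ : ℝ) ^ 2 * Fintype.card A +
              (Fintype.card S₂ : ℝ) ^ 2 * Fintype.card B) * (H : ℝ) ^ 3) +
            Real.sqrt ((Fintype.card S₁ : ℝ) * Fintype.card S₂ * Fintype.card A *
              Fintype.card B * H)),
        ENNReal.ofReal (1 - 8 * δ) ≤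
          ℙ {ω | G.gap K (μ ω) (ν ω) ≤
            c * C * Real.sqrt T *
              Real.log ((Fintype.card S₁ : ℝ) * Fintype.card S₂ * Fintype.card A *
                Fintype.card B * H * K / δ) ^ p} := by
  refine ⟨2000, 2, by norm_num, ?_⟩
  intro S₁ S₂ A B _ _ _ _ _ _ _ _ _ _ H K hH hK δ hδ hδ1 G η γ hη hγ Ω _ ℙ _ D μ ν hA hB hp
    T hT C hC
  subst hT hC
  by_cases hAB : Subsingleton A ∧ Subsingleton B
  · have := hAB.1
    have := hAB.2
    -- The logarithm may be arbitrarily small here, but there is only one pair of policies, and the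
    -- gap is not positive.
    refine le_trans (ENNReal.ofReal_le_one.2 (by linarith)) (le_of_eq ?_)
    rw [← measure_univ (μ := ℙ)]
    refine congrArg ℙ (Set.eq_univ_of_forall fun ω => ?_).symm
    exact (FactoredMG.gap_nonpos_of_subsingleton (hA ω).isPolicy' (hB ω).isPolicy').trans
      (by positivity)
  have : Nonempty S₁ := ⟨G.x₁⟩
  have : Nonempty S₂ := ⟨G.x₂⟩
  obtain ⟨hL, ⟨hL₁, hL₁'⟩, ⟨hL₂, hL₂'⟩, hx, ha, hb⟩ :=
    FactoredMG.log_bounds S₁ S₂ A B hH hK hδ hδ1 hAB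
  obtain ⟨bad, hbad, hgood⟩ := hp.exists_concentrated hδ hδ1 hL hH hK
  have hdev := hp.measure_expected_bonus_ge hA hB (FactoredMG.stepSize_pos hK hH hη)
    (FactoredMG.stepSize_pos hK hH hγ) hH (by linarith) hL₁ hL₂ (Real.log (1 / δ))
  have hexp : Real.exp (-Real.log (1 / δ)) = δ := by
    rw [one_div, Real.log_inv, neg_neg, Real.exp_log hδ]
  rw [hexp] at hdev
  obtain ⟨dev, hdev, hsum⟩ : ∃ dev : Set Ω, ℙ dev ≤ ENNReal.ofReal δ ∧ ∀ ω ∉ dev,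
      ∑ k ∈ Finset.Icc 1 K, FactoredMG.evalReward H G.P₁ G.P₂ (μ ω k) (ν ω k)
          ((D ω).priorBonus H K δ (k - 1)) H G.x₁ G.x₂ <
        2 * ∑ k ∈ Finset.Icc 1 K, FactoredMG.realized H D k
            (fun ω => (D ω).priorBonus H K δ (k - 1)) H ω +
          2 * (H * FactoredMG.maxBonus S₁ S₂ A B H K δ) * Real.log (1 / δ) :=
    ⟨_, hdev, fun ω hω => not_le.1 hω⟩
  set good : Set Ω := {ω | G.gap K (μ ω) (ν ω) ≤ _}
  have hcover : Set.univ ⊆ good ∪ (bad ∪ dev) := by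
    intro ω _
    by_contra hω
    simp only [Set.mem_union, not_or] at hω
    obtain ⟨h1, h2, h3⟩ := hω
    refine h1 ?_
    have hgap := FactoredMG.gap_le_of_concentrated hK hH hη hγ (hA ω) (hB ω) (hgood ω h2)
    have hmono : ∑ k ∈ Finset.Icc 1 K, FactoredMG.evalReward H G.P₁ G.P₂ (μ ω k) (ν ω k)
          ((D ω).bonus H K δ k) H G.x₁ G.x₂ ≤
        ∑ k ∈ Finset.Icc 1 K, FactoredMG.evalReward H G.P₁ G.P₂ (μ ω k) (ν ω k)
          ((D ω).priorBonus H K δ (k - 1)) H G.x₁ G.x₂ :=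
      Finset.sum_le_sum fun k hk => FactoredMG.evalReward_mono
        ((hA ω).isPolicy' k (Finset.mem_Icc.1 hk).2) ((hB ω).isPolicy' k (Finset.mem_Icc.1 hk).2)
        G.isSubKernel₁ G.isSubKernel₂ (fun h _ s t a b =>
          (D ω).bonus_le_priorBonus (by linarith) hL₁ hL₂ (Finset.mem_Icc.1 hk).1 h s t a b)
        H le_rfl _ _
    have hreal := FactoredMG.sum_realized_le
      (fun h => (D ω).sum_priorBonus_le (by linarith) hL₁ hL₂ h)
    have hlt := hsum ω h3
    have hfin := FactoredMG.regret_terms_le (FactoredMG.one_le_card_cast S₁)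
      (FactoredMG.one_le_card_cast S₂) (FactoredMG.one_le_card_cast A)
      (FactoredMG.one_le_card_cast B) (Nat.one_le_cast.2 hH) (Nat.one_le_cast.2 hK) hL hL₁' hL₂'
      hx ha hb
    refine le_trans ?_ hfin
    push_cast at hreal
    rw [FactoredMG.maxBonus] at hlt
    linarith
  have h1 : (1 : ENNReal) ≤ ℙ good + (ENNReal.ofReal (4 * δ) + ENNReal.ofReal δ) := by
    rw [← measure_univ (μ := ℙ)]
    exact (measure_mono hcover).trans ((measure_union_le _ _).trans
      (add_le_add le_rfl ((measure_union_le _ _).trans (add_le_add hbad hdev))))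
  rw [← ENNReal.ofReal_add (by linarith) hδ.le] at h1
  refine le_trans ?_ (tsub_le_iff_right.2 h1)
  rw [← ENNReal.ofReal_one, ← ENNReal.ofReal_sub _ (by linarith)]
  exact ENNReal.ofReal_le_ofReal (by linarith)
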